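/- **Setting.** Let $D,L\ge 1$ be integers, $\Lambda=\{0,\dots,L\}^D$ with the Manhattan distance (with or without periodic boundary condition), and $N=(L+1)^D$. On $(\mathbb C^2)^{\otimes\Lambda}$ consider $$H=-\sum_{i\in\Lambda}Z_i+\varepsilon\sum_{j\in\Lambda}h_j,\qquad h_j=h_j^\dagger,\quad \|h_j\|\le 1,$$ where $(h_j)$ is $(r_0,l)$-geometrically local with integers $r_0,l\ge1$: $h_j$ is supported on the ball of radius $r_0$ around $j$, and each site is acted on non-trivially by at most $l$ of the $h_j$. Let $\hat f(\omega)=\hat u(\omega/8)\,\hat v(2\omega)$, where for some $\alpha>1$ and $A_{1,u},A_{2,u},A_{1,v},A_{2,v}>0$ the functions $\hat u:\mathbb R\to[0,\infty)$ and $\hat v:\mathbb R\to\mathbb C$ are smooth with $|\hat u^{(n)}(\omega)|\le A_{1,u}A_{2,u}^n n^{n\alpha}$ and $|\hat v^{(n)}(\omega)|\le A_{1,v}A_{2,v}^n n^{n\alpha}$ for all $n\ge 0$, $\omega\in\mathbb R$ (with $0^0=1$); $\operatorname{supp}\hat u\subset[-1,1]$, $\hat u$ is bounded below by a positive constant on $[-\frac12,\frac12]$,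 $\hat u(-\frac14)=1$; $\hat v'\in L^1(\mathbb R)$, $\operatorname{supp}\hat v\subset(-\infty,0]$, $\hat v(-4)=1$. Put $$f(s)=\frac1{2\pi}\int_{\mathbb R}\hat f(\omega)e^{-i\omega s}\,d\omega,\qquad K_i=\int_{\mathbb R} f(s)\,e^{iHs}X_ie^{-iHs}\,ds,\qquad \mathcal L[\rho]=\sum_{i\in\Lambda}\Big(K_i\rho K_i^\dagger-\tfrac12\{K_i^\dagger K_i,\rho\}\Big).$$ **Theorem.** There are absolute constants $a,C>0$ and, for all $\alpha,A_{1,u},A_{2,u},A_{1,v},A_{2,v}$ and $D$ as above, a constant $c>0$ depending only on these, such that the following holds with $$\varepsilon^*=c\,(r_0l)^{-aD},$$ which is independent of $N$. For all $r_0,l,L$, all $(h_j)$ and all $\hat u,\hat v$ as above, if $|\varepsilon|<\varepsilon^*$ and $\psi_0$ is a normalized ground state of $H$ (an eigenvector for the lowest eigenvalue), then for every $0<\eta\le1$, every $t\ge C\log(N/\eta)$ and every density matrix $\rho$, $$\big\|e^{t\mathcal L}\rho-|\psi_0\rangle\langle\psi_0|\big\|_1\le\eta ,$$ where $\|A\|_1=\operatorname{Tr}\sqrt{A^\dagger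 A}$. (In particular the ground state is unique up to a phase.) -/

import Mathlib

open scoped Matrix Matrix.Norms.L2Operator MatrixOrder ComplexOrder

noncomputable section

namespace GroundStatePrep

/-! ### The lattice -/

/-- The sites of the lattice `[0, L]^D`. -/
abbrev Site (D L : ℕ) : Type := Fin D → Fin (L + 1)

/-- Distance of two coordinates in `{0, …, L}`, on a segment or (if `periodic`) on a cycle of
length `L + 1`. -/
def coordDist (periodic : Bool) {L : ℕ} (a b : Fin (L + 1)) : ℕ :=
  if periodic then min ((a : ℤ) - (b : ℤ)).natAbs (L + 1 - ((a : ℤ) - (b : ℤ)).natAbs)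
  else ((a : ℤ) - (b : ℤ)).natAbs

/-- The Manhattan distance on the lattice, with or without periodic boundary condition. -/
def manhattanDist (periodic : Bool) {D L : ℕ} (i j : Site D L) : ℕ :=
  ∑ k, coordDist periodic (i k) (j k)

/-- The ball of radius `r` around the site `j`. -/
def siteBall (periodic : Bool) {D L : ℕ} (j : Site D L) (r : ℕ) : Set (Site D L) :=
  {i | manhattanDist periodic i j ≤ r}

/-! ### Operators on the spin system -/

/-- Operators on `(ℂ²)^{⊗ Λ}` as matrices in the computational basis, which is indexed by the
configurations `Λ → {0, 1}`. The norm `‖·‖` is the operator norm for the Euclidean norm. -/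
abbrev Op (Λ : Type) : Type := Matrix (Λ → Fin 2) (Λ → Fin 2) ℂ

section Spin

variable {Λ : Type} [Fintype Λ] [DecidableEq Λ]

open Classical in
/-- `A = B ⊗ 1` with `B` an operator on the spins in `S` and `1` the identity on the others. -/
def IsSupportedOn (S : Set Λ) (A : Op Λ) : Prop :=
  ∃ B : Op S, ∀ x y : Λ → Fin 2,
    A x y = if ∀ i, i ∉ S → x i = y i then B (fun i => x i) (fun i => y i) else 0

/-- The site `i` appears in `A`: the operator `A` acts non-trivially on the spin at `i`. -/
def ActsOn (i : Λ) (A : Op Λ) : Prop := ¬ IsSupportedOn {i}ᶜ A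

/-- The single-spin operator `M` at site `i`, tensored with the identity on all other sites. -/
def onSite (i : Λ) (M : Matrix (Fin 2) (Fin 2) ℂ) : Op Λ :=
  Matrix.of fun x y => if ∀ k, k ≠ i → x k = y k then M (x i) (y i) else 0

def pauliX (i : Λ) : Op Λ := onSite i !![0, 1; 1, 0]

def pauliZ (i : Λ) : Op Λ := onSite i !![1, 0; 0, -1]

/-- `H_ε = - ∑ Z_i + ε ∑ h_j`. -/
def hamiltonian (ε : ℝ) (h : Λ → Op Λ) : Op Λ :=
  -∑ i, pauliZ i + (ε : ℂ) • ∑ j, h j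

/-- `ψ` is a normalized eigenvector of `H` for its lowest eigenvalue. -/
def IsGroundState (H : Op Λ) (ψ : (Λ → Fin 2) → ℂ) : Prop :=
  star ψ ⬝ᵥ ψ = 1 ∧ ∃ E : ℝ, H *ᵥ ψ = (E : ℂ) • ψ ∧
    ∀ (μ : ℝ) (φ : (Λ → Fin 2) → ℂ), φ ≠ 0 → H *ᵥ φ = (μ : ℂ) • φ → E ≤ μ

/-- The rank-one operator `|ψ⟩⟨ψ|`. -/
def pureState (ψ : (Λ → Fin 2) → ℂ) : Op Λ := Matrix.vecMulVec ψ (star ψ)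

/-- Density matrices. -/
def IsState (ρ : Op Λ) : Prop := ρ.PosSemidef ∧ ρ.trace = 1

/-- The trace norm `‖A‖₁ = Tr √(A† A)`. -/
def traceNorm (A : Op Λ) : ℝ := (CFC.sqrt (Aᴴ * A)).trace.re

/-! ### The Lindblad dynamics -/

/-- The jump operator `K = ∫ f(s) e^{iHs} A e^{-iHs} ds`. -/
def jumpOp (f : ℝ → ℂ) (H A : Op Λ) : Op Λ :=
  ∫ s : ℝ, f s • (NormedSpace.exp ((Complex.I * (s : ℂ)) • H) * A *
    NormedSpace.exp ((-(Complex.I * (s : ℂ))) • H))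

/-- The dissipator `ρ ↦ K ρ K† - ½ {K† K, ρ}`. -/
def dissipator (K : Op Λ) : Op Λ →ₗ[ℂ] Op Λ :=
  LinearMap.mulLeftRight ℂ (K, Kᴴ) -
    (1 / 2 : ℂ) • (LinearMap.mulLeft ℂ (Kᴴ * K) + LinearMap.mulRight ℂ (Kᴴ * K))

/-- The Lindbladian without coherent term, with one jump operator for each coupling operator
`X_i`. -/
def lindbladian (f : ℝ → ℂ) (H : Op Λ) : Op Λ →L[ℂ] Op Λ :=
  LinearMap.toContinuousLinearMap (∑ i : Λ, dissipator (jumpOp f H (pauliX i)))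

/-- The evolved state `e^{t𝓛} ρ`. -/
def evolve (f : ℝ → ℂ) (H : Op Λ) (t : ℝ) (ρ : Op Λ) : Op Λ :=
  NormedSpace.exp ((t : ℂ) • lindbladian f H) ρ

end Spin

/-- The family `(h_j)` of self-adjoint terms is `(r, l)`-geometrically local: `h_j` is supported on
the ball of radius `r` around `j`, and each site appears in at most `l` of the terms. -/
structure IsGeometricallyLocal (periodic : Bool) {D L : ℕ} (r l : ℕ)
    (h : Site D L → Op (Site D L)) : Prop where
  hermitian : ∀ j, (h j).IsHermitian
  supported : ∀ j, IsSupportedOn (siteBall periodic j r) (h j)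
  overlap : ∀ i, {j | ActsOn i (h j)}.ncard ≤ l

/-! ### The filter function -/

/-- The Gevrey class `𝒢^s_{C₁,C₂}(ℝ)`; here `0 ^ 0 = 1`. -/
def IsGevrey {E : Type*} [NormedAddCommGroup E] [NormedSpace ℝ E] (s C₁ C₂ : ℝ) (g : ℝ → E) :
    Prop :=
  ContDiff ℝ (⊤ : ℕ∞) g ∧ ∀ (n : ℕ) (ω : ℝ), ‖iteratedDeriv n g ω‖ ≤ C₁ * C₂ ^ n * (n : ℝ) ^ (n * s)

/-- The frequency-domain filter `f̂(ω) = û(ω/8) v̂(2ω)`. -/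
def filterHat (u : ℝ → ℝ) (v : ℝ → ℂ) (ω : ℝ) : ℂ := (u (ω / 8) : ℂ) * v (2 * ω)

/-- The time-domain filter `f(s) = (2π)⁻¹ ∫ f̂(ω) e^{-iωs} dω`. -/
def filterTime (u : ℝ → ℝ) (v : ℝ → ℂ) (s : ℝ) : ℂ :=
  (1 / (2 * Real.pi) : ℂ) * ∫ ω : ℝ, filterHat u v ω * Complex.exp (-(Complex.I * ω * s))

/-- The conditions on the two factors `û`, `v̂` of the filter function. -/
structure FilterAssumption (α A₁u A₂u A₁v A₂v : ℝ) (u : ℝ → ℝ) (v : ℝ → ℂ) : Prop where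
  gevrey_u : IsGevrey α A₁u A₂u u
  nonneg_u : ∀ ω, 0 ≤ u ω
  supp_u : tsupport u ⊆ Set.Icc (-1) 1
  lower_u : ∃ c > 0, ∀ ω ∈ Set.Icc (-(1 / 2) : ℝ) (1 / 2), c ≤ u ω
  value_u : u (-(1 / 4)) = 1
  gevrey_v : IsGevrey α A₁v A₂v v
  deriv_v : MeasureTheory.Integrable (deriv v)
  supp_v : tsupport v ⊆ Set.Iic 0
  value_v : v (-4) = 1

end GroundStatePrep

end

noncomputable section

set_option linter.unusedSimpArgs false
set_option linter.unusedSectionVars false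

namespace GroundStatePrep

/-! ### Completely positive maps on a C⋆-algebra -/

section CStar

variable {𝒜 : Type*} [CStarAlgebra 𝒜]

/-! The proof works in the Heisenberg picture and measures an observable O by the sum over sites i
of ‖osc_i O‖, where osc_i O = O - ⟨0|O|0⟩_i ⊗ 1. Every O lies within this sum of a scalar, and
scalars do not see the difference of two states. It therefore suffices that the adjoint dynamics
contracts the sum at a rate independent of N.

At ε = 0 the operator X_i = a_i + a_i† carries the frequencies -2 and +2. Since f̂(-2) = 1 and f̂(2)
= 0, K_i is the lowering operator a_i. On the range of osc_i its adjoint generator is -(3 + Z·Z)/4,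
which contracts at rate at least 3/4 - 1/4 = 1/2 in operator norm (`IsLowering.heisenberg_osc`). The
dissipators of the other sites commute with osc_i and are contractive, so they do no harm.

For small ε, K_j is a_j plus a quasi-local correction of size O(|ε|) (`IsWeaklyCoupled.jump_bound`).
Smoothness and compact support of f̂ give f finite polynomial moments. A Lieb–Robinson bound
controls the oscillations of the evolved X_j away from j, and comparison with the free evolution
controls the whole operator. Expanding K_j into localized pieces shows that the correction feeds at
most 1/4 of the oscillation sum back into it (`IsSpinSystem.sum_norm_oscDefect_le`), which leaves
the rate 1/4 (`IsSpinSystem.exists_sum_norm_osc_le`). For i ≠ j the perturbed dissipator of K_j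
acting on osc_i O is never estimated as a perturbation: it is kept whole and its contractivity is
used.

Since f̂ vanishes on [0, ∞), every K_j annihilates any ground state, whose projector is then a fixed
point. All one-step estimates hold for 1 + h𝓛† up to O(h²) and pass to the semigroup by Euler
products, giving the distance 4N e^{-t/4}. -/

theorem norm_one_le_one : ‖(1 : 𝒜)‖ ≤ 1 := by
  rcases subsingleton_or_nontrivial 𝒜 with h | h
  · simp [Subsingleton.elim (1 : 𝒜) 0]
  · exact CStarRing.norm_one.le

/-- A completely positive map with two Kraus operators is bounded by the norm of its value at `1`. -/
theorem norm_kraus_pair_le (A V W : 𝒜) {c : ℝ} (hc : 0 < c)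
    (h : ‖star V * V + star W * W‖ ≤ c) :
    ‖star V * A * V + star W * A * W‖ ≤ c * ‖A‖ := by
  let _ := CStarAlgebra.spectralOrder 𝒜
  have _ := CStarAlgebra.spectralOrderedRing 𝒜
  set m := star V * V + star W * W with hm
  set T := star V * A * V + star W * A * W with hT
  have hm0 : 0 ≤ m := add_nonneg (star_mul_self_nonneg V) (star_mul_self_nonneg W)
  have hmc : m ≤ algebraMap ℝ 𝒜 c :=
    (IsSelfAdjoint.le_algebraMap_norm_self (IsSelfAdjoint.of_nonneg hm0)).trans
      (by simpa using (algebraMap_mono 𝒜 h))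
  set S := star (A * V) * (A * V) + star (A * W) * (A * W) with hS
  have hS0 : 0 ≤ S := add_nonneg (star_mul_self_nonneg _) (star_mul_self_nonneg _)
  have hSle : ‖S‖ ≤ ‖A‖ ^ 2 * c := by
    have h1 : S = star V * (star A * A) * V + star W * (star A * A) * W := by
      simp only [hS, star_mul, mul_assoc]
    have h2 : star A * A ≤ algebraMap ℝ 𝒜 (‖A‖ ^ 2) := by
      have := IsSelfAdjoint.le_algebraMap_norm_self (IsSelfAdjoint.star_mul_self A)
      rwa [CStarRing.norm_star_mul_self, ← sq] at this
    have h3 : S ≤ (‖A‖ ^ 2) • m := by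
      have e : (‖A‖ ^ 2) • m = star V * (algebraMap ℝ 𝒜 (‖A‖ ^ 2)) * V
          + star W * (algebraMap ℝ 𝒜 (‖A‖ ^ 2)) * W := by
        simp only [hm, Algebra.algebraMap_eq_smul_one, mul_smul_comm, smul_mul_assoc, mul_one,
          smul_add]
      rw [h1, e]
      exact add_le_add (star_left_conjugate_le_conjugate h2 V)
        (star_left_conjugate_le_conjugate h2 W)
    calc ‖S‖ ≤ ‖(‖A‖ ^ 2) • m‖ := CStarAlgebra.norm_le_norm_of_nonneg_of_le hS0 h3
      _ = ‖A‖ ^ 2 * ‖m‖ := by rw [norm_smul, Real.norm_of_nonneg (by positivity)]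
      _ ≤ _ := by gcongr
  -- A Kadison–Schwarz inequality, proved by writing the difference of the two sides as two squares
  -- plus the nonnegative term T†(c - m)T.
  have key : c • (star T * T) ≤ (c ^ 2) • S := by
    have e : (c ^ 2) • S - c • (star T * T) =
        star (c • (A * V) - V * T) * (c • (A * V) - V * T) +
        star (c • (A * W) - W * T) * (c • (A * W) - W * T) +
        star T * (algebraMap ℝ 𝒜 c - m) * T := by
      have hTs : star T = star (A * V) * V + star (A * W) * W := by
        simp only [hT, star_add, star_mul, star_star, mul_assoc]
      have hT2 : star T * T = star (A * V) * V * T + star (A * W) * W * T := by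
        rw [← add_mul, ← hTs]
      have hT3 : star T * T = star T * (star V * (A * V)) + star T * (star W * (A * W)) := by
        rw [← mul_add, ← mul_assoc, ← mul_assoc, ← hT]
      clear_value T
      simp only [Algebra.algebraMap_eq_smul_one, star_sub, star_smul, mul_sub, sub_mul, hm, hS,
        mul_add, add_mul, smul_mul_assoc, mul_smul_comm, mul_one, smul_add, star_mul,
        star_trivial, mul_assoc, pow_two, mul_smul] at hT2 hT3 ⊢
      linear_combination (norm := module) (-c) • hT2 - c • hT3
    rw [← sub_nonneg, e]
    refine add_nonneg (add_nonneg (star_mul_self_nonneg _) (star_mul_self_nonneg _)) ?_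
    exact star_left_conjugate_nonneg (sub_nonneg.2 hmc) T
  have h4 : c * ‖T‖ ^ 2 ≤ c ^ 2 * (‖A‖ ^ 2 * c) := by
    have h5 := CStarAlgebra.norm_le_norm_of_nonneg_of_le
      (smul_nonneg hc.le (star_mul_self_nonneg T)) key
    rw [norm_smul, norm_smul, Real.norm_of_nonneg hc.le, Real.norm_of_nonneg (by positivity),
      CStarRing.norm_star_mul_self, ← sq] at h5
    exact h5.trans (by gcongr)
  have h6 : ‖T‖ ^ 2 ≤ (c * ‖A‖) ^ 2 := by
    have : c * ‖T‖ ^ 2 ≤ c * (c * ‖A‖) ^ 2 := by nlinarith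
    exact le_of_mul_le_mul_left this hc
  exact le_of_sq_le_sq h6 (by positivity)

/-- The polarized dissipator in the Heisenberg picture. -/
def heisenberg (S T O : 𝒜) : 𝒜 :=
  star S * O * T - (1 / 2 : ℂ) • (star S * T * O + O * (star S * T))

theorem norm_heisenberg_le (S T O : 𝒜) : ‖heisenberg S T O‖ ≤ 2 * ‖S‖ * ‖T‖ * ‖O‖ := by
  have h1 : ‖star S * O * T‖ ≤ ‖S‖ * ‖O‖ * ‖T‖ := by
    refine (norm_mul_le _ _).trans ?_
    gcongr
    exact (norm_mul_le _ _).trans (by rw [norm_star])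
  have h0 : ‖star S * T‖ ≤ ‖S‖ * ‖T‖ := (norm_mul_le _ _).trans (by rw [norm_star])
  have h2 : ‖star S * T * O‖ ≤ ‖S‖ * ‖T‖ * ‖O‖ := (norm_mul_le _ _).trans (by gcongr)
  have h3 : ‖O * (star S * T)‖ ≤ ‖O‖ * (‖S‖ * ‖T‖) := (norm_mul_le _ _).trans (by gcongr)
  have h4 : ‖(1 / 2 : ℂ) • (star S * T * O + O * (star S * T))‖ ≤
      1 / 2 * (‖S‖ * ‖T‖ * ‖O‖ + ‖O‖ * (‖S‖ * ‖T‖)) := by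
    rw [norm_smul]
    have : ‖(1 / 2 : ℂ)‖ = 1 / 2 := by norm_num
    rw [this]
    gcongr
    exact (norm_add_le _ _).trans (add_le_add h2 h3)
  calc _ ≤ _ := norm_sub_le _ _
    _ ≤ _ := add_le_add h1 h4
    _ = _ := by ring

theorem heisenberg_add_left (S S' T O : 𝒜) :
    heisenberg (S + S') T O = heisenberg S T O + heisenberg S' T O := by
  simp only [heisenberg, star_add, add_mul, mul_add]; module

theorem heisenberg_add_mid (S T T' O : 𝒜) :
    heisenberg S (T + T') O = heisenberg S T O + heisenberg S T' O := by
  simp only [heisenberg, add_mul, mul_add]; module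

theorem heisenberg_sub (S T O O' : 𝒜) :
    heisenberg S T (O - O') = heisenberg S T O - heisenberg S T O' := by
  simp only [heisenberg, sub_mul, mul_sub]; module

theorem heisenberg_zero_left (T O : 𝒜) : heisenberg 0 T O = 0 := by simp [heisenberg]

theorem heisenberg_zero_mid (S O : 𝒜) : heisenberg S 0 O = 0 := by simp [heisenberg]

theorem heisenberg_sum_left {ι : Type*} (s : Finset ι) (S : ι → 𝒜) (T O : 𝒜) :
    heisenberg (∑ i ∈ s, S i) T O = ∑ i ∈ s, heisenberg (S i) T O := by
  classical
  induction s using Finset.induction_on with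
  | empty => simp [heisenberg_zero_left]
  | insert a s ha ih => rw [Finset.sum_insert ha, Finset.sum_insert ha, heisenberg_add_left, ih]

theorem heisenberg_sum_mid {ι : Type*} (s : Finset ι) (S : 𝒜) (T : ι → 𝒜) (O : 𝒜) :
    heisenberg S (∑ i ∈ s, T i) O = ∑ i ∈ s, heisenberg S (T i) O := by
  classical
  induction s using Finset.induction_on with
  | empty => simp [heisenberg_zero_mid]
  | insert a s ha ih => rw [Finset.sum_insert ha, Finset.sum_insert ha, heisenberg_add_mid, ih]

theorem heisenberg_eq_zero {S T O : 𝒜} (hS : Commute O (star S)) (hT : Commute O T) :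
    heisenberg S T O = 0 := by
  have h1 : star S * O * T = star S * T * O := by rw [mul_assoc, hT.eq, mul_assoc]
  have h2 : O * (star S * T) = star S * T * O := by
    rw [← mul_assoc, hS.eq, h1]
  rw [heisenberg, h1, h2]; module

/-- Up to second order, `1 + h 𝓛†` is a contraction, for one jump operator. -/
theorem norm_add_heisenberg_le (K A : 𝒜) {h : ℝ} (hh : 0 ≤ h) :
    ‖A + (h : ℂ) • heisenberg K K A‖ ≤ (1 + h ^ 2 * ‖K‖ ^ 4 / 2) * ‖A‖ := by
  have hn : ‖star K * K‖ = ‖K‖ ^ 2 := by rw [CStarRing.norm_star_mul_self, sq]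
  set G := star K * K with hG
  have hGs : star G = G := by simp [hG]
  -- Kraus operators of a short time step: 1 - hG/2 for no jump and √h K for a jump. They reproduce
  -- 1 + h𝓛† up to (h²/4) GAG, and they are normalized up to (h²/4) G².
  set V : 𝒜 := 1 - ((h / 2 : ℝ) : ℂ) • G with hV
  set W : 𝒜 := ((Real.sqrt h : ℝ) : ℂ) • K with hW
  have hsq : ((Real.sqrt h : ℝ) : ℂ) * ((Real.sqrt h : ℝ) : ℂ) = h := by
    rw [← Complex.ofReal_mul, Real.mul_self_sqrt hh]
  have hVs : star V = V := by
    simp only [hV, star_sub, star_one, star_smul, hGs, Complex.star_def, Complex.conj_ofReal]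
  have hWs : star W = ((Real.sqrt h : ℝ) : ℂ) • star K := by
    simp only [hW, star_smul, Complex.star_def, Complex.conj_ofReal]
  have e1 : star V * V + star W * W = 1 + ((h ^ 2 / 4 : ℝ) : ℂ) • (G * G) := by
    rw [hVs, hWs]
    simp only [hV, hW, smul_mul_assoc, mul_smul_comm, smul_smul, hsq, mul_sub, sub_mul, one_mul,
      mul_one, ← hG]
    push_cast
    module
  have e2 : A + (h : ℂ) • heisenberg K K A =
      (star V * A * V + star W * A * W) - ((h ^ 2 / 4 : ℝ) : ℂ) • (G * A * G) := by
    rw [hVs, hWs]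
    simp only [hV, hW, heisenberg, smul_mul_assoc, mul_smul_comm, smul_smul, hsq, mul_sub,
      sub_mul, one_mul, mul_one, ← hG]
    push_cast
    module
  have n1 : ‖star V * V + star W * W‖ ≤ 1 + h ^ 2 / 4 * ‖K‖ ^ 4 := by
    rw [e1]
    refine (norm_add_le _ _).trans (add_le_add norm_one_le_one ?_)
    rw [norm_smul, Complex.norm_real, Real.norm_of_nonneg (by positivity)]
    gcongr
    calc _ ≤ _ := norm_mul_le _ _
      _ = _ := by rw [hn]; ring
  have n2 : ‖((h ^ 2 / 4 : ℝ) : ℂ) • (G * A * G)‖ ≤ h ^ 2 / 4 * ‖K‖ ^ 4 * ‖A‖ := by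
    rw [norm_smul, Complex.norm_real, Real.norm_of_nonneg (by positivity),
      mul_assoc (h ^ 2 / 4)]
    refine mul_le_mul_of_nonneg_left ?_ (by positivity)
    calc _ ≤ _ := norm_mul_le _ _
      _ ≤ ‖G‖ * ‖A‖ * ‖G‖ := mul_le_mul_of_nonneg_right (norm_mul_le _ _) (norm_nonneg _)
      _ = _ := by rw [hn]; ring
  rw [e2]
  calc _ ≤ _ := norm_sub_le _ _
    _ ≤ _ := add_le_add (norm_kraus_pair_le A V W (by positivity) n1) n2
    _ = _ := by ring

/-- Up to second order, `1 + h 𝓛†` is a contraction. -/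
theorem exists_norm_add_sum_heisenberg_le {ι : Type*} (s : Finset ι) (K : ι → 𝒜) :
    ∃ C : ℝ, 0 ≤ C ∧ ∀ h : ℝ, 0 ≤ h → ∀ A : 𝒜,
      ‖A + (h : ℂ) • ∑ j ∈ s, heisenberg (K j) (K j) A‖ ≤ (1 + C * h ^ 2) * ‖A‖ := by
  refine ⟨(s.card : ℝ) * ∑ j ∈ s, ‖K j‖ ^ 4 / 2, by positivity, fun h hh A => ?_⟩
  rcases s.eq_empty_or_nonempty with rfl | hs
  · simp
  have hn : (0 : ℝ) < s.card := by exact_mod_cast hs.card_pos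
  set n : ℝ := (s.card : ℝ) with hnd
  have hn' : (n : ℂ) ≠ 0 := by exact_mod_cast hn.ne'
  -- The step with all n jumps is the average of n single-jump steps of length n h, each of them
  -- contractive to first order.
  have e : A + (h : ℂ) • ∑ j ∈ s, heisenberg (K j) (K j) A =
      ((n⁻¹ : ℝ) : ℂ) • ∑ j ∈ s, (A + ((n * h : ℝ) : ℂ) • heisenberg (K j) (K j) A) := by
    rw [Finset.sum_add_distrib, Finset.sum_const, ← Finset.smul_sum, smul_add, smul_smul,
      ← Nat.cast_smul_eq_nsmul ℂ, smul_smul]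
    push_cast
    rw [show ((s.card : ℂ)) = (n : ℂ) by simp [hnd], inv_mul_cancel₀ hn', one_smul,
      inv_mul_cancel_left₀ hn']
  rw [e, norm_smul, Complex.norm_real, Real.norm_of_nonneg (by positivity)]
  have h1 : ‖∑ j ∈ s, (A + ((n * h : ℝ) : ℂ) • heisenberg (K j) (K j) A)‖ ≤
      ∑ j ∈ s, (1 + (n * h) ^ 2 * ‖K j‖ ^ 4 / 2) * ‖A‖ :=
    (norm_sum_le _ _).trans
      (Finset.sum_le_sum fun j _ => norm_add_heisenberg_le (K j) A (by positivity))
  calc _ ≤ n⁻¹ * ∑ j ∈ s, (1 + (n * h) ^ 2 * ‖K j‖ ^ 4 / 2) * ‖A‖ := by gcongr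
    _ = n⁻¹ * ((n + (n * h) ^ 2 * ∑ j ∈ s, ‖K j‖ ^ 4 / 2) * ‖A‖) := by
        rw [← Finset.sum_mul, Finset.sum_add_distrib, Finset.mul_sum]
        simp [hnd, mul_div_assoc]
    _ = _ := by field_simp

end CStar

/-! ### Conditional expectation onto the ground state of one spin -/

section OneSpin

variable {𝒜 : Type*} [CStarAlgebra 𝒜]

/-- `A` commutes with the algebra generated by the lowering operator `a`. -/
def CommutesWith (A a : 𝒜) : Prop := Commute A a ∧ Commute A (star a)

namespace CommutesWith

variable {A B a : 𝒜}

theorem star (h : CommutesWith A a) : CommutesWith (star A) a :=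
  ⟨by simpa using h.2.star_star, by simpa using h.1.star_star⟩

theorem add (h : CommutesWith A a) (h' : CommutesWith B a) : CommutesWith (A + B) a :=
  ⟨h.1.add_left h'.1, h.2.add_left h'.2⟩

theorem sub (h : CommutesWith A a) (h' : CommutesWith B a) : CommutesWith (A - B) a :=
  ⟨h.1.sub_left h'.1, h.2.sub_left h'.2⟩

theorem mul (h : CommutesWith A a) (h' : CommutesWith B a) : CommutesWith (A * B) a :=
  ⟨h.1.mul_left h'.1, h.2.mul_left h'.2⟩

theorem neg (h : CommutesWith A a) : CommutesWith (-A) a :=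
  ⟨h.1.neg_left, h.2.neg_left⟩

end CommutesWith

/-- `O ↦ ⟨0|O|0⟩ ⊗ 1`, for the spin with lowering operator `a = |0⟩⟨1|`. -/
def condExp (a : 𝒜) : 𝒜 →L[ℂ] 𝒜 :=
  ContinuousLinearMap.mulLeftRight ℂ 𝒜 (a * star a) (a * star a) +
    ContinuousLinearMap.mulLeftRight ℂ 𝒜 (star a) a

/-- The part of an operator that is annihilated by `condExp a`. -/
def osc (a : 𝒜) : 𝒜 →L[ℂ] 𝒜 := ContinuousLinearMap.id ℂ 𝒜 - condExp a

theorem condExp_apply (a O : 𝒜) :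
    condExp a O = a * star a * O * (a * star a) + star a * O * a := by
  simp [condExp]

theorem osc_apply (a O : 𝒜) : osc a O = O - condExp a O := rfl

theorem condExp_mul_left {A a : 𝒜} (h : CommutesWith A a) (O : 𝒜) :
    condExp a (A * O) = A * condExp a O := by
  have h1 : a * star a * A = A * (a * star a) := ((h.1.mul_right h.2).eq).symm
  simp only [condExp_apply, mul_add, ← mul_assoc, h.2.eq]
  rw [h1]; simp only [mul_assoc]

theorem condExp_mul_right {A a : 𝒜} (h : CommutesWith A a) (O : 𝒜) :
    condExp a (O * A) = condExp a O * A := by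
  have h1 : A * (a * star a) = a * star a * A := (h.1.mul_right h.2).eq
  simp only [condExp_apply, add_mul, mul_assoc, h.1.eq]
  rw [h1]; simp only [mul_assoc]

theorem condExp_commutesWith_of_ne {A a b : 𝒜} (hb : CommutesWith b a) (h : CommutesWith A a) :
    CommutesWith (condExp b A) a := by
  rw [condExp_apply]
  exact (((hb.mul hb.star).mul h).mul (hb.mul hb.star)).add ((hb.star.mul h).mul hb)

theorem condExp_heisenberg {S T a : 𝒜} (hS : CommutesWith S a) (hT : CommutesWith T a) (O : 𝒜) :
    condExp a (heisenberg S T O) = heisenberg S T (condExp a O) := by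
  simp only [heisenberg, map_sub, map_smul, map_add, condExp_mul_left (hS.star.mul hT),
    condExp_mul_right (hS.star.mul hT), condExp_mul_right hT, condExp_mul_left hS.star]

/-- The relations of a lowering operator `|0⟩⟨1|`. -/
structure IsLowering (a : 𝒜) : Prop where
  mul_self : a * a = 0
  car : a * star a + star a * a = 1

namespace IsLowering

variable {a : 𝒜} (ha : IsLowering a)
include ha

theorem mul_star_mul : a * (star a * a) = a := by
  have := congrArg (a * ·) ha.car
  simpa only [mul_add, mul_one, ← mul_assoc, ha.mul_self, zero_mul, zero_add] using this

theorem star_mul_star : star a * star a = 0 := by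
  simpa using congrArg star ha.mul_self

theorem star_mul_mul_star : star a * (a * star a) = star a := by
  simpa [mul_assoc] using congrArg star ha.mul_star_mul

theorem mul_self_assoc (x : 𝒜) : a * (a * x) = 0 := by rw [← mul_assoc, ha.mul_self, zero_mul]

theorem star_mul_star_assoc (x : 𝒜) : star a * (star a * x) = 0 := by
  rw [← mul_assoc, ha.star_mul_star, zero_mul]

theorem mul_star_mul_assoc (x : 𝒜) : a * (star a * (a * x)) = a * x := by
  rw [← mul_assoc, ← mul_assoc, mul_assoc a, ha.mul_star_mul]

theorem star_mul_mul_star_assoc (x : 𝒜) : star a * (a * (star a * x)) = star a * x := by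
  rw [← mul_assoc, ← mul_assoc, mul_assoc (star a), ha.star_mul_mul_star]

theorem norm_le_one : ‖a‖ ≤ 1 := by
  have h1 : ‖star a * a‖ = ‖star a * a‖ * ‖star a * a‖ := by
    rw [← CStarRing.norm_star_mul_self]
    congr 1
    simp only [star_mul, star_star, mul_assoc, ha.star_mul_mul_star_assoc]
  have h2 : ‖star a * a‖ ≤ 1 := by
    by_contra hlt
    push Not at hlt
    nlinarith
  rw [CStarRing.norm_star_mul_self] at h2
  nlinarith [norm_nonneg a]

theorem norm_condExp_le (O : 𝒜) : ‖condExp a O‖ ≤ ‖O‖ := by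
  have h := norm_kraus_pair_le O (a * star a) a one_pos (by
    simp only [star_mul, star_star, mul_assoc, ha.star_mul_mul_star]
    rw [ha.car]; exact norm_one_le_one)
  rw [condExp_apply]
  simpa using h

theorem norm_osc_le (O : 𝒜) : ‖osc a O‖ ≤ 2 * ‖O‖ := by
  rw [osc_apply]
  linarith [norm_sub_le O (condExp a O), ha.norm_condExp_le O]

theorem condExp_commutesWith (O : 𝒜) : CommutesWith (condExp a O) a := by
  constructor <;>
  simp only [Commute, SemiconjBy, condExp_apply, mul_add, add_mul, mul_assoc, ha.mul_self,
    ha.mul_star_mul, ha.star_mul_star, ha.star_mul_mul_star, ha.mul_self_assoc,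
    ha.star_mul_star_assoc, ha.mul_star_mul_assoc, ha.star_mul_mul_star_assoc, mul_zero,
    add_zero, zero_add]

theorem condExp_of_commutesWith {A : 𝒜} (h : CommutesWith A a) : condExp a A = A := by
  have := condExp_mul_left h 1
  rw [mul_one] at this
  rw [this, condExp_apply]
  simp only [mul_one, mul_assoc, ha.star_mul_mul_star]
  rw [ha.car, mul_one]

theorem osc_of_commutesWith {A : 𝒜} (h : CommutesWith A a) : osc a A = 0 := by
  rw [osc_apply, ha.condExp_of_commutesWith h, sub_self]

/-- The expansion over the matrix units |α⟩⟨β| of one spin. The coefficients ⟨α|T|β⟩ are values of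
`condExp a`, hence commute with the spin; this peels one site off the support of T. -/
theorem matrixUnit_expansion (T : 𝒜) :
    T = a * star a * condExp a T + a * condExp a (T * star a) + star a * condExp a (a * T)
      + star a * a * condExp a (a * T * star a) := by
  have h : T = (a * star a + star a * a) * T * (a * star a + star a * a) := by
    rw [ha.car, one_mul, mul_one]
  conv_lhs => rw [h]
  simp only [condExp_apply, mul_add, add_mul, mul_assoc, ha.mul_self,
    ha.mul_star_mul, ha.star_mul_star, ha.star_mul_mul_star, ha.mul_self_assoc,
    ha.star_mul_star_assoc, ha.mul_star_mul_assoc, ha.star_mul_mul_star_assoc, mul_zero,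
    add_zero, zero_add]
  abel

/-- Dual to the stationarity of |0⟩ under amplitude damping: a annihilates |0⟩, so every term of
⟨0|𝓛†O|0⟩ contains a|0⟩ or its adjoint. -/
theorem condExp_heisenberg_self (O : 𝒜) : condExp a (heisenberg a a O) = 0 := by
  simp only [condExp_apply, heisenberg, mul_sub, sub_mul, smul_add, smul_mul_assoc,
    mul_smul_comm, mul_add, add_mul, mul_assoc, ha.mul_self,
    ha.mul_star_mul, ha.star_mul_star, ha.star_mul_mul_star, ha.mul_self_assoc,
    ha.star_mul_star_assoc, ha.mul_star_mul_assoc, ha.star_mul_mul_star_assoc, mul_zero,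
    add_zero, zero_add, smul_zero, sub_zero, zero_mul]

theorem osc_heisenberg_self (O : 𝒜) : osc a (heisenberg a a O) = heisenberg a a (osc a O) := by
  have h : heisenberg a a (condExp a O) = 0 :=
    heisenberg_eq_zero (ha.condExp_commutesWith O).2 (ha.condExp_commutesWith O).1
  rw [osc_apply, ha.condExp_heisenberg_self, osc_apply, heisenberg_sub, h]

/-- On the range of `osc a` the amplitude damping generator is `-(3 + Z · Z) / 4`. -/
theorem heisenberg_osc (O : 𝒜) : heisenberg a a (osc a O) =
    -((3 / 4 : ℂ) • osc a O + (1 / 4 : ℂ) •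
      ((a * star a - star a * a) * osc a O * (a * star a - star a * a))) := by
  have h : O = (a * star a + star a * a) * O * (a * star a + star a * a) := by
    rw [ha.car, one_mul, mul_one]
  -- The entries 01, 10 and 11 of O, with the 00 entry subtracted from the last. Coherences decay at
  -- rate 1/2 and the 11 entry at rate 1, while Z·Z equals -1 and +1 on them.
  have h' : osc a O = a * (star a * (O * (star a * a))) + star a * (a * (O * (a * star a)))
      + star a * (a * (O * (star a * a))) - star a * (O * a) := by
    rw [osc_apply, condExp_apply]
    nth_rewrite 1 [h]
    simp only [mul_add, add_mul, mul_assoc]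
    abel
  rw [h']
  simp only [heisenberg, mul_sub, sub_mul, smul_add, smul_sub, smul_mul_assoc,
    mul_smul_comm, mul_add, add_mul, mul_assoc, ha.mul_self,
    ha.mul_star_mul, ha.star_mul_star, ha.star_mul_mul_star, ha.mul_self_assoc,
    ha.star_mul_star_assoc, ha.mul_star_mul_assoc, ha.star_mul_mul_star_assoc, mul_zero,
    add_zero, zero_add, smul_zero, sub_zero, zero_sub, neg_mul, zero_mul]
  module

theorem norm_parity_le : ‖a * star a - star a * a‖ ≤ 1 := by
  have h1 : ‖a * star a - star a * a‖ * ‖a * star a - star a * a‖ ≤ 1 := by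
    rw [← CStarRing.norm_star_mul_self]
    refine le_trans (le_of_eq ?_) (norm_one_le_one (𝒜 := 𝒜))
    rw [← ha.car]
    congr 1
    simp only [star_sub, star_mul, star_star, mul_sub, sub_mul, mul_assoc, ha.mul_self,
      ha.mul_star_mul, ha.star_mul_star, ha.star_mul_mul_star, ha.mul_self_assoc,
      ha.star_mul_star_assoc, ha.mul_star_mul_assoc, ha.star_mul_mul_star_assoc, mul_zero,
      sub_zero, zero_sub]
    abel
  nlinarith [norm_nonneg (a * star a - star a * a)]

theorem norm_parity_conj_le (O : 𝒜) :
    ‖(a * star a - star a * a) * O * (a * star a - star a * a)‖ ≤ ‖O‖ := by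
  have h := ha.norm_parity_le
  calc _ ≤ _ := norm_mul_le _ _
    _ ≤ ‖a * star a - star a * a‖ * ‖O‖ * ‖a * star a - star a * a‖ :=
        mul_le_mul_of_nonneg_right (norm_mul_le _ _) (norm_nonneg _)
    _ ≤ 1 * ‖O‖ * 1 := by gcongr
    _ = _ := by ring

end IsLowering

end OneSpin

/-! ### Systems of spins -/

section Spins

variable {𝒜 : Type*} [CStarAlgebra 𝒜] {Λ : Type*}

/-- The relations between the lowering operators of a system of spins, which act irreducibly. -/
structure IsSpinSystem (k : Λ → 𝒜) : Prop where
  lowering : ∀ i, IsLowering (k i)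
  commutes : ∀ i j, i ≠ j → CommutesWith (k i) (k j)
  irreducible : ∀ A, (∀ i, CommutesWith A (k i)) → ∃ c : ℂ, A = c • 1

/-- `A` acts only on the spins in `S`. -/
def LocalizedOn (k : Λ → 𝒜) (S : Finset Λ) (A : 𝒜) : Prop := ∀ i, i ∉ S → CommutesWith A (k i)

namespace IsSpinSystem

variable {k : Λ → 𝒜} (hk : IsSpinSystem k)
include hk

theorem commutesWith_condExp {A : 𝒜} {i : Λ} (j : Λ) (h : CommutesWith A (k i)) :
    CommutesWith (condExp (k j) A) (k i) := by
  by_cases hij : j = i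
  · subst hij; exact (hk.lowering j).condExp_commutesWith A
  · exact condExp_commutesWith_of_ne (hk.commutes j i hij) h

/-- Operators on complementary sets of spins commute. -/
theorem commute_of_localizedOn [DecidableEq Λ] (S : Finset Λ) :
    ∀ T O : 𝒜, LocalizedOn k S T → (∀ i ∈ S, CommutesWith O (k i)) → Commute T O := by
  induction S using Finset.induction_on with
  | empty =>
    intro T O hT _
    obtain ⟨c, rfl⟩ := hk.irreducible T fun i => hT i (by simp)
    exact (Commute.one_left O).smul_left c
  | insert a S ha ih =>
    intro T O hT hO
    have hOa := hO a (by simp)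
    have hka : ∀ i, i ∉ insert a S → CommutesWith (k a) (k i) := fun i hi =>
      hk.commutes a i (by rintro rfl; simp at hi)
    -- Conditioning on the spin a removes it from the support, so the induction hypothesis applies
    -- to each coefficient of the matrix unit expansion of T.
    have key : ∀ U, LocalizedOn k (insert a S) U → Commute (condExp (k a) U) O := by
      intro U hU
      refine ih _ _ (fun i hi => ?_) fun i hi => hO i (by simp [hi])
      by_cases hia : i = a
      · subst hia; exact (hk.lowering i).condExp_commutesWith U
      · exact hk.commutesWith_condExp a (hU i (by simp [hia, hi]))
    rw [(hk.lowering a).matrixUnit_expansion T]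
    have h1 := hOa.1.symm
    have h2 := hOa.2.symm
    refine Commute.add_left (Commute.add_left (Commute.add_left ?_ ?_) ?_) ?_
    · exact (h1.mul_left h2).mul_left (key T hT)
    · exact h1.mul_left (key _ fun i hi => (hT i hi).mul (hka i hi).star)
    · exact h2.mul_left (key _ fun i hi => (hka i hi).mul (hT i hi))
    · exact (h2.mul_left h1).mul_left
        (key _ fun i hi => ((hka i hi).mul (hT i hi)).mul (hka i hi).star)

/-- An operator is approximated, up to its oscillations in `S`, by one acting trivially on `S`. -/
theorem exists_commutesWith_approx [DecidableEq Λ] (S : Finset Λ) (O : 𝒜) :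
    ∃ O' : 𝒜, (∀ i ∈ S, CommutesWith O' (k i)) ∧ ‖O - O'‖ ≤ ∑ i ∈ S, ‖osc (k i) O‖ := by
  induction S using Finset.induction_on with
  | empty => exact ⟨O, by simp, by simp⟩
  | insert a S ha ih =>
    obtain ⟨O', h1, h2⟩ := ih
    refine ⟨condExp (k a) O', fun i hi => ?_, ?_⟩
    · rcases Finset.mem_insert.1 hi with rfl | hi
      · exact (hk.lowering i).condExp_commutesWith O'
      · exact hk.commutesWith_condExp a (h1 i hi)
    · rw [Finset.sum_insert ha]
      have e : O - condExp (k a) O' = osc (k a) O + condExp (k a) (O - O') := by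
        rw [osc_apply, map_sub]; abel
      rw [e]
      exact (norm_add_le _ _).trans
        (add_le_add le_rfl (((hk.lowering a).norm_condExp_le _).trans h2))

/-- Decomposition of an operator into pieces localized in sublevel sets of `d`. -/
theorem exists_localized_decomposition [DecidableEq Λ] (d : Λ → ℕ) (V : 𝒜) (S : Finset Λ) :
    ∃ (T : Λ → 𝒜) (c : 𝒜), V = c + ∑ m ∈ S, T m ∧ (∀ m ∈ S, ‖T m‖ ≤ ‖osc (k m) V‖) ∧
      (∀ m ∈ S, ∀ i ∈ S, d m < d i → CommutesWith (T m) (k i)) ∧ ‖c‖ ≤ ‖V‖ ∧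
      ∀ i ∈ S, CommutesWith c (k i) := by
  induction S using Finset.induction_on_max_value d with
  | empty => exact ⟨fun _ => 0, V, by simp, by simp, by simp, le_rfl, by simp⟩
  | insert a S ha hmax ih =>
    obtain ⟨T, c, hV, hT, hTc, hc, hcc⟩ := ih
    have hne : ∀ m ∈ S, m ≠ a := fun m hm h => ha (h ▸ hm)
    -- Sites enter in order of increasing d, and each new one conditions all earlier pieces. The
    -- piece at m is thus osc_m V conditioned on all sites that enter later, and V telescopes into
    -- these pieces and its full conditional expectation.
    refine ⟨fun m => if m = a then osc (k a) V else condExp (k a) (T m), condExp (k a) c,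
      ?_, ?_, ?_, ?_, ?_⟩
    · rw [Finset.sum_insert ha, if_pos rfl,
        Finset.sum_congr rfl fun m hm => if_neg (hne m hm), ← map_sum]
      have : condExp (k a) V = condExp (k a) c + condExp (k a) (∑ m ∈ S, T m) := by
        conv_lhs => rw [hV]
        rw [map_add]
      rw [osc_apply, this]; abel
    · intro m hm
      rcases Finset.mem_insert.1 hm with rfl | hm
      · simp
      · simp only [if_neg (hne m hm)]
        exact ((hk.lowering a).norm_condExp_le _).trans (hT m hm)
    · intro m hm i hi hd
      rcases Finset.mem_insert.1 hm with rfl | hm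
      · rcases Finset.mem_insert.1 hi with rfl | hi
        · exact absurd hd (lt_irrefl _)
        · exact absurd (hmax i hi) (not_le.2 hd)
      · simp only [if_neg (hne m hm)]
        rcases Finset.mem_insert.1 hi with rfl | hi
        · exact (hk.lowering i).condExp_commutesWith _
        · exact hk.commutesWith_condExp a (hTc m hm i hi hd)
    · exact ((hk.lowering a).norm_condExp_le _).trans hc
    · intro i hi
      rcases Finset.mem_insert.1 hi with rfl | hi
      · exact (hk.lowering i).condExp_commutesWith _
      · exact hk.commutesWith_condExp a (hcc i hi)

end IsSpinSystem

end Spins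

/-! ### Contraction of the oscillations -/

section Contraction

variable {𝒜 : Type*} [CStarAlgebra 𝒜] {Λ : Type*} [Fintype Λ] [DecidableEq Λ]

/-- A finite set with a distance of polynomial growth. -/
structure HasPolyGrowth (d : Λ → Λ → ℕ) (q : ℕ) (Γ : ℝ) : Prop where
  self : ∀ i, d i i = 0
  symm : ∀ i j, d i j = d j i
  triangle : ∀ i j m, d i m ≤ d i j + d j m
  sum_le : ∀ j, ∑ i, ((1 + (d i j : ℝ)) ^ q)⁻¹ ≤ Γ

/-- The ball of radius `r` around `j`. -/
def ballOf (d : Λ → Λ → ℕ) (j : Λ) (r : ℕ) : Finset Λ := Finset.univ.filter fun i => d i j ≤ r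

theorem mem_ballOf {d : Λ → Λ → ℕ} {i j : Λ} {r : ℕ} : i ∈ ballOf d j r ↔ d i j ≤ r := by
  simp [ballOf]

namespace HasPolyGrowth

variable {d : Λ → Λ → ℕ} {q : ℕ} {Γ : ℝ} (hd : HasPolyGrowth d q Γ)
include hd

theorem nonneg [Nonempty Λ] : 0 ≤ Γ :=
  le_trans (Finset.sum_nonneg fun _ _ => by positivity) (hd.sum_le (Classical.arbitrary Λ))

theorem card_ballOf_le (j : Λ) (r : ℕ) : ((ballOf d j r).card : ℝ) ≤ Γ * (1 + (r : ℝ)) ^ q := by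
  have h1 : ((ballOf d j r).card : ℝ) * ((1 + (r : ℝ)) ^ q)⁻¹ ≤ Γ := by
    calc _ = ∑ i ∈ ballOf d j r, ((1 + (r : ℝ)) ^ q)⁻¹ := by simp
      _ ≤ ∑ i ∈ ballOf d j r, ((1 + (d i j : ℝ)) ^ q)⁻¹ := by
          refine Finset.sum_le_sum fun i hi => ?_
          have : (d i j : ℝ) ≤ r := by exact_mod_cast mem_ballOf.1 hi
          gcongr
      _ ≤ ∑ i, ((1 + (d i j : ℝ)) ^ q)⁻¹ :=
          Finset.sum_le_univ_sum_of_nonneg fun i => by positivity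
      _ ≤ Γ := hd.sum_le j
  rwa [← div_eq_mul_inv, div_le_iff₀ (by positivity)] at h1

end HasPolyGrowth

variable {k : Λ → 𝒜}

namespace IsSpinSystem

variable (hk : IsSpinSystem k)
include hk

/-- Operators acting trivially on S are annihilated by the dissipator of T, T', so O may be replaced
by its distance to such an operator. Conditioning on any site preserves triviality on S, so the same
approximant serves for the second bound. -/
theorem norm_heisenberg_localized_le {S : Finset Λ} {T T' : 𝒜} (hT : LocalizedOn k S T)
    (hT' : LocalizedOn k S T') (O : 𝒜) :
    ‖heisenberg T T' O‖ ≤ 2 * ‖T‖ * ‖T'‖ * ∑ m ∈ S, ‖osc (k m) O‖ ∧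
    ∀ i, ‖heisenberg T T' (condExp (k i) O)‖ ≤ 2 * ‖T‖ * ‖T'‖ * ∑ m ∈ S, ‖osc (k m) O‖ := by
  obtain ⟨O', h1, h2⟩ := hk.exists_commutesWith_approx S O
  have hz : ∀ P, (∀ i ∈ S, CommutesWith P (k i)) → heisenberg T T' P = 0 := fun P hP =>
    heisenberg_eq_zero (hk.commute_of_localizedOn S _ P (fun i hi => (hT i hi).star) hP).symm
      (hk.commute_of_localizedOn S _ P hT' hP).symm
  constructor
  · have e : heisenberg T T' O = heisenberg T T' (O - O') := by
      rw [heisenberg_sub, hz O' h1, sub_zero]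
    rw [e]
    exact (norm_heisenberg_le _ _ _).trans (by gcongr)
  · intro i
    have e : heisenberg T T' (condExp (k i) O) = heisenberg T T' (condExp (k i) (O - O')) := by
      rw [map_sub, heisenberg_sub,
        hz _ fun m hm => hk.commutesWith_condExp i (h1 m hm), sub_zero]
    rw [e]
    refine (norm_heisenberg_le _ _ _).trans ?_
    gcongr
    exact ((hk.lowering i).norm_condExp_le _).trans h2

theorem norm_osc_heisenberg_le {S : Finset Λ} {T T' : 𝒜} (hT : LocalizedOn k S T)
    (hT' : LocalizedOn k S T') (O : 𝒜) (i : Λ) :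
    ‖osc (k i) (heisenberg T T' O)‖ ≤ 4 * ‖T‖ * ‖T'‖ * ∑ m ∈ S, ‖osc (k m) O‖ := by
  have h1 := (hk.norm_heisenberg_localized_le hT hT' O).1
  have h2 := (hk.lowering i).norm_osc_le (heisenberg T T' O)
  linarith

/-- Conditioning on a spin outside S commutes with the dissipator, so only the sites of S contribute
to the commutator. -/
theorem norm_osc_heisenberg_sub_le {S : Finset Λ} {T T' : 𝒜} (hT : LocalizedOn k S T)
    (hT' : LocalizedOn k S T') (O : 𝒜) (i : Λ) :
    ‖osc (k i) (heisenberg T T' O) - heisenberg T T' (osc (k i) O)‖ ≤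
      if i ∈ S then 4 * ‖T‖ * ‖T'‖ * ∑ m ∈ S, ‖osc (k m) O‖ else 0 := by
  have e : osc (k i) (heisenberg T T' O) - heisenberg T T' (osc (k i) O) =
      heisenberg T T' (condExp (k i) O) - condExp (k i) (heisenberg T T' O) := by
    rw [osc_apply, osc_apply, heisenberg_sub]; abel
  rw [e]
  split_ifs with hi
  · have h := hk.norm_heisenberg_localized_le hT hT' O
    have h1 := (hk.lowering i).norm_condExp_le (heisenberg T T' O)
    linarith [norm_sub_le (heisenberg T T' (condExp (k i) O))
      (condExp (k i) (heisenberg T T' O)), h.1, h.2 i]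
  · rw [condExp_heisenberg (hT i hi) (hT' i hi), sub_self, norm_zero]

/-- The effect of a quasi-local perturbation `K` of the jump operator `k j` on the oscillation at
`i`. -/
def oscDefect (_ : IsSpinSystem k) (j : Λ) (K O : 𝒜) (i : Λ) : 𝒜 :=
  if i = j then osc (k i) (heisenberg K K O) - osc (k i) (heisenberg (k j) (k j) O)
  else osc (k i) (heisenberg K K O) - heisenberg K K (osc (k i) O)

/-- Pieces are cut out along balls around j. The fully conditioned remainder, of norm at most ‖V‖,
joins the central piece, of norm at most 2‖V‖; hence the constant 3. -/
theorem exists_quasilocal_decomposition {d : Λ → Λ → ℕ} {q : ℕ} {Γ : ℝ}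
    (hd : HasPolyGrowth d q Γ) (j : Λ) (V : 𝒜) :
    ∃ T : Λ → 𝒜, V = ∑ m, T m ∧ (∀ m, LocalizedOn k (ballOf d j (d m j)) (T m)) ∧
      ∀ p : ℕ, ∑ m, (1 + (d m j : ℝ)) ^ p * ‖T m‖ ≤ 3 * ‖V‖ +
        ∑ m ∈ Finset.univ.erase j, (1 + (d m j : ℝ)) ^ p * ‖osc (k m) V‖ := by
  obtain ⟨T, c, hV, hT, hTc, hc, hcc⟩ :=
    hk.exists_localized_decomposition (fun i => d i j) V Finset.univ
  refine ⟨fun m => if m = j then c + T j else T m, ?_, ?_, ?_⟩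
  · rw [← Finset.add_sum_erase _ _ (Finset.mem_univ j), if_pos rfl,
      Finset.sum_congr rfl fun m hm => if_neg (Finset.ne_of_mem_erase hm), add_assoc,
      Finset.add_sum_erase _ _ (Finset.mem_univ j)]
    exact hV
  · intro m i hi
    rw [mem_ballOf, not_le] at hi
    dsimp only
    split_ifs with hmj
    · subst hmj
      exact (hcc i (Finset.mem_univ i)).add
        (hTc m (Finset.mem_univ m) i (Finset.mem_univ i) hi)
    · exact hTc m (Finset.mem_univ m) i (Finset.mem_univ i) hi
  · intro p
    rw [← Finset.add_sum_erase _ _ (Finset.mem_univ j)]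
    refine add_le_add ?_ (Finset.sum_le_sum fun m hm => ?_)
    · simp only [hd.self, if_true]
      have := (hk.lowering j).norm_osc_le V
      have := hT j (Finset.mem_univ j)
      have := norm_add_le c (T j)
      simp only [Nat.cast_zero, add_zero, one_pow, one_mul]
      linarith
    · simp only [if_neg (Finset.ne_of_mem_erase hm)]
      have := hT m (Finset.mem_univ m)
      gcongr

/-- The dissipator is expanded over pairs of localized pieces of K. A pair of radius R affects at
most Γ(1 + R)^q sites, and bringing in the weights (1 + d)^(-q) of the oscillations costs another (1
+ R)^q. This is why the pieces are weighted by the power 2q. -/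
theorem sum_norm_oscDefect_le [Nonempty Λ] {d : Λ → Λ → ℕ} {q : ℕ} {Γ : ℝ}
    (hd : HasPolyGrowth d q Γ) (j : Λ) (K O : 𝒜) {x : ℝ}
    (hx : 3 * ‖K - k j‖ + ∑ m ∈ Finset.univ.erase j,
      (1 + (d m j : ℝ)) ^ (2 * q) * ‖osc (k m) K‖ ≤ x) :
    ∑ i, ‖hk.oscDefect j K O i‖ ≤ 4 * Γ * (2 * x + x ^ 2) *
      ∑ m, ‖osc (k m) O‖ * ((1 + (d m j : ℝ)) ^ q)⁻¹ := by
  have hΓ := hd.nonneg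
  obtain ⟨T₀, hV, hloc₀, hsum₀⟩ := hk.exists_quasilocal_decomposition hd j (K - k j)
  have hosc : ∀ m ∈ Finset.univ.erase j, osc (k m) (K - k j) = osc (k m) K := by
    intro m hm
    rw [map_sub, (hk.lowering m).osc_of_commutesWith
      (hk.commutes j m (Finset.ne_of_mem_erase hm).symm), sub_zero]
  have hy : ∑ m, (1 + (d m j : ℝ)) ^ (2 * q) * ‖T₀ m‖ ≤ x := by
    refine (hsum₀ (2 * q)).trans (le_trans (le_of_eq ?_) hx)
    rw [Finset.sum_congr rfl fun m hm => by rw [hosc m hm]]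
  -- The index `none` stands for the unperturbed operator k j, of radius 0, and `some m` for the
  -- pieces of K - k j. The pair (none, none) is the free dissipator and drops out of the defect.
  set T : Option Λ → 𝒜 := fun p => p.elim (k j) T₀ with hT
  set ρ : Option Λ → ℕ := fun p => p.elim 0 (fun m => d m j) with hρ
  have hK : K = ∑ p, T p := by
    rw [Fintype.sum_option]
    simp only [hT, Option.elim]
    rw [← hV]; abel
  have hloc : ∀ p r, ρ p ≤ r → LocalizedOn k (ballOf d j r) (T p) := by
    intro p r hr i hi
    rw [mem_ballOf, not_le] at hi
    cases p with
    | none =>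
      refine hk.commutes j i ?_
      rintro rfl
      simp [hd.self] at hi
    | some m => exact hloc₀ m i (by rw [mem_ballOf, not_le]; exact lt_of_le_of_lt hr hi)
  set D : Option Λ → ℝ := fun p => (1 + (ρ p : ℝ)) ^ (2 * q) * ‖T p‖ with hD
  have hD0 : ∀ p, 0 ≤ D p := fun p => by positivity
  set P : Finset (Option Λ × Option Λ) := Finset.univ.erase (none, none) with hP
  set U : ℝ := ∑ m, ‖osc (k m) O‖ * ((1 + (d m j : ℝ)) ^ q)⁻¹ with hU
  have hU0 : 0 ≤ U := Finset.sum_nonneg fun _ _ => by positivity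
  set S : Option Λ × Option Λ → Finset Λ := fun p => ballOf d j (max (ρ p.1) (ρ p.2)) with hS
  -- expansion of the quadratic map
  have hexp : ∀ A, heisenberg K K A = heisenberg (k j) (k j) A
      + ∑ p ∈ P, heisenberg (T p.1) (T p.2) A := by
    intro A
    have h1 : heisenberg K K A = ∑ p : Option Λ × Option Λ, heisenberg (T p.1) (T p.2) A := by
      conv_lhs => rw [hK, heisenberg_sum_left]
      rw [Fintype.sum_prod_type]
      exact Finset.sum_congr rfl fun p _ => heisenberg_sum_mid _ _ _ _
    rw [h1, ← Finset.add_sum_erase _ _ (Finset.mem_univ ((none : Option Λ), (none : Option Λ)))]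
    rfl
  -- the contribution of one pair
  have hterm : ∀ i, ‖hk.oscDefect j K O i‖ ≤ ∑ p ∈ P, if i ∈ S p then
      4 * ‖T p.1‖ * ‖T p.2‖ * ∑ m ∈ S p, ‖osc (k m) O‖ else 0 := by
    intro i
    have hl1 : ∀ p : Option Λ × Option Λ, LocalizedOn k (S p) (T p.1) := fun p =>
      hloc _ _ (le_max_left _ _)
    have hl2 : ∀ p : Option Λ × Option Λ, LocalizedOn k (S p) (T p.2) := fun p =>
      hloc _ _ (le_max_right _ _)
    rw [oscDefect]
    split_ifs with hij
    · subst hij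
      have e : osc (k i) (heisenberg K K O) - osc (k i) (heisenberg (k i) (k i) O) =
          ∑ p ∈ P, osc (k i) (heisenberg (T p.1) (T p.2) O) := by
        rw [hexp O, map_add, map_sum, add_sub_cancel_left]
      rw [e]
      refine (norm_sum_le _ _).trans (Finset.sum_le_sum fun p _ => ?_)
      rw [if_pos (by rw [hS, mem_ballOf, hd.self]; exact Nat.zero_le _)]
      exact hk.norm_osc_heisenberg_le (hl1 p) (hl2 p) O i
    · have e : osc (k i) (heisenberg K K O) - heisenberg K K (osc (k i) O) =
          ∑ p ∈ P, (osc (k i) (heisenberg (T p.1) (T p.2) O) -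
            heisenberg (T p.1) (T p.2) (osc (k i) O)) := by
        have h0 : osc (k i) (heisenberg (k j) (k j) O) =
            heisenberg (k j) (k j) (osc (k i) O) := by
          have hc := hk.commutes j i (Ne.symm hij)
          rw [osc_apply, osc_apply, heisenberg_sub, condExp_heisenberg hc hc]
        rw [hexp O, hexp (osc (k i) O), map_add, map_sum, h0, Finset.sum_sub_distrib]
        abel
      rw [e]
      exact (norm_sum_le _ _).trans (Finset.sum_le_sum fun p _ =>
        hk.norm_osc_heisenberg_sub_le (hl1 p) (hl2 p) O i)
  have hpair : ∀ p ∈ P, ∑ i, (if i ∈ S p then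
      4 * ‖T p.1‖ * ‖T p.2‖ * ∑ m ∈ S p, ‖osc (k m) O‖ else 0) ≤
      4 * Γ * U * (D p.1 * D p.2) := by
    intro p _
    set R : ℕ := max (ρ p.1) (ρ p.2) with hR
    have hsumS : ∑ m ∈ S p, ‖osc (k m) O‖ ≤ (1 + (R : ℝ)) ^ q * U := by
      calc _ ≤ ∑ m ∈ S p, (1 + (R : ℝ)) ^ q *
            (‖osc (k m) O‖ * ((1 + (d m j : ℝ)) ^ q)⁻¹) := by
            refine Finset.sum_le_sum fun m hm => ?_
            have hm' : (d m j : ℝ) ≤ R := by exact_mod_cast mem_ballOf.1 hm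
            have : 1 ≤ (1 + (R : ℝ)) ^ q * ((1 + (d m j : ℝ)) ^ q)⁻¹ := by
              rw [← div_eq_mul_inv, one_le_div (by positivity)]
              gcongr
            nlinarith [norm_nonneg (osc (k m) O)]
        _ ≤ ∑ m, (1 + (R : ℝ)) ^ q * (‖osc (k m) O‖ * ((1 + (d m j : ℝ)) ^ q)⁻¹) :=
            Finset.sum_le_univ_sum_of_nonneg fun m => by positivity
        _ = _ := by rw [← Finset.mul_sum]
    have hcard := hd.card_ballOf_le j R
    have hRle : (1 + (R : ℝ)) ^ (2 * q) ≤
        (1 + (ρ p.1 : ℝ)) ^ (2 * q) * (1 + (ρ p.2 : ℝ)) ^ (2 * q) := by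
      rw [← mul_pow]
      gcongr
      have : (R : ℝ) ≤ ρ p.1 + ρ p.2 := by
        exact_mod_cast max_le (Nat.le_add_right _ _) (Nat.le_add_left _ _)
      nlinarith [mul_nonneg (Nat.cast_nonneg (α := ℝ) (ρ p.1)) (Nat.cast_nonneg (α := ℝ) (ρ p.2))]
    rw [← Finset.sum_filter, Finset.sum_const, nsmul_eq_mul, Finset.filter_mem_eq_inter,
      Finset.univ_inter]
    calc ((S p).card : ℝ) * (4 * ‖T p.1‖ * ‖T p.2‖ * ∑ m ∈ S p, ‖osc (k m) O‖)
        ≤ (Γ * (1 + (R : ℝ)) ^ q) * (4 * ‖T p.1‖ * ‖T p.2‖ * ((1 + (R : ℝ)) ^ q * U)) := by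
          gcongr
      _ = 4 * Γ * U * (‖T p.1‖ * ‖T p.2‖ * (1 + (R : ℝ)) ^ (2 * q)) := by ring
      _ ≤ 4 * Γ * U * (‖T p.1‖ * ‖T p.2‖ *
          ((1 + (ρ p.1 : ℝ)) ^ (2 * q) * (1 + (ρ p.2 : ℝ)) ^ (2 * q))) := by gcongr
      _ = _ := by simp only [hD]; ring
  -- With the free piece of weight at most 1 and the others of total weight at most x, the pairs
  -- other than (none, none) sum to at most (1 + x)² - 1.
  have hDsum : ∑ p ∈ P, D p.1 * D p.2 ≤ 2 * x + x ^ 2 := by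
    have h1 : ∑ p : Option Λ × Option Λ, D p.1 * D p.2 = (∑ p, D p) ^ 2 := by
      rw [Fintype.sum_prod_type, sq, Finset.sum_mul_sum]
    have h2 : ∑ p, D p = D none + ∑ m, D (some m) := Fintype.sum_option _
    have h3 : ∑ m, D (some m) ≤ x := hy
    have h4 : D none ≤ 1 := by
      simp only [hD, hρ, hT, Option.elim, Nat.cast_zero, add_zero, one_pow, one_mul]
      exact (hk.lowering j).norm_le_one
    have h5 : 0 ≤ ∑ m, D (some m) := Finset.sum_nonneg fun _ _ => hD0 _
    have h6 := Finset.add_sum_erase Finset.univ (fun p : Option Λ × Option Λ => D p.1 * D p.2)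
      (Finset.mem_univ ((none : Option Λ), (none : Option Λ)))
    rw [h1, h2] at h6
    simp only at h6
    nlinarith [hD0 none]
  calc _ ≤ ∑ i, ∑ p ∈ P, (if i ∈ S p then
      4 * ‖T p.1‖ * ‖T p.2‖ * ∑ m ∈ S p, ‖osc (k m) O‖ else 0) :=
        Finset.sum_le_sum fun i _ => hterm i
    _ = ∑ p ∈ P, ∑ i, (if i ∈ S p then
      4 * ‖T p.1‖ * ‖T p.2‖ * ∑ m ∈ S p, ‖osc (k m) O‖ else 0) := Finset.sum_comm
    _ ≤ ∑ p ∈ P, 4 * Γ * U * (D p.1 * D p.2) := Finset.sum_le_sum hpair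
    _ = 4 * Γ * U * ∑ p ∈ P, D p.1 * D p.2 := (Finset.mul_sum _ _ _).symm
    _ ≤ 4 * Γ * U * (2 * x + x ^ 2) := by gcongr
    _ = _ := by ring

/-- Up to second order, `1 + h 𝓛†` contracts the sum of all oscillations. -/
theorem exists_sum_norm_osc_le [Nonempty Λ] {d : Λ → Λ → ℕ} {q : ℕ} {Γ : ℝ}
    (hd : HasPolyGrowth d q Γ) (K : Λ → 𝒜) {x : ℝ}
    (hx : ∀ j, 3 * ‖K j - k j‖ + ∑ m ∈ Finset.univ.erase j,
      (1 + (d m j : ℝ)) ^ (2 * q) * ‖osc (k m) (K j)‖ ≤ x)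
    (hsmall : 4 * Γ ^ 2 * (2 * x + x ^ 2) ≤ 1 / 4) :
    ∃ C : ℝ, 0 ≤ C ∧ ∀ h : ℝ, 0 ≤ h → h ≤ 1 / 2 → ∀ O : 𝒜,
      ∑ i, ‖osc (k i) (O + (h : ℂ) • ∑ j, heisenberg (K j) (K j) O)‖ ≤
        (1 - h / 4 + C * h ^ 2) * ∑ i, ‖osc (k i) O‖ := by
  have hΓ := hd.nonneg
  choose C hC0 hC using fun i => exists_norm_add_sum_heisenberg_le (Finset.univ.erase i) K
  refine ⟨2 * ∑ i, C i, by have := Finset.sum_nonneg fun i (_ : i ∈ Finset.univ) => hC0 i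
                           positivity, fun h h0 h1 O => ?_⟩
  have hx0 : 0 ≤ x := le_trans (by positivity) (hx (Classical.arbitrary Λ))
  have hsite : ∀ i, ‖osc (k i) (O + (h : ℂ) • ∑ j, heisenberg (K j) (K j) O)‖ ≤
      (1 - h / 2 + 2 * (∑ i, C i) * h ^ 2) * ‖osc (k i) O‖
        + h * ∑ j, ‖hk.oscDefect j (K j) O i‖ := by
    intro i
    set A := osc (k i) O with hA
    -- The step is split in half. One half carries the dissipators of the other sites with doubled
    -- step 2h, contractive up to O(h²); the other carries the decay of the site itself and has norm
    -- at most 1 - h. Together they give 1 - h/2, and only the defects remain as a perturbation.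
    have e : osc (k i) (O + (h : ℂ) • ∑ j, heisenberg (K j) (K j) O) =
        (1 / 2 : ℂ) • (A + ((2 * h : ℝ) : ℂ) •
          ∑ j ∈ Finset.univ.erase i, heisenberg (K j) (K j) A)
        + (1 / 2 : ℂ) • (((1 - 3 * h / 2 : ℝ) : ℂ) • A - ((h / 2 : ℝ) : ℂ) •
          ((k i * star (k i) - star (k i) * k i) * A * (k i * star (k i) - star (k i) * k i)))
        + (h : ℂ) • ∑ j, hk.oscDefect j (K j) O i := by
      have e1 : osc (k i) (heisenberg (K i) (K i) O) =
          hk.oscDefect i (K i) O i + heisenberg (k i) (k i) A := by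
        rw [oscDefect, if_pos rfl, ← (hk.lowering i).osc_heisenberg_self, sub_add_cancel]
      have e2 : ∑ j ∈ Finset.univ.erase i, osc (k i) (heisenberg (K j) (K j) O) =
          ∑ j ∈ Finset.univ.erase i, hk.oscDefect j (K j) O i +
          ∑ j ∈ Finset.univ.erase i, heisenberg (K j) (K j) A := by
        rw [← Finset.sum_add_distrib]
        refine Finset.sum_congr rfl fun j hj => ?_
        rw [oscDefect, if_neg (Finset.ne_of_mem_erase hj).symm, sub_add_cancel]
      rw [map_add, map_smul, map_sum, ← Finset.add_sum_erase _ _ (Finset.mem_univ i), e1, e2,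
        ← Finset.add_sum_erase _ (fun j => hk.oscDefect j (K j) O i) (Finset.mem_univ i),
        hA, (hk.lowering i).heisenberg_osc, ← hA]
      push_cast
      module
    rw [e]
    have n1 := hC i (2 * h) (by positivity) A
    have n2 : ‖((1 - 3 * h / 2 : ℝ) : ℂ) • A - ((h / 2 : ℝ) : ℂ) •
        ((k i * star (k i) - star (k i) * k i) * A * (k i * star (k i) - star (k i) * k i))‖ ≤
        (1 - h) * ‖A‖ := by
      refine (norm_sub_le _ _).trans ?_
      rw [norm_smul, norm_smul, Complex.norm_real, Complex.norm_real,
        Real.norm_of_nonneg (by linarith), Real.norm_of_nonneg (by positivity)]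
      have := (hk.lowering i).norm_parity_conj_le A
      nlinarith [norm_nonneg A]
    have n3 : ‖(h : ℂ) • ∑ j, hk.oscDefect j (K j) O i‖ ≤
        h * ∑ j, ‖hk.oscDefect j (K j) O i‖ := by
      rw [norm_smul, Complex.norm_real, Real.norm_of_nonneg h0]
      gcongr
      exact norm_sum_le _ _
    have hhalf : ∀ B : 𝒜, ‖(1 / 2 : ℂ) • B‖ = 1 / 2 * ‖B‖ := fun B => by
      rw [norm_smul]; norm_num
    have hCi : C i ≤ ∑ i, C i :=
      Finset.single_le_sum (fun j _ => hC0 j) (Finset.mem_univ i)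
    refine (norm_add₃_le).trans ?_
    rw [hhalf, hhalf]
    have : C i * h ^ 2 * ‖A‖ ≤ (∑ i, C i) * h ^ 2 * ‖A‖ := by gcongr
    nlinarith
  -- Summing first over the affected site i and then over the jump j gives a second factor Γ. By
  -- `hsmall` half of the decay rate 1/2 survives.
  have hdef : ∑ i, ∑ j, ‖hk.oscDefect j (K j) O i‖ ≤ 1 / 4 * ∑ i, ‖osc (k i) O‖ := by
    rw [Finset.sum_comm]
    calc _ ≤ ∑ j, 4 * Γ * (2 * x + x ^ 2) *
          ∑ m, ‖osc (k m) O‖ * ((1 + (d m j : ℝ)) ^ q)⁻¹ :=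
          Finset.sum_le_sum fun j _ => hk.sum_norm_oscDefect_le hd j (K j) O (hx j)
      _ = 4 * Γ * (2 * x + x ^ 2) *
          ∑ m, ‖osc (k m) O‖ * ∑ j, ((1 + (d j m : ℝ)) ^ q)⁻¹ := by
          rw [← Finset.mul_sum, Finset.sum_comm]
          simp only [Finset.mul_sum, hd.symm]
      _ ≤ 4 * Γ * (2 * x + x ^ 2) * ∑ m, ‖osc (k m) O‖ * Γ := by
          gcongr with m
          exact hd.sum_le m
      _ = 4 * Γ ^ 2 * (2 * x + x ^ 2) * ∑ m, ‖osc (k m) O‖ := by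
          rw [← Finset.sum_mul]; ring
      _ ≤ _ := by gcongr
  calc _ ≤ ∑ i, ((1 - h / 2 + 2 * (∑ i, C i) * h ^ 2) * ‖osc (k i) O‖
        + h * ∑ j, ‖hk.oscDefect j (K j) O i‖) := Finset.sum_le_sum fun i _ => hsite i
    _ = (1 - h / 2 + 2 * (∑ i, C i) * h ^ 2) * ∑ i, ‖osc (k i) O‖
        + h * ∑ i, ∑ j, ‖hk.oscDefect j (K j) O i‖ := by
        rw [Finset.sum_add_distrib, ← Finset.mul_sum, ← Finset.mul_sum]
    _ ≤ (1 - h / 2 + 2 * (∑ i, C i) * h ^ 2) * ∑ i, ‖osc (k i) O‖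
        + h * (1 / 4 * ∑ i, ‖osc (k i) O‖) := by gcongr
    _ = _ := by ring

end IsSpinSystem

end Contraction

/-! ### Locality of the Heisenberg evolution -/

section Evolution

variable {𝒜 : Type*} [CStarAlgebra 𝒜]

/-- The Heisenberg evolution `e^{iHs} A e^{-iHs}`. -/
def heisEvo (H : 𝒜) (s : ℝ) (A : 𝒜) : 𝒜 :=
  NormedSpace.exp ((Complex.I * (s : ℂ)) • H) * A *
    NormedSpace.exp ((-(Complex.I * (s : ℂ))) • H)

theorem exp_mul_exp_neg (z : ℂ) (H : 𝒜) :
    NormedSpace.exp (z • H) * NormedSpace.exp ((-z) • H) = 1 := by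
  let +nondep : NormedAlgebra ℚ 𝒜 := .restrictScalars ℚ ℂ 𝒜
  rw [neg_smul, ← NormedSpace.exp_add_of_commute (Commute.refl _).neg_right, add_neg_cancel,
    NormedSpace.exp_zero]

theorem heisEvo_zero (H A : 𝒜) : heisEvo H 0 A = A := by
  simp [heisEvo, NormedSpace.exp_zero]

theorem heisEvo_neg_heisEvo (H : 𝒜) (s : ℝ) (A : 𝒜) : heisEvo H (-s) (heisEvo H s A) = A := by
  have h1 := exp_mul_exp_neg (-(Complex.I * (s : ℂ))) H
  rw [neg_neg] at h1
  simp only [heisEvo, Complex.ofReal_neg, mul_neg, neg_neg]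
  calc _ = (NormedSpace.exp ((-(Complex.I * (s : ℂ))) • H) *
        NormedSpace.exp ((Complex.I * (s : ℂ)) • H)) * A *
        (NormedSpace.exp ((-(Complex.I * (s : ℂ))) • H) *
        NormedSpace.exp ((Complex.I * (s : ℂ)) • H)) := by simp only [mul_assoc]
    _ = A := by rw [h1, one_mul, mul_one]

theorem heisEvo_neg_left (H : 𝒜) (s : ℝ) (A : 𝒜) : heisEvo (-H) s A = heisEvo H (-s) A := by
  simp [heisEvo]

theorem heisEvo_sub (H : 𝒜) (s : ℝ) (A B : 𝒜) :
    heisEvo H s (A - B) = heisEvo H s A - heisEvo H s B := by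
  simp only [heisEvo, mul_sub, sub_mul]

theorem heisEvo_smul (H : 𝒜) (s : ℝ) (c : ℂ) (A : 𝒜) :
    heisEvo H s (c • A) = c • heisEvo H s A := by
  simp only [heisEvo, mul_smul_comm, smul_mul_assoc]

theorem heisEvo_commutator (H : 𝒜) (s : ℝ) (A : 𝒜) :
    heisEvo H s (H * A - A * H) = H * heisEvo H s A - heisEvo H s A * H := by
  have h : ∀ z : ℂ, Commute H (NormedSpace.exp (z • H)) := fun z =>
    ((Commute.refl H).smul_right z).exp_right
  simp only [heisEvo, mul_sub, sub_mul]
  congr 1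
  · simp only [← mul_assoc, (h _).eq]
  · simp only [mul_assoc, (h _).eq]

theorem norm_exp_mul_I_le {H : 𝒜} (hH : IsSelfAdjoint H) (s : ℝ) :
    ‖NormedSpace.exp ((Complex.I * (s : ℂ)) • H)‖ ≤ 1 := by
  let +nondep : NormedAlgebra ℚ 𝒜 := .restrictScalars ℚ ℂ 𝒜
  have h : (Complex.I * (s : ℂ)) • H ∈ skewAdjoint 𝒜 := by
    rw [skewAdjoint.mem_iff, star_smul, hH.star_eq]
    simp
  have hu := NormedSpace.exp_mem_unitary_of_mem_skewAdjoint h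
  rcases subsingleton_or_nontrivial 𝒜 with h' | h'
  · rw [Subsingleton.elim (NormedSpace.exp ((Complex.I * (s : ℂ)) • H)) 0]; simp
  · exact (CStarRing.norm_of_mem_unitary hu).le

theorem norm_heisEvo_le {H : 𝒜} (hH : IsSelfAdjoint H) (s : ℝ) (A : 𝒜) :
    ‖heisEvo H s A‖ ≤ ‖A‖ := by
  have h1 := norm_exp_mul_I_le hH s
  have h2 := norm_exp_mul_I_le hH (-s)
  rw [Complex.ofReal_neg, mul_neg] at h2
  calc _ ≤ _ := norm_mul_le _ _
    _ ≤ ‖NormedSpace.exp ((Complex.I * (s : ℂ)) • H)‖ * ‖A‖ *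
        ‖NormedSpace.exp ((-(Complex.I * (s : ℂ))) • H)‖ :=
        mul_le_mul_of_nonneg_right (norm_mul_le _ _) (norm_nonneg _)
    _ ≤ 1 * ‖A‖ * 1 := by gcongr
    _ = _ := by ring

theorem norm_heisEvo {H : 𝒜} (hH : IsSelfAdjoint H) (s : ℝ) (A : 𝒜) :
    ‖heisEvo H s A‖ = ‖A‖ :=
  le_antisymm (norm_heisEvo_le hH s A) (by
    conv_lhs => rw [← heisEvo_neg_heisEvo H s A]
    exact norm_heisEvo_le hH _ _)

theorem hasDerivAt_exp_mul_I (H : 𝒜) (c : ℂ) (s : ℝ) :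
    HasDerivAt (fun s : ℝ => NormedSpace.exp ((c * (s : ℂ)) • H))
      (NormedSpace.exp ((c * (s : ℂ)) • H) * (c • H)) s := by
  have h := hasDerivAt_exp_smul_const (𝕂 := ℝ) (c • H) s
  have e : ∀ s : ℝ, (c * (s : ℂ)) • H = s • (c • H) := fun s => by
    rw [mul_comm, mul_smul]; rfl
  simpa only [e] using h

theorem hasDerivAt_heisEvo (H : 𝒜) {f : ℝ → 𝒜} {f' : 𝒜} {s : ℝ} (hf : HasDerivAt f f' s) :
    HasDerivAt (fun s => heisEvo H s (f s))
      (heisEvo H s (f' + Complex.I • (H * f s - f s * H))) s := by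
  have h1 := hasDerivAt_exp_mul_I H Complex.I s
  have h2 := hasDerivAt_exp_mul_I H (-Complex.I) s
  have h3 := (h1.mul hf).mul h2
  have hc : Commute H (NormedSpace.exp ((-Complex.I * (s : ℂ)) • H)) :=
    ((Commute.refl H).smul_right _).exp_right
  simp only [neg_mul] at h3 hc
  refine h3.congr_deriv ?_
  simp only [heisEvo, Pi.mul_apply, mul_add, add_mul, mul_sub, sub_mul, smul_sub,
    mul_smul_comm, smul_mul_assoc, mul_assoc, ← hc.eq]
  module

theorem hasDerivAt_heisEvo_const (H A : 𝒜) (s : ℝ) :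
    HasDerivAt (fun s => heisEvo H s A)
      (Complex.I • (H * heisEvo H s A - heisEvo H s A * H)) s := by
  have h := hasDerivAt_heisEvo H (hasDerivAt_const s A)
  rwa [zero_add, heisEvo_smul, heisEvo_commutator] at h

theorem hasDerivAt_heisEvo_neg (H : 𝒜) {f : ℝ → 𝒜} {f' : 𝒜} {s : ℝ} (hf : HasDerivAt f f' s) :
    HasDerivAt (fun s => heisEvo H (-s) (f s))
      (heisEvo H (-s) (f' - Complex.I • (H * f s - f s * H))) s := by
  have h := hasDerivAt_heisEvo (-H) hf
  simp only [heisEvo_neg_left] at h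
  convert h using 2
  simp only [neg_mul, mul_neg, sub_neg_eq_add, smul_sub, smul_add, smul_neg]
  abel

theorem continuous_heisEvo (H A : 𝒜) : Continuous fun s => heisEvo H s A :=
  continuous_iff_continuousAt.2 fun s => (hasDerivAt_heisEvo_const H A s).continuousAt

end Evolution

/-! ### Lieb–Robinson bound for the oscillations. -/

section LiebRobinson

variable {𝒜 : Type*} [CStarAlgebra 𝒜] {Λ : Type*} [Fintype Λ] [DecidableEq Λ] {k : Λ → 𝒜}

theorem condExp_commutator {A a : 𝒜} (h : CommutesWith A a) (O : 𝒜) :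
    condExp a (A * O - O * A) = A * condExp a O - condExp a O * A := by
  rw [map_sub, condExp_mul_left h, condExp_mul_right h]

namespace IsSpinSystem

variable (hk : IsSpinSystem k)
include hk

/-- Both commutators vanish on operators trivial on S, so O may be replaced by O - O'. In the
Lieb–Robinson estimate this is the source through which an interaction term spreads oscillations. -/
theorem norm_commutator_localized_le {S : Finset Λ} {T : 𝒜} (hT : LocalizedOn k S T) (O : 𝒜)
    (i : Λ) :
    ‖osc (k i) (T * O - O * T) - (T * osc (k i) O - osc (k i) O * T)‖ ≤
      4 * ‖T‖ * ∑ m ∈ S, ‖osc (k m) O‖ := by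
  obtain ⟨O', h1, h2⟩ := hk.exists_commutesWith_approx S O
  have hz : ∀ P, (∀ i ∈ S, CommutesWith P (k i)) → T * P - P * T = 0 := fun P hP => by
    rw [(hk.commute_of_localizedOn S _ P hT hP).eq, sub_self]
  have hn : ∀ P, ‖T * P - P * T‖ ≤ 2 * ‖T‖ * ‖P‖ := fun P => by
    refine (norm_sub_le _ _).trans ?_
    linarith [norm_mul_le T P, norm_mul_le P T]
  set P := O - O' with hP
  have e1 : T * O - O * T = T * P - P * T := by
    have := hz O' h1
    rw [sub_eq_zero] at this
    simp only [hP, mul_sub, sub_mul, this]; abel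
  have e2 : T * condExp (k i) O - condExp (k i) O * T =
      T * condExp (k i) P - condExp (k i) P * T := by
    have := hz _ fun m hm => hk.commutesWith_condExp i (h1 m hm)
    rw [sub_eq_zero] at this
    simp only [hP, map_sub, mul_sub, sub_mul, this]; abel
  have e : osc (k i) (T * O - O * T) - (T * osc (k i) O - osc (k i) O * T) =
      (T * condExp (k i) P - condExp (k i) P * T) - condExp (k i) (T * P - P * T) := by
    rw [← e2, ← e1, osc_apply, osc_apply]
    simp only [mul_sub, sub_mul]; abel
  rw [e]
  have h3 := hn P
  have h4 := hn (condExp (k i) P)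
  have h5 := (hk.lowering i).norm_condExp_le P
  have h6 := (hk.lowering i).norm_condExp_le (T * P - P * T)
  have h7 := norm_sub_le (T * condExp (k i) P - condExp (k i) P * T)
    (condExp (k i) (T * P - P * T))
  have h8 : ‖T‖ * ‖condExp (k i) P‖ ≤ ‖T‖ * ‖P‖ := by gcongr
  have h9 : ‖T‖ * ‖P‖ ≤ ‖T‖ * ∑ m ∈ S, ‖osc (k m) O‖ := by gcongr
  linarith

/-- A Lieb–Robinson bound: growth of the oscillations of `e^{iHs} X e^{-iHs}` away from the site
`j` where `X` acts, for positive times. -/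
theorem norm_osc_heisEvo_le_of_nonneg {d : Λ → Λ → ℕ} {q : ℕ} {Γ : ℝ} (hd : HasPolyGrowth d q Γ)
    {H H₀ : 𝒜} {g : Λ → 𝒜} {S : Λ → Finset Λ} {e b : ℝ} {l r : ℕ} (hH : IsSelfAdjoint H)
    (hHg : H = H₀ + ∑ n, g n)
    (hH₀ : ∀ m A, condExp (k m) (H₀ * A - A * H₀) = H₀ * condExp (k m) A - condExp (k m) A * H₀)
    (hgS : ∀ n, LocalizedOn k (S n) (g n)) (hgn : ∀ n, ‖g n‖ ≤ e)
    (hgl : ∀ m, ∃ N : Finset Λ, N.card ≤ l ∧ ∀ n, n ∉ N → CommutesWith (g n) (k m))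
    (hSb : ∀ n, ((S n).card : ℝ) ≤ b) (hr : 0 < r)
    (hSr : ∀ n, ∀ m ∈ S n, ∀ m' ∈ S n, d m m' ≤ r) (he : 0 ≤ e)
    {j : Λ} {X : 𝒜} (hX : LocalizedOn k {j} X) (hXn : ‖X‖ ≤ 1) {t : ℝ} (ht : 0 ≤ t)
    {m : Λ} (hm : m ≠ j) :
    ‖osc (k m) (heisEvo H t X)‖ ≤
      2 * ((4 * Real.exp 1 * e * l * b * t) * Real.exp (4 * Real.exp 1 * e * l * b * t
        - (d m j : ℝ) / r)) := by
  set w : ℝ := 4 * Real.exp 1 * e * l * b with hw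
  have hb : 0 ≤ b := le_trans (Nat.cast_nonneg _) (hSb j)
  have hw0 : 0 ≤ w := by positivity
  set lam : Λ → ℝ := fun m => Real.exp ((d m j : ℝ) / r) with hlam
  have hlam0 : ∀ m, 0 < lam m := fun m => Real.exp_pos _
  set A : ℝ → 𝒜 := fun s => heisEvo H s X with hA
  set R : Λ → ℝ → 𝒜 := fun m s => osc (k m) (H * A s - A s * H)
    - (H * osc (k m) (A s) - osc (k m) (A s) * H) with hR
  -- Pulling the oscillations back by the isometric evolution removes the commutator with H from
  -- their derivative; only the failure R of osc to commute with it remains. The weights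
  -- e^{d(m,j)/r} turn spatial decay into a bound on a sup norm.
  set B : ℝ → Λ → 𝒜 := fun s m => (lam m : ℂ) • heisEvo H (-s) (osc (k m) (A s)) with hB
  set B' : ℝ → Λ → 𝒜 := fun s m => (lam m : ℂ) • heisEvo H (-s) (Complex.I • R m s) with hB'
  have hderiv : ∀ s, HasDerivAt B (B' s) s := by
    intro s
    rw [hasDerivAt_pi]
    intro m
    have h1 : HasDerivAt (fun s => osc (k m) (A s))
        (osc (k m) (Complex.I • (H * A s - A s * H))) s :=
      ((osc (k m)).restrictScalars ℝ).hasFDerivAt.comp_hasDerivAt s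
        (hasDerivAt_heisEvo_const H X s)
    have h2 := (hasDerivAt_heisEvo_neg H h1).const_smul (lam m : ℂ)
    refine h2.congr_deriv ?_
    simp only [hB', hR]
    rw [map_smul, ← smul_sub]
  have hnormB : ∀ s m, ‖osc (k m) (A s)‖ ≤ (lam m)⁻¹ * ‖B s‖ := by
    intro s m
    have h1 : ‖B s m‖ = lam m * ‖osc (k m) (A s)‖ := by
      simp only [hB]
      rw [norm_smul, Complex.norm_real, Real.norm_of_nonneg (hlam0 m).le, norm_heisEvo hH]
    have h2 := norm_le_pi_norm (B s) m
    rw [h1] at h2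
    rw [inv_mul_eq_div, le_div_iff₀ (hlam0 m)]
    linarith
  -- H₀ drops out because conditioning commutes with its commutator. The growth rate w collects at
  -- most l terms acting at m, a factor 4e for each, at most b sites per term, and Euler's number
  -- for the ratio of weights at distance at most r.
  have hRn : ∀ s m, lam m * ‖R m s‖ ≤ w * ‖B s‖ := by
    intro s m
    obtain ⟨N, hNl, hN⟩ := hgl m
    have e1 : R m s = ∑ n ∈ N, (osc (k m) (g n * A s - A s * g n)
        - (g n * osc (k m) (A s) - osc (k m) (A s) * g n)) := by
      have hsplit : ∀ P : 𝒜, H * P - P * H = (H₀ * P - P * H₀) + ∑ n, (g n * P - P * g n) := by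
        intro P
        rw [hHg, Finset.sum_sub_distrib, ← Finset.sum_mul, ← Finset.mul_sum]
        noncomm_ring
      have h0 : osc (k m) (H₀ * A s - A s * H₀) =
          H₀ * osc (k m) (A s) - osc (k m) (A s) * H₀ := by
        rw [osc_apply, hH₀, osc_apply]; noncomm_ring
      have h1 : R m s = ∑ n, (osc (k m) (g n * A s - A s * g n)
          - (g n * osc (k m) (A s) - osc (k m) (A s) * g n)) := by
        simp only [hR]
        rw [hsplit (A s), hsplit (osc (k m) (A s)), map_add, map_sum, h0,
          add_sub_add_left_eq_sub, ← Finset.sum_sub_distrib]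
      rw [h1]
      refine (Finset.sum_subset (Finset.subset_univ N) fun n _ hn => ?_).symm
      rw [osc_apply, condExp_commutator (hN n hn), osc_apply]
      noncomm_ring
    have hterm : ∀ n, n ∈ N → lam m * ‖osc (k m) (g n * A s - A s * g n)
        - (g n * osc (k m) (A s) - osc (k m) (A s) * g n)‖ ≤
        4 * e * (b * Real.exp 1) * ‖B s‖ := by
      intro n _
      by_cases hmS : m ∈ S n
      · have h1 := hk.norm_commutator_localized_le (hgS n) (A s) m
        have h2 : lam m * ∑ m' ∈ S n, ‖osc (k m') (A s)‖ ≤ b * Real.exp 1 * ‖B s‖ := by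
          rw [Finset.mul_sum]
          calc _ ≤ ∑ m' ∈ S n, Real.exp 1 * ‖B s‖ := by
                refine Finset.sum_le_sum fun m' hm' => ?_
                have h3 : lam m * (lam m')⁻¹ ≤ Real.exp 1 := by
                  simp only [hlam]
                  rw [← Real.exp_neg, ← Real.exp_add]
                  refine Real.exp_le_exp.2 ?_
                  have h4 : (d m j : ℝ) ≤ r + d m' j := by
                    exact_mod_cast (hd.triangle m m' j).trans
                      (Nat.add_le_add_right (hSr n m hmS m' hm') _)
                  have hr' : (0 : ℝ) < r := by exact_mod_cast hr
                  rw [← sub_eq_add_neg, ← sub_div, div_le_one hr']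
                  linarith
                calc lam m * ‖osc (k m') (A s)‖ ≤ lam m * ((lam m')⁻¹ * ‖B s‖) :=
                      mul_le_mul_of_nonneg_left (hnormB s m') (hlam0 m).le
                  _ = lam m * (lam m')⁻¹ * ‖B s‖ := by ring
                  _ ≤ _ := by gcongr
            _ = (S n).card * (Real.exp 1 * ‖B s‖) := by simp
            _ ≤ b * (Real.exp 1 * ‖B s‖) := by gcongr; exact hSb n
            _ = _ := by ring
        calc _ ≤ lam m * (4 * ‖g n‖ * ∑ m' ∈ S n, ‖osc (k m') (A s)‖) :=
              mul_le_mul_of_nonneg_left h1 (hlam0 m).le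
          _ = 4 * ‖g n‖ * (lam m * ∑ m' ∈ S n, ‖osc (k m') (A s)‖) := by ring
          _ ≤ 4 * e * (b * Real.exp 1 * ‖B s‖) := by
              have := hgn n
              have h0 : 0 ≤ lam m * ∑ m' ∈ S n, ‖osc (k m') (A s)‖ :=
                mul_nonneg (hlam0 m).le (Finset.sum_nonneg fun _ _ => norm_nonneg _)
              gcongr
          _ = _ := by ring
      · have : osc (k m) (g n * A s - A s * g n)
            - (g n * osc (k m) (A s) - osc (k m) (A s) * g n) = 0 := by
          rw [osc_apply, condExp_commutator (hgS n m hmS), osc_apply]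
          noncomm_ring
        rw [this, norm_zero, mul_zero]
        positivity
    rw [e1]
    calc _ ≤ lam m * ∑ n ∈ N, ‖osc (k m) (g n * A s - A s * g n)
        - (g n * osc (k m) (A s) - osc (k m) (A s) * g n)‖ :=
          mul_le_mul_of_nonneg_left (norm_sum_le _ _) (hlam0 m).le
      _ ≤ ∑ n ∈ N, 4 * e * (b * Real.exp 1) * ‖B s‖ := by
          rw [Finset.mul_sum]
          exact Finset.sum_le_sum hterm
      _ = (N.card : ℝ) * (4 * e * (b * Real.exp 1) * ‖B s‖) := by simp
      _ ≤ (l : ℝ) * (4 * e * (b * Real.exp 1) * ‖B s‖) := by gcongr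
      _ = _ := by rw [hw]; ring
  have hB'n : ∀ s, ‖B' s‖ ≤ w * ‖B s‖ := by
    intro s
    rw [pi_norm_le_iff_of_nonneg (by positivity)]
    intro m
    simp only [hB']
    rw [norm_smul, Complex.norm_real, Real.norm_of_nonneg (hlam0 m).le, norm_heisEvo hH,
      norm_smul, Complex.norm_I, one_mul]
    exact hRn s m
  have hB0m : ∀ m, m ≠ j → B 0 m = 0 := by
    intro m hm
    simp only [hB, hA, neg_zero, heisEvo_zero]
    rw [(hk.lowering m).osc_of_commutesWith (hX m (by simpa using hm)), smul_zero]
  have hB0 : ‖B 0‖ ≤ 2 := by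
    rw [pi_norm_le_iff_of_nonneg (by norm_num)]
    intro m
    by_cases hmj : m = j
    · subst hmj
      simp only [hB, hA, neg_zero, heisEvo_zero, hlam, hd.self]
      simp only [Nat.cast_zero, zero_div, Real.exp_zero, Complex.ofReal_one, one_smul]
      linarith [(hk.lowering m).norm_osc_le X]
    · rw [hB0m m hmj, norm_zero]; norm_num
  have hgron : ∀ s ∈ Set.Icc 0 t, ‖B s‖ ≤ 2 * Real.exp (w * s) := by
    have h := norm_le_gronwallBound_of_norm_deriv_right_le (f := B) (f' := B') (δ := 2) (K := w)
      (ε := 0) (a := 0) (b := t) (fun s _ => (hderiv s).continuousAt.continuousWithinAt)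
      (fun s _ => (hderiv s).hasDerivWithinAt) hB0 (fun s _ => by rw [add_zero]; exact hB'n s)
    intro s hs
    have h' := h s hs
    rwa [gronwallBound_ε0, sub_zero] at h'
  -- Oscillations away from j start from zero. Integrating the derivative once more, instead of
  -- using Grönwall alone, produces the prefactor w t, which makes the bound linear in the coupling.
  have hmv := norm_image_sub_le_of_norm_deriv_le_segment' (f := B) (f' := B')
    (C := w * (2 * Real.exp (w * t))) (a := 0) (b := t)
    (fun s _ => (hderiv s).hasDerivWithinAt)
    (fun s hs => (hB'n s).trans (by
      have h1 := hgron s ⟨hs.1, hs.2.le⟩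
      have h2 : Real.exp (w * s) ≤ Real.exp (w * t) :=
        Real.exp_le_exp.2 (mul_le_mul_of_nonneg_left hs.2.le hw0)
      exact mul_le_mul_of_nonneg_left (h1.trans (by linarith)) hw0)) t ⟨ht, le_rfl⟩
  have h1 : ‖B t m‖ ≤ w * (2 * Real.exp (w * t)) * t := by
    have := (norm_le_pi_norm (B t - B 0) m).trans hmv
    rwa [Pi.sub_apply, hB0m m hm, sub_zero, sub_zero] at this
  have h2 : ‖B t m‖ = lam m * ‖osc (k m) (A t)‖ := by
    simp only [hB]
    rw [norm_smul, Complex.norm_real, Real.norm_of_nonneg (hlam0 m).le, norm_heisEvo hH]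
  rw [h2] at h1
  rw [Real.exp_sub, ← mul_div_assoc, ← mul_div_assoc, le_div_iff₀ (Real.exp_pos _)]
  calc _ = lam m * ‖osc (k m) (A t)‖ := by simp only [hlam, hA]; ring
    _ ≤ _ := h1
    _ = _ := by ring

end IsSpinSystem

end LiebRobinson

/-! ### Jump operators of weakly coupled spins -/

section WeakCoupling

variable {𝒜 : Type*} [CStarAlgebra 𝒜] {Λ : Type*} [Fintype Λ] [DecidableEq Λ] {k : Λ → 𝒜}

/-- `H = -∑ Z_i + ∑ g_n` with self-adjoint terms `g_n` of norm at most `e` on the balls of radius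
`r`, of which at most `l` act on any given spin. -/
structure IsWeaklyCoupled (k : Λ → 𝒜) (d : Λ → Λ → ℕ) (H : 𝒜) (g : Λ → 𝒜) (e : ℝ) (l r : ℕ) :
    Prop where
  eq : H = -∑ i, (k i * star (k i) - star (k i) * k i) + ∑ n, g n
  selfAdjoint : ∀ n, IsSelfAdjoint (g n)
  localized : ∀ n, LocalizedOn k (ballOf d n r) (g n)
  norm_le : ∀ n, ‖g n‖ ≤ e
  overlap : ∀ m, ∃ N : Finset Λ, N.card ≤ l ∧ ∀ n, n ∉ N → CommutesWith (g n) (k m)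

namespace IsLowering

variable {a : 𝒜} (ha : IsLowering a)
include ha

/-- Both sides vanish: |0⟩ is an eigenvector of Z, and Z commutes with everything conditioned on the
spin. The free Hamiltonian therefore spreads no oscillations. -/
theorem condExp_commutator_parity (A : 𝒜) :
    condExp a ((a * star a - star a * a) * A - A * (a * star a - star a * a)) =
      (a * star a - star a * a) * condExp a A - condExp a A * (a * star a - star a * a) := by
  have hc := ha.condExp_commutesWith A
  have h1 : Commute (condExp a A) (a * star a - star a * a) :=
    (hc.1.mul_right hc.2).sub_right (hc.2.mul_right hc.1)
  rw [h1.eq, sub_self]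
  simp only [condExp_apply, mul_sub, sub_mul, mul_add, add_mul, mul_assoc, ha.mul_self,
    ha.mul_star_mul, ha.star_mul_star, ha.star_mul_mul_star, ha.mul_self_assoc,
    ha.star_mul_star_assoc, ha.mul_star_mul_assoc, ha.star_mul_mul_star_assoc, mul_zero,
    add_zero, zero_add, sub_zero, zero_sub]
  abel

theorem norm_add_star_le : ‖a + star a‖ ≤ 1 := by
  have h1 : ‖a + star a‖ * ‖a + star a‖ ≤ 1 := by
    rw [← CStarRing.norm_star_mul_self]
    refine le_trans (le_of_eq ?_) (norm_one_le_one (𝒜 := 𝒜))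
    rw [← ha.car]
    congr 1
    simp only [star_add, star_star, mul_add, add_mul, ha.mul_self, ha.star_mul_star]
    abel
  nlinarith [norm_nonneg (a + star a)]

end IsLowering

/-- Interpolation between a trivial and an exponential bound. -/
theorem le_of_le_one_of_le_mul_exp {v x y : ℝ} (p : ℕ) (hx : 0 ≤ x) (hy : 0 ≤ y) (h1 : v ≤ 1)
    (h2 : v ≤ x * Real.exp (x - y)) :
    v ≤ Real.exp 1 * p.factorial * x * ((1 + x) / (1 + y)) ^ p := by
  have hfac : (1 : ℝ) ≤ p.factorial := by exact_mod_cast Nat.one_le_of_lt p.factorial_pos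
  have hexp : (1 : ℝ) ≤ Real.exp 1 := Real.one_le_exp zero_le_one
  -- For y ≤ x the ratio is at least 1, and e x dominates: by v ≤ 1 if x ≥ 1, and by the exponential
  -- bound if x ≤ 1.
  rcases le_total y x with hyx | hxy
  · have hr : 1 ≤ ((1 + x) / (1 + y)) ^ p :=
      one_le_pow₀ ((one_le_div (by positivity)).2 (by linarith))
    have hv : v ≤ Real.exp 1 * x := by
      rcases le_total 1 x with h | h
      · nlinarith
      · refine h2.trans ?_
        rw [mul_comm]
        gcongr
        linarith
    calc v ≤ Real.exp 1 * 1 * x * 1 := by linarith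
      _ ≤ _ := by gcongr
  -- Here the exponential beats the power 1 + (y - x), and (1 + x)(1 + y - x) = 1 + y + x(y - x) ≥ 1
  -- + y. The prefactor x is retained.
  · have h3 : (1 + (y - x)) ^ p ≤ p.factorial * Real.exp (1 + (y - x)) := by
      have := Real.pow_div_factorial_le_exp (1 + (y - x)) (by linarith) p
      rwa [div_le_iff₀ (by positivity), mul_comm] at this
    have h4 : Real.exp (x - y) ≤ Real.exp 1 * p.factorial * (1 / (1 + (y - x))) ^ p := by
      rw [one_div, inv_pow, ← div_eq_mul_inv, le_div_iff₀ (by positivity)]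
      calc _ ≤ Real.exp (x - y) * (p.factorial * Real.exp (1 + (y - x))) := by gcongr
        _ = p.factorial * (Real.exp (x - y) * Real.exp (1 + (y - x))) := by ring
        _ = _ := by rw [← Real.exp_add]; ring_nf
    have h5 : 1 / (1 + (y - x)) ≤ (1 + x) / (1 + y) := by
      rw [div_le_div_iff₀ (by positivity) (by positivity)]
      nlinarith
    calc v ≤ x * Real.exp (x - y) := h2
      _ ≤ x * (Real.exp 1 * p.factorial * ((1 + x) / (1 + y)) ^ p) := by
          gcongr
          exact h4.trans (by gcongr)
      _ = _ := by ring

namespace IsWeaklyCoupled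

variable {d : Λ → Λ → ℕ} {q : ℕ} {Γ : ℝ} {H : 𝒜} {g : Λ → 𝒜} {e : ℝ} {l r : ℕ}
  (hw : IsWeaklyCoupled k d H g e l r) (hk : IsSpinSystem k) (hd : HasPolyGrowth d q Γ)
include hw

theorem isSelfAdjoint : IsSelfAdjoint H := by
  rw [hw.eq]
  have h1 : IsSelfAdjoint (∑ i, (k i * star (k i) - star (k i) * k i)) :=
    isSelfAdjoint_sum _ fun i _ => (IsSelfAdjoint.mul_star_self (k i)).sub
      (IsSelfAdjoint.star_mul_self (k i))
  exact h1.neg.add (isSelfAdjoint_sum _ fun n _ => hw.selfAdjoint n)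

include hk

theorem condExp_commutator_free (m : Λ) (A : 𝒜) :
    condExp (k m) ((∑ i, (k i * star (k i) - star (k i) * k i)) * A
      - A * ∑ i, (k i * star (k i) - star (k i) * k i)) =
    (∑ i, (k i * star (k i) - star (k i) * k i)) * condExp (k m) A
      - condExp (k m) A * ∑ i, (k i * star (k i) - star (k i) * k i) := by
  simp only [Finset.sum_mul, Finset.mul_sum, ← Finset.sum_sub_distrib, map_sum]
  refine Finset.sum_congr rfl fun i _ => ?_
  by_cases him : i = m
  · subst him; exact (hk.lowering i).condExp_commutator_parity A
  · have h := hk.commutes i m him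
    exact condExp_commutator ((h.mul h.star).sub (h.star.mul h)) A

theorem norm_osc_evolved_le (hd : HasPolyGrowth d q Γ) (hr : 1 ≤ r) (he : 0 ≤ e)
    {j m : Λ} (hm : m ≠ j) (s : ℝ) :
    ‖osc (k m) (heisEvo H s (k j + star (k j)))‖ ≤
      2 * ((4 * Real.exp 1 * e * l * (Γ * (1 + (r : ℝ)) ^ q) * |s|) *
        Real.exp (4 * Real.exp 1 * e * l * (Γ * (1 + (r : ℝ)) ^ q) * |s|
        - (d m j : ℝ) / (2 * r : ℕ))) := by
  have hX : LocalizedOn k {j} (k j + star (k j)) := fun i hi => by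
    have h := hk.commutes j i (by rintro rfl; simp at hi)
    exact h.add h.star
  have hSr : ∀ n, ∀ m ∈ ballOf d n r, ∀ m' ∈ ballOf d n r, d m m' ≤ 2 * r := by
    intro n m hm m' hm'
    have h1 := mem_ballOf.1 hm
    have h2 := mem_ballOf.1 hm'
    have h3 := hd.triangle m n m'
    rw [hd.symm n m'] at h3
    omega
  rcases le_total 0 s with hs | hs
  · rw [abs_of_nonneg hs]
    refine hk.norm_osc_heisEvo_le_of_nonneg hd hw.isSelfAdjoint hw.eq (fun m A => ?_)
      hw.localized hw.norm_le hw.overlap (fun n => hd.card_ballOf_le n r) (by omega) hSr he hX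
      (hk.lowering j).norm_add_star_le hs hm
    have := hw.condExp_commutator_free hk m A
    rw [neg_mul, mul_neg, sub_neg_eq_add, neg_mul, mul_neg, sub_neg_eq_add,
      neg_add_eq_sub, neg_add_eq_sub, ← neg_sub, map_neg, this, neg_sub]
  -- Negative times are positive times for -H, which has the same structure.
  · rw [abs_of_nonpos hs, ← neg_neg s, ← heisEvo_neg_left, neg_neg]
    refine hk.norm_osc_heisEvo_le_of_nonneg hd hw.isSelfAdjoint.neg
      (H₀ := ∑ i, (k i * star (k i) - star (k i) * k i)) (g := fun n => -g n)
      (by rw [hw.eq, neg_add, neg_neg, Finset.sum_neg_distrib]) (hw.condExp_commutator_free hk)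
      (fun n i hi => (hw.localized n i hi).neg) (fun n => by rw [norm_neg]; exact hw.norm_le n)
      (fun m => ?_) (fun n => hd.card_ballOf_le n r) (by omega) hSr he hX
      (hk.lowering j).norm_add_star_le (neg_nonneg.2 hs) hm
    obtain ⟨N, h1, h2⟩ := hw.overlap m
    exact ⟨N, h1, fun n hn => (h2 n hn).neg⟩

/-- Polynomial decay of the oscillations of the evolved coupling operator. -/
theorem norm_osc_evolved_le_poly (hd : HasPolyGrowth d q Γ) (hr : 1 ≤ r) (he : 0 ≤ e) (p : ℕ)
    (hw1 : 4 * Real.exp 1 * e * l * (Γ * (1 + (r : ℝ)) ^ q) ≤ 1)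
    {j m : Λ} (hm : m ≠ j) (s : ℝ) :
    ‖osc (k m) (heisEvo H s (k j + star (k j)))‖ ≤
      2 * Real.exp 1 * p.factorial * (4 * Real.exp 1 * e * l * (Γ * (1 + (r : ℝ)) ^ q)) *
        (2 * r) ^ p * ((1 + (d m j : ℝ)) ^ p)⁻¹ * (1 + |s|) ^ (p + 1) := by
  have : Nonempty Λ := ⟨j⟩
  have hΓ := hd.nonneg
  set w := 4 * Real.exp 1 * e * l * (Γ * (1 + (r : ℝ)) ^ q) with hwd
  have hw0 : 0 ≤ w := by positivity
  set v := ‖osc (k m) (heisEvo H s (k j + star (k j)))‖ with hv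
  -- Trivially v ≤ 2‖X‖ ≤ 2, so v/2 fits the interpolation with x = w|s| and y = d/(2r); the length
  -- 2r is the diameter of the supports.
  have h1 : v / 2 ≤ 1 := by
    have a1 := (hk.lowering m).norm_osc_le (heisEvo H s (k j + star (k j)))
    have a2 := norm_heisEvo_le hw.isSelfAdjoint s (k j + star (k j))
    have a3 := (hk.lowering j).norm_add_star_le
    linarith
  have h2 : v / 2 ≤ w * |s| * Real.exp (w * |s| - (d m j : ℝ) / (2 * r : ℕ)) := by
    linarith [hw.norm_osc_evolved_le hk hd hr he hm s]
  have h3 := le_of_le_one_of_le_mul_exp p (by positivity) (by positivity) h1 h2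
  have hr' : (1 : ℝ) ≤ r := by exact_mod_cast hr
  have h4 : (1 + w * |s|) / (1 + (d m j : ℝ) / (2 * r : ℕ)) ≤
      (1 + |s|) * (2 * r) * (1 + (d m j : ℝ))⁻¹ := by
    rw [← div_eq_mul_inv, div_le_div_iff₀ (by positivity) (by positivity)]
    have a1 : 1 + w * |s| ≤ 1 + |s| := by nlinarith [abs_nonneg s]
    have a2 : 1 + (d m j : ℝ) ≤ 2 * r * (1 + (d m j : ℝ) / (2 * r : ℕ)) := by
      push_cast
      rw [mul_add, mul_div_cancel₀ _ (by positivity)]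
      linarith
    calc _ ≤ (1 + |s|) * (2 * r * (1 + (d m j : ℝ) / (2 * r : ℕ))) := by gcongr
      _ = _ := by ring
  calc v = 2 * (v / 2) := by ring
    _ ≤ 2 * (Real.exp 1 * p.factorial * (w * |s|) *
        ((1 + |s|) * (2 * r) * (1 + (d m j : ℝ))⁻¹) ^ p) := by
        gcongr
        exact h3.trans (by gcongr)
    _ = 2 * Real.exp 1 * p.factorial * w * (2 * r) ^ p * ((1 + (d m j : ℝ)) ^ p)⁻¹ *
        ((1 + |s|) ^ p * |s|) := by rw [mul_pow, mul_pow, inv_pow]; ring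
    _ ≤ _ := by
        rw [pow_succ]
        gcongr
        linarith

/-- Comparison with the free evolution of the coupling operator. -/
theorem norm_evolved_sub_free_le (he : 0 ≤ e) (j : Λ) (s : ℝ) :
    ‖heisEvo H s (k j + star (k j)) - (Complex.exp (-2 * Complex.I * s) • k j +
      Complex.exp (2 * Complex.I * s) • star (k j))‖ ≤ 4 * e * l * |s| := by
  set Y : ℝ → 𝒜 := fun s => Complex.exp (-2 * Complex.I * s) • k j +
      Complex.exp (2 * Complex.I * s) • star (k j) with hY
  have hYd : ∀ s : ℝ, HasDerivAt Y ((-2 * Complex.I) • Complex.exp (-2 * Complex.I * s) • k j +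
      (2 * Complex.I) • Complex.exp (2 * Complex.I * s) • star (k j)) s := by
    intro s
    have h : ∀ c : ℂ, HasDerivAt (fun s : ℝ => Complex.exp (c * s))
        (c * Complex.exp (c * s)) s := fun c => by
      have h1 : HasDerivAt (fun s : ℝ => c * (s : ℂ)) (c * 1) s :=
        (Complex.ofRealCLM.hasDerivAt (x := s)).const_mul c
      simpa [mul_comm] using h1.cexp
    have h1 := ((h (-2 * Complex.I)).smul_const (k j)).add
      ((h (2 * Complex.I)).smul_const (star (k j)))
    simp only [mul_smul] at h1 ⊢
    exact h1
  have hc1 : ∀ i, (k i * star (k i) - star (k i) * k i) * k j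
      - k j * (k i * star (k i) - star (k i) * k i) = if i = j then 2 • k j else 0 := by
    intro i
    split_ifs with hij
    · subst hij
      have ha := hk.lowering i
      simp only [mul_sub, sub_mul, mul_assoc, ha.mul_self, ha.mul_star_mul, ha.mul_self_assoc,
        mul_zero, sub_zero, zero_sub]
      abel
    · have h := (hk.commutes j i (Ne.symm hij))
      have h' : Commute (k j) (k i * star (k i) - star (k i) * k i) :=
        (h.1.mul_right h.2).sub_right (h.2.mul_right h.1)
      rw [h'.eq, sub_self]
  have hfree1 : (-∑ i, (k i * star (k i) - star (k i) * k i)) * k j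
      - k j * (-∑ i, (k i * star (k i) - star (k i) * k i)) = (-2 : ℂ) • k j := by
    have : (∑ i, (k i * star (k i) - star (k i) * k i)) * k j
      - k j * (∑ i, (k i * star (k i) - star (k i) * k i)) = 2 • k j := by
      rw [Finset.sum_mul, Finset.mul_sum, ← Finset.sum_sub_distrib,
        Finset.sum_congr rfl fun i _ => hc1 i]
      simp
    rw [neg_mul, mul_neg, sub_neg_eq_add, neg_add_eq_sub, ← neg_sub, this, neg_smul,
      ofNat_smul_eq_nsmul ℂ 2 (k j)]
  have hfree2 : (-∑ i, (k i * star (k i) - star (k i) * k i)) * star (k j)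
      - star (k j) * (-∑ i, (k i * star (k i) - star (k i) * k i)) = (2 : ℂ) • star (k j) := by
    have h := congrArg star hfree1
    have hs : star (∑ i, (k i * star (k i) - star (k i) * k i)) =
        ∑ i, (k i * star (k i) - star (k i) * k i) := by
      simp [star_sum]
    simp only [star_sub, star_mul, star_neg, hs, star_smul] at h
    rw [← neg_sub, h]
    simp
  have hcomm : ∀ s, ‖(∑ n, g n) * Y s - Y s * ∑ n, g n‖ ≤ 4 * e * l := by
    intro s
    obtain ⟨N, hN, hNc⟩ := hw.overlap j
    have hYn : ‖Y s‖ ≤ 2 := by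
      have ha := (hk.lowering j).norm_le_one
      have e1 : ∀ c : ℝ, ‖Complex.exp (c * Complex.I * s)‖ = 1 := fun c => by
        rw [Complex.norm_exp]; simp
      have e2 := e1 (-2)
      have e3 := e1 2
      push_cast at e2 e3
      refine (norm_add_le _ _).trans ?_
      rw [norm_smul, norm_smul, e2, e3, norm_star]
      linarith
    rw [Finset.sum_mul, Finset.mul_sum, ← Finset.sum_sub_distrib,
      ← Finset.sum_subset (Finset.subset_univ N) (fun n _ hn => by
        have h := hNc n hn
        have h' : Commute (g n) (Y s) := (h.1.smul_right _).add_right (h.2.smul_right _)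
        rw [h'.eq, sub_self])]
    calc _ ≤ ∑ n ∈ N, 4 * e := by
          refine (norm_sum_le _ _).trans (Finset.sum_le_sum fun n _ => ?_)
          have a1 := norm_sub_le (g n * Y s) (Y s * g n)
          have a2 := norm_mul_le (g n) (Y s)
          have a3 := norm_mul_le (Y s) (g n)
          have a4 : ‖g n‖ * ‖Y s‖ ≤ e * 2 :=
            mul_le_mul (hw.norm_le n) hYn (norm_nonneg _) he
          linarith
      _ = N.card * (4 * e) := by simp
      _ ≤ l * (4 * e) := by gcongr
      _ = _ := by ring
  -- Interaction picture: the phases of Y solve the free equation, since [-∑ Z_i, k j] = -2 k j.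
  -- What remains is the commutator with at most l terms, each of norm at most 2 · e · 2.
  have hCd : ∀ s, HasDerivAt (fun s => heisEvo H (-s) (Y s))
      (heisEvo H (-s) (-(Complex.I • ((∑ n, g n) * Y s - Y s * ∑ n, g n)))) s := by
    intro s
    refine (hasDerivAt_heisEvo_neg H (hYd s)).congr_deriv ?_
    congr 1
    have h0 : (-∑ i, (k i * star (k i) - star (k i) * k i)) * Y s
        - Y s * (-∑ i, (k i * star (k i) - star (k i) * k i)) =
        (-2 : ℂ) • Complex.exp (-2 * Complex.I * s) • k j
          + (2 : ℂ) • Complex.exp (2 * Complex.I * s) • star (k j) := by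
      simp only [hY, mul_add, add_mul, mul_smul_comm, smul_mul_assoc]
      rw [smul_comm (-2 : ℂ), smul_comm (2 : ℂ), ← hfree1, ← hfree2, smul_sub, smul_sub]
      abel
    rw [hw.eq, add_mul _ _ (Y s), mul_add (Y s), add_sub_add_comm, h0]
    module
  have hmv := convex_univ.norm_image_sub_le_of_norm_hasDerivWithin_le
    (f := fun s => heisEvo H (-s) (Y s)) (C := 4 * e * l)
    (fun s _ => (hCd s).hasDerivWithinAt) (fun s _ => by
      rw [norm_heisEvo hw.isSelfAdjoint, norm_neg, norm_smul, Complex.norm_I, one_mul]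
      exact hcomm s) (Set.mem_univ (0 : ℝ)) (Set.mem_univ s)
  have hY0 : Y 0 = k j + star (k j) := by simp [hY]
  simp only [neg_zero, heisEvo_zero, hY0, sub_zero, Real.norm_eq_abs] at hmv
  calc _ = ‖heisEvo H s (heisEvo H (-s) (Y s) - (k j + star (k j)))‖ := by
        have := heisEvo_neg_heisEvo H (-s) (Y s)
        rw [neg_neg] at this
        rw [heisEvo_sub, this, norm_sub_rev]
    _ ≤ _ := by rw [norm_heisEvo hw.isSelfAdjoint]; exact hmv

end IsWeaklyCoupled

end WeakCoupling

/-! ### Quasi-locality of the filtered jump operators. -/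

section JumpBounds

open MeasureTheory

variable {𝒜 : Type*} [CStarAlgebra 𝒜] {Λ : Type*} [Fintype Λ] [DecidableEq Λ] {k : Λ → 𝒜}

theorem integrable_smul_of_norm_le {f : ℝ → ℂ} {p : ℕ} (hf : Continuous f)
    (hfi : Integrable fun s => ‖f s‖ * (1 + |s|) ^ p) {A : ℝ → 𝒜} (hA : Continuous A) {c : ℝ}
    (hc : ∀ s, ‖A s‖ ≤ c * (1 + |s|) ^ p) : Integrable fun s => f s • A s := by
  refine (hfi.const_mul c).mono' (hf.smul hA).aestronglyMeasurable
    (Filter.Eventually.of_forall fun s => ?_)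
  rw [norm_smul]
  calc _ ≤ ‖f s‖ * (c * (1 + |s|) ^ p) := by gcongr; exact hc s
    _ = _ := by ring

theorem norm_integral_smul_le {f : ℝ → ℂ} {p : ℕ}
    (hfi : Integrable fun s => ‖f s‖ * (1 + |s|) ^ p) {A : ℝ → 𝒜} {c M : ℝ} (hc0 : 0 ≤ c)
    (hM : ∫ s, ‖f s‖ * (1 + |s|) ^ p ≤ M) (hc : ∀ s, ‖A s‖ ≤ c * (1 + |s|) ^ p) :
    ‖∫ s, f s • A s‖ ≤ c * M := by
  refine (norm_integral_le_of_norm_le (hfi.const_mul c)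
    (Filter.Eventually.of_forall fun s => ?_)).trans ?_
  · rw [norm_smul]
    calc _ ≤ ‖f s‖ * (c * (1 + |s|) ^ p) := by gcongr; exact hc s
      _ = _ := by ring
  · rw [integral_const_mul]
    gcongr

namespace IsWeaklyCoupled

variable {d : Λ → Λ → ℕ} {q : ℕ} {Γ : ℝ} {H : 𝒜} {g : Λ → 𝒜} {e : ℝ} {l r : ℕ}

/-- The jump operators are quasi-local perturbations of the lowering operators. -/
theorem jump_bound (hw : IsWeaklyCoupled k d H g e l r) (hk : IsSpinSystem k)
    (hd : HasPolyGrowth d q Γ) (hr : 1 ≤ r) (he : 0 ≤ e)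
    (hw1 : 4 * Real.exp 1 * e * l * (Γ * (1 + (r : ℝ)) ^ q) ≤ 1)
    {f : ℝ → ℂ} (hf : Continuous f)
    (hfi : Integrable fun s => ‖f s‖ * (1 + |s|) ^ (3 * q + 1)) {M : ℝ}
    (hM : ∫ s, ‖f s‖ * (1 + |s|) ^ (3 * q + 1) ≤ M)
    (hf1 : ∫ s, f s * Complex.exp (-2 * Complex.I * s) = 1)
    (hf2 : ∫ s, f s * Complex.exp (2 * Complex.I * s) = 0) (j : Λ) :
    3 * ‖(∫ s, f s • heisEvo H s (k j + star (k j))) - k j‖ +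
      ∑ m ∈ Finset.univ.erase j, (1 + (d m j : ℝ)) ^ (2 * q) *
        ‖osc (k m) (∫ s, f s • heisEvo H s (k j + star (k j)))‖ ≤
    M * (12 * e * l + Γ * (2 * Real.exp 1 * (3 * q).factorial *
      (4 * Real.exp 1 * e * l * (Γ * (1 + (r : ℝ)) ^ q)) * (2 * r) ^ (3 * q))) := by
  have : Nonempty Λ := ⟨j⟩
  have hΓ := hd.nonneg
  set X := k j + star (k j) with hX
  have hM0 : 0 ≤ M := le_trans (integral_nonneg fun s => by positivity) hM
  have hpow : ∀ s : ℝ, 1 ≤ (1 + |s|) ^ (3 * q + 1) := fun s =>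
    one_le_pow₀ (by linarith [abs_nonneg s])
  have hpow' : ∀ s : ℝ, |s| ≤ (1 + |s|) ^ (3 * q + 1) := fun s => by
    have h := one_le_pow₀ (n := 3 * q) (show 1 ≤ 1 + |s| by linarith [abs_nonneg s])
    rw [pow_succ]
    nlinarith [abs_nonneg s]
  have hXi : Integrable fun s => f s • heisEvo H s X :=
    integrable_smul_of_norm_le hf hfi (continuous_heisEvo H X) (c := 1) fun s => by
      rw [norm_heisEvo hw.isSelfAdjoint, one_mul]
      exact (hk.lowering j).norm_add_star_le.trans (hpow s)
  have hei : ∀ c : ℝ, Integrable fun s : ℝ => f s * Complex.exp (c * Complex.I * s) := by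
    intro c
    refine integrable_smul_of_norm_le (𝒜 := ℂ) hf hfi (c := 1) (by fun_prop) fun s => ?_
    rw [one_mul, Complex.norm_exp]
    simpa using hpow s
  have he1 := hei (-2)
  have he2 := hei 2
  push_cast at he1 he2
  set Y : ℝ → 𝒜 := fun s => Complex.exp (-2 * Complex.I * s) • k j +
      Complex.exp (2 * Complex.I * s) • star (k j) with hY
  have hYf : ∀ s, f s • Y s = (f s * Complex.exp (-2 * Complex.I * s)) • k j +
      (f s * Complex.exp (2 * Complex.I * s)) • star (k j) := fun s => by
    simp only [hY, smul_add, mul_smul]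
  have hYi : Integrable fun s => f s • Y s := by
    simp only [hYf]
    exact (he1.smul_const _).add (he2.smul_const _)
  -- The filter keeps the frequency -2 of k j with weight 1 and suppresses the frequency +2 of its
  -- adjoint, so the free jump operator is exactly k j.
  have hYint : ∫ s, f s • Y s = k j := by
    simp only [hYf]
    rw [integral_add (he1.smul_const _) (he2.smul_const _), integral_smul_const,
      integral_smul_const, hf1, hf2, one_smul, zero_smul, add_zero]
  have b1 : ‖(∫ s, f s • heisEvo H s X) - k j‖ ≤ 4 * e * l * M := by
    have e1 : (∫ s, f s • heisEvo H s X) - k j = ∫ s, f s • (heisEvo H s X - Y s) := by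
      simp only [smul_sub]
      rw [integral_sub hXi hYi, hYint]
    rw [e1]
    refine norm_integral_smul_le hfi (by positivity) hM fun s => ?_
    refine (hw.norm_evolved_sub_free_le hk he j s).trans ?_
    exact mul_le_mul_of_nonneg_left (hpow' s) (by positivity)
  set c₀ := 2 * Real.exp 1 * (3 * q).factorial *
      (4 * Real.exp 1 * e * l * (Γ * (1 + (r : ℝ)) ^ q)) * (2 * r) ^ (3 * q) with hc₀
  have hc₀0 : 0 ≤ c₀ := by positivity
  have b2 : ∀ m ∈ Finset.univ.erase j, ‖osc (k m) (∫ s, f s • heisEvo H s X)‖ ≤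
      c₀ * ((1 + (d m j : ℝ)) ^ (3 * q))⁻¹ * M := by
    intro m hm
    rw [← (osc (k m)).integral_comp_comm hXi]
    simp only [map_smul]
    refine norm_integral_smul_le hfi (by positivity) hM fun s => ?_
    exact hw.norm_osc_evolved_le_poly hk hd hr he (3 * q) hw1 (Finset.ne_of_mem_erase hm) s
  -- Decay of order 3q pays for the weight of order 2q and leaves the order q, summable with total
  -- Γ. The time bound for order 3q grows with power 3q + 1, hence the moment required of f.
  have b3 : ∑ m ∈ Finset.univ.erase j, (1 + (d m j : ℝ)) ^ (2 * q) *
        ‖osc (k m) (∫ s, f s • heisEvo H s X)‖ ≤ M * (Γ * c₀) := by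
    calc _ ≤ ∑ m ∈ Finset.univ.erase j, c₀ * M * ((1 + (d m j : ℝ)) ^ q)⁻¹ := by
          refine Finset.sum_le_sum fun m hm => ?_
          have hp : (0 : ℝ) < 1 + d m j := by positivity
          calc _ ≤ (1 + (d m j : ℝ)) ^ (2 * q) * (c₀ * ((1 + (d m j : ℝ)) ^ (3 * q))⁻¹ * M) := by
                gcongr
                exact b2 m hm
            _ = _ := by
                rw [show 3 * q = 2 * q + q by ring, pow_add]
                field_simp
      _ ≤ ∑ m, c₀ * M * ((1 + (d m j : ℝ)) ^ q)⁻¹ :=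
          Finset.sum_le_univ_sum_of_nonneg fun m => by positivity
      _ = c₀ * M * ∑ m, ((1 + (d m j : ℝ)) ^ q)⁻¹ := by rw [Finset.mul_sum]
      _ ≤ c₀ * M * Γ := by gcongr; exact hd.sum_le j
      _ = _ := by ring
  linarith

end IsWeaklyCoupled

end JumpBounds

/-! ### The filter function -/

section Filter

open MeasureTheory FourierTransform

/-- The inverse Fourier transform in the normalization of the filter function. -/
def timeDomain (F : ℝ → ℂ) (s : ℝ) : ℂ :=
  (1 / (2 * Real.pi) : ℂ) * ∫ ω : ℝ, F ω * Complex.exp (-(Complex.I * ω * s))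

theorem timeDomain_eq_fourier (F : ℝ → ℂ) (s : ℝ) :
    timeDomain F s = (1 / (2 * Real.pi) : ℂ) * 𝓕 F (s / (2 * Real.pi)) := by
  rw [timeDomain, Real.fourier_real_eq_integral_exp_smul]
  congr 1
  refine integral_congr_ae (Filter.Eventually.of_forall fun ω => ?_)
  simp only [smul_eq_mul]
  rw [mul_comm]
  congr 2
  have : (Real.pi : ℂ) ≠ 0 := by exact_mod_cast Real.pi_ne_zero
  push_cast
  field_simp

/-! ### Smooth filters with compact frequency support. -/

section CompactSupport

variable {F : ℝ → ℂ} {R : ℝ} (hF : ContDiff ℝ (⊤ : ℕ∞) F) (hFs : tsupport F ⊆ Set.Icc (-R) R)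
include hF hFs

theorem integrable_iteratedDeriv (n : ℕ) : Integrable (iteratedDeriv n F) := by
  have hc : HasCompactSupport F := isCompact_Icc.of_isClosed_subset (isClosed_tsupport F) hFs
  refine Continuous.integrable_of_hasCompactSupport
    (hF.continuous_iteratedDeriv n (by exact_mod_cast le_top)) ?_
  refine hc.mono' ?_
  intro x hx
  refine support_iteratedFDeriv_subset (𝕜 := ℝ) n ?_
  rw [Function.mem_support] at hx ⊢
  rw [← norm_ne_zero_iff, norm_iteratedFDeriv_eq_norm_iteratedDeriv, norm_ne_zero_iff]
  exact hx

theorem integral_norm_iteratedDeriv_le {n : ℕ} {B : ℝ} (hR : 0 ≤ R)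
    (hB : ∀ ω, ‖iteratedDeriv n F ω‖ ≤ B) :
    ∫ ω, ‖iteratedDeriv n F ω‖ ≤ 2 * R * B := by
  have hz : ∀ x, x ∉ Set.Icc (-R) R → ‖iteratedDeriv n F x‖ = 0 := by
    intro x hx
    by_contra h
    refine hx (hFs (support_iteratedFDeriv_subset (𝕜 := ℝ) n ?_))
    rwa [Function.mem_support, ← norm_ne_zero_iff, norm_iteratedFDeriv_eq_norm_iteratedDeriv]
  rw [← setIntegral_eq_integral_of_forall_compl_eq_zero hz]
  calc _ ≤ ∫ ω in Set.Icc (-R) R, B :=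
        setIntegral_mono (integrable_iteratedDeriv hF hFs n).norm.integrableOn
          (integrableOn_const (by simp)) hB
    _ = 2 * R * B := by
        rw [setIntegral_const, Real.volume_real_Icc_of_le (by linarith), smul_eq_mul]; ring

/-- Integration by parts: at the argument s/(2π) the Fourier transform of the n-th derivative
carries the factor (i s)^n, and it is bounded by the L¹ norm over [-R, R]. -/
theorem pow_mul_norm_timeDomain_le {n : ℕ} {B : ℝ} (hR : 0 ≤ R)
    (hB : ∀ ω, ‖iteratedDeriv n F ω‖ ≤ B) (s : ℝ) :
    |s| ^ n * ‖timeDomain F s‖ ≤ 2 * R * B := by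
  have h1 := congrFun (Real.fourier_iteratedDeriv (N := ⊤) hF
    (fun n _ => integrable_iteratedDeriv hF hFs n) (n := n) (by exact_mod_cast le_top))
    (s / (2 * Real.pi))
  have h2 : ‖𝓕 (iteratedDeriv n F) (s / (2 * Real.pi))‖ ≤ 2 * R * B :=
    (VectorFourier.norm_fourierIntegral_le_integral_norm _ _ _ _ _).trans
      (integral_norm_iteratedDeriv_le hF hFs hR hB)
  have hpi := Real.pi_pos
  have h3 : ‖𝓕 (iteratedDeriv n F) (s / (2 * Real.pi))‖ =
      |s| ^ n * ‖𝓕 F (s / (2 * Real.pi))‖ := by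
    rw [h1, norm_smul, norm_pow]
    congr 2
    have : (2 * Real.pi * Complex.I * ((s / (2 * Real.pi) : ℝ) : ℂ)) = Complex.I * s := by
      have : (Real.pi : ℂ) ≠ 0 := by exact_mod_cast Real.pi_ne_zero
      push_cast
      field_simp
    rw [this]; simp
  have h4 : ‖timeDomain F s‖ ≤ ‖𝓕 F (s / (2 * Real.pi))‖ := by
    rw [timeDomain_eq_fourier, norm_mul]
    refine mul_le_of_le_one_left (norm_nonneg _) ?_
    have : ‖(1 / (2 * Real.pi) : ℂ)‖ = 1 / (2 * Real.pi) := by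
      rw [norm_div, norm_one, norm_mul, Complex.norm_real, Real.norm_of_nonneg hpi.le]
      norm_num
    rw [this, div_le_one (by positivity)]
    linarith [Real.pi_gt_three]
  calc _ ≤ |s| ^ n * ‖𝓕 F (s / (2 * Real.pi))‖ := by gcongr
    _ ≤ _ := h3 ▸ h2

theorem continuous_timeDomain : Continuous (timeDomain F) := by
  have hi : Integrable F := by simpa using integrable_iteratedDeriv hF hFs 0
  have h : Continuous (𝓕 F) := VectorFourier.fourierIntegral_continuous
    Real.continuous_fourierChar (by exact continuous_inner) hi
  have e : timeDomain F = fun s => (1 / (2 * Real.pi) : ℂ) * 𝓕 F (s / (2 * Real.pi)) :=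
    funext (timeDomain_eq_fourier F)
  rw [e]
  exact continuous_const.mul (h.comp (continuous_id.div_const _))

/-- Decay of order p + 2 leaves 1/(1 + s²) after weighting by (1 + |s|)^p; its integral is π. -/
theorem timeDomain_moment {p : ℕ} {B₀ B₁ : ℝ} (hR : 0 ≤ R)
    (hB₀ : ∀ ω, ‖iteratedDeriv 0 F ω‖ ≤ B₀) (hB₁ : ∀ ω, ‖iteratedDeriv (p + 2) F ω‖ ≤ B₁) :
    (Integrable fun s => ‖timeDomain F s‖ * (1 + |s|) ^ p) ∧
    ∫ s, ‖timeDomain F s‖ * (1 + |s|) ^ p ≤ 2 ^ (p + 2) * (2 * R * (B₀ + B₁)) * Real.pi := by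
  have hb : ∀ s, ‖timeDomain F s‖ * (1 + |s|) ^ p ≤
      2 ^ (p + 2) * (2 * R * (B₀ + B₁)) * (1 + s ^ 2)⁻¹ := by
    intro s
    have h0 := pow_mul_norm_timeDomain_le hF hFs hR hB₀ s
    have h1 := pow_mul_norm_timeDomain_le hF hFs hR hB₁ s
    rw [pow_zero, one_mul] at h0
    have h2 : (1 + |s|) ^ (p + 2) ≤ 2 ^ (p + 2) * (1 + |s| ^ (p + 2)) := by
      have hs := abs_nonneg s
      rcases le_total |s| 1 with h | h
      · calc (1 + |s|) ^ (p + 2) ≤ 2 ^ (p + 2) := by gcongr; linarith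
          _ ≤ _ := le_mul_of_one_le_right (by positivity) (by linarith [pow_nonneg hs (p + 2)])
      · calc (1 + |s|) ^ (p + 2) ≤ (2 * |s|) ^ (p + 2) := by gcongr; linarith
          _ = 2 ^ (p + 2) * |s| ^ (p + 2) := mul_pow _ _ _
          _ ≤ _ := by gcongr; linarith
    have h3 : 1 + s ^ 2 ≤ (1 + |s|) ^ 2 := by nlinarith [abs_nonneg s, sq_abs s]
    rw [← div_eq_mul_inv, le_div_iff₀ (by positivity)]
    calc _ ≤ ‖timeDomain F s‖ * (1 + |s|) ^ p * (1 + |s|) ^ 2 := by gcongr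
      _ = ‖timeDomain F s‖ * (1 + |s|) ^ (p + 2) := by rw [pow_add]; ring
      _ ≤ ‖timeDomain F s‖ * (2 ^ (p + 2) * (1 + |s| ^ (p + 2))) := by gcongr
      _ = 2 ^ (p + 2) * (‖timeDomain F s‖ + |s| ^ (p + 2) * ‖timeDomain F s‖) := by ring
      _ ≤ 2 ^ (p + 2) * (2 * R * B₀ + 2 * R * B₁) := by gcongr
      _ = _ := by ring
  have hintegr := integrable_inv_one_add_sq.const_mul (2 ^ (p + 2) * (2 * R * (B₀ + B₁)))
  have hcont : Continuous fun s => ‖timeDomain F s‖ * (1 + |s|) ^ p :=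
    (continuous_timeDomain hF hFs).norm.mul ((continuous_const.add continuous_abs).pow p)
  have hi : Integrable fun s => ‖timeDomain F s‖ * (1 + |s|) ^ p :=
    hintegr.mono' hcont.aestronglyMeasurable (Filter.Eventually.of_forall fun s => by
      rw [Real.norm_of_nonneg (by positivity)]; exact hb s)
  refine ⟨hi, (integral_mono hi hintegr hb).trans (le_of_eq ?_)⟩
  rw [integral_const_mul, integral_univ_inv_one_add_sq]

theorem integral_timeDomain_mul_exp (hi : Integrable (timeDomain F)) (ν : ℝ) :
    ∫ s, timeDomain F s * Complex.exp (Complex.I * ν * s) = F ν := by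
  have hFi : Integrable F := by simpa using integrable_iteratedDeriv hF hFs 0
  have hpi := Real.pi_pos
  have hpic : (Real.pi : ℂ) ≠ 0 := by exact_mod_cast Real.pi_ne_zero
  have e : ∀ ξ, 𝓕 F ξ = (2 * Real.pi : ℂ) * timeDomain F (ξ * (2 * Real.pi)) := fun ξ => by
    rw [timeDomain_eq_fourier, mul_div_cancel_right₀ _ (by positivity)]
    field_simp
  have hFF : Integrable (𝓕 F) := by
    have : 𝓕 F = fun ξ => (2 * Real.pi : ℂ) * timeDomain F (ξ * (2 * Real.pi)) := funext e
    rw [this]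
    exact (hi.comp_mul_right' (by positivity)).const_mul _
  have h := hFi.fourierInv_fourier_eq hFF (v := ν) hF.continuous.continuousAt
  rw [Real.fourierInv_eq'] at h
  rw [← h]
  have h2 := Measure.integral_comp_mul_right
    (fun s => timeDomain F s * Complex.exp (Complex.I * ν * s)) (2 * Real.pi)
  rw [abs_of_pos (by positivity)] at h2
  have h3 : ∫ s, timeDomain F s * Complex.exp (Complex.I * ν * s) = (2 * Real.pi : ℂ) *
      ∫ ξ : ℝ, timeDomain F (ξ * (2 * Real.pi)) *
        Complex.exp (Complex.I * ν * (ξ * (2 * Real.pi) : ℝ)) := by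
    rw [h2, Complex.real_smul]
    push_cast
    field_simp
  rw [h3, ← integral_const_mul]
  refine integral_congr_ae (Filter.Eventually.of_forall fun ξ => ?_)
  simp only [smul_eq_mul, e ξ]
  rw [mul_comm (Complex.exp _), ← mul_assoc]
  congr 2
  simp only [RCLike.inner_apply, conj_trivial]
  push_cast
  ring

end CompactSupport

theorem filterTime_eq_timeDomain (u : ℝ → ℝ) (v : ℝ → ℂ) :
    filterTime u v = timeDomain (filterHat u v) := rfl

/-- A bound on the derivatives of the filter in terms of the Gevrey constants. -/
def filterDerivBound (α A₁u A₂u A₁v A₂v : ℝ) (n : ℕ) : ℝ :=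
  ∑ i ∈ Finset.range (n + 1), (n.choose i : ℝ) * (A₁u * A₂u ^ i * (i : ℝ) ^ (i * α)) *
    (2 ^ (n - i) * (A₁v * A₂v ^ (n - i) * ((n - i : ℕ) : ℝ) ^ ((n - i : ℕ) * α)))

namespace FilterAssumption

variable {α A₁u A₂u A₁v A₂v : ℝ} {u : ℝ → ℝ} {v : ℝ → ℂ}
  (hf : FilterAssumption α A₁u A₂u A₁v A₂v u v)
include hf

theorem contDiff_factors : ContDiff ℝ (⊤ : ℕ∞) (fun ω => (u (ω / 8) : ℂ)) ∧
    ContDiff ℝ (⊤ : ℕ∞) (fun ω => v (2 * ω)) :=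
  ⟨Complex.ofRealCLM.contDiff.comp (hf.gevrey_u.1.comp (contDiff_id.div_const 8)),
    hf.gevrey_v.1.comp (contDiff_const.mul contDiff_id)⟩

theorem contDiff_filterHat : ContDiff ℝ (⊤ : ℕ∞) (filterHat u v) :=
  hf.contDiff_factors.1.mul hf.contDiff_factors.2

theorem tsupport_filterHat : tsupport (filterHat u v) ⊆ Set.Icc (-8) 8 := by
  refine closure_minimal (fun ω hω => ?_) isClosed_Icc
  have hu : ω / 8 ∈ Set.Icc (-1 : ℝ) 1 := by
    refine hf.supp_u (subset_tsupport u ?_)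
    intro h
    simp [filterHat, h] at hω
  constructor <;> linarith [hu.1, hu.2]

theorem filterHat_of_nonneg {ω : ℝ} (hω : 0 ≤ ω) : filterHat u v ω = 0 := by
  have hpos : ∀ x, 0 < x → v x = 0 := fun x hx => by
    by_contra h
    exact absurd (hf.supp_v (subset_tsupport v h)) (not_le.2 hx)
  -- The support condition allows the endpoint 0, where v vanishes by continuity. Frequency 0 is
  -- needed for matrix elements between vectors of the lowest energy.
  have h0 : v 0 = 0 := by
    have hc : Filter.Tendsto v (nhdsWithin 0 (Set.Ioi 0)) (nhds (v 0)) :=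
      hf.gevrey_v.1.continuous.continuousAt.tendsto.mono_left nhdsWithin_le_nhds
    refine tendsto_nhds_unique hc ?_
    refine (tendsto_const_nhds (x := (0 : ℂ))).congr' ?_
    filter_upwards [self_mem_nhdsWithin] with x hx using (hpos x hx).symm
  rw [filterHat]
  rcases hω.eq_or_lt with rfl | h
  · simp [h0]
  · rw [hpos (2 * ω) (by linarith), mul_zero]

theorem filterHat_neg_two : filterHat u v (-2) = 1 := by
  rw [filterHat, show (-2 : ℝ) / 8 = -(1 / 4) by norm_num, show (2 : ℝ) * -2 = -4 by norm_num,
    hf.value_u, hf.value_v]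
  simp

theorem norm_iteratedDeriv_filterHat_le (n : ℕ) (ω : ℝ) :
    ‖iteratedDeriv n (filterHat u v) ω‖ ≤ filterDerivBound α A₁u A₂u A₁v A₂v n := by
  have hu : ∀ i : ℕ, ‖iteratedFDeriv ℝ i (fun ω => (u (ω / 8) : ℂ)) ω‖ ≤
      A₁u * A₂u ^ i * (i : ℝ) ^ (i * α) := by
    intro i
    have hcu : ContDiff ℝ (⊤ : ℕ∞) fun ω => u ((1 / 8) * ω) :=
      hf.gevrey_u.1.comp (contDiff_const.mul contDiff_id)
    have e : (fun ω => (u (ω / 8) : ℂ)) = Complex.ofRealLI ∘ fun ω => u ((1 / 8) * ω) := by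
      funext x
      simp [div_eq_inv_mul]
    rw [e, Complex.ofRealLI.norm_iteratedFDeriv_comp_left hcu.contDiffAt
      (by exact_mod_cast le_top), norm_iteratedFDeriv_eq_norm_iteratedDeriv,
      iteratedDeriv_comp_const_smul (hf.gevrey_u.1.of_le (by exact_mod_cast le_top)), norm_smul]
    have h1 : ‖(1 / 8 : ℝ) ^ i‖ ≤ 1 := by
      rw [norm_pow]
      exact pow_le_one₀ (norm_nonneg _) (by norm_num)
    exact (mul_le_of_le_one_left (norm_nonneg _) h1).trans (hf.gevrey_u.2 i _)
  have hv : ∀ i : ℕ, ‖iteratedFDeriv ℝ i (fun ω => v (2 * ω)) ω‖ ≤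
      2 ^ i * (A₁v * A₂v ^ i * (i : ℝ) ^ (i * α)) := by
    intro i
    rw [norm_iteratedFDeriv_eq_norm_iteratedDeriv,
      iteratedDeriv_comp_const_smul (hf.gevrey_v.1.of_le (by exact_mod_cast le_top)), norm_smul]
    have h1 : ‖(2 : ℝ) ^ i‖ = 2 ^ i := by rw [Real.norm_of_nonneg (by positivity)]
    rw [h1]
    gcongr
    exact hf.gevrey_v.2 i _
  rw [← norm_iteratedFDeriv_eq_norm_iteratedDeriv]
  refine (norm_iteratedFDeriv_mul_le hf.contDiff_factors.1 hf.contDiff_factors.2 ω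
    (by exact_mod_cast le_top)).trans (Finset.sum_le_sum fun i _ => ?_)
  have h0 := (norm_nonneg _).trans (hu i)
  exact mul_le_mul (mul_le_mul_of_nonneg_left (hu i) (Nat.cast_nonneg _)) (hv (n - i))
    (norm_nonneg _) (mul_nonneg (Nat.cast_nonneg _) h0)

end FilterAssumption

/-- A bound on the moments of the filter in the time domain. -/
def filterMomentBound (α A₁u A₂u A₁v A₂v : ℝ) (p : ℕ) : ℝ :=
  2 ^ (p + 2) * (2 * 8 * (filterDerivBound α A₁u A₂u A₁v A₂v 0 +
    filterDerivBound α A₁u A₂u A₁v A₂v (p + 2))) * Real.pi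

namespace FilterAssumption

variable {α A₁u A₂u A₁v A₂v : ℝ} {u : ℝ → ℝ} {v : ℝ → ℂ}
  (hf : FilterAssumption α A₁u A₂u A₁v A₂v u v)
include hf

theorem filterTime_moment (p : ℕ) :
    (Integrable fun s => ‖filterTime u v s‖ * (1 + |s|) ^ p) ∧
    ∫ s, ‖filterTime u v s‖ * (1 + |s|) ^ p ≤ filterMomentBound α A₁u A₂u A₁v A₂v p := by
  rw [filterTime_eq_timeDomain]
  exact timeDomain_moment hf.contDiff_filterHat hf.tsupport_filterHat (by norm_num)
    (hf.norm_iteratedDeriv_filterHat_le 0) (hf.norm_iteratedDeriv_filterHat_le (p + 2))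

theorem continuous_filterTime : Continuous (filterTime u v) :=
  continuous_timeDomain hf.contDiff_filterHat hf.tsupport_filterHat

theorem integrable_filterTime : Integrable (filterTime u v) := by
  have h := (hf.filterTime_moment 0).1
  simp only [pow_zero, mul_one] at h
  exact (integrable_norm_iff hf.continuous_filterTime.aestronglyMeasurable).1 h

theorem integral_filterTime_mul_exp (ν : ℝ) :
    ∫ s, filterTime u v s * Complex.exp (Complex.I * ν * s) = filterHat u v ν :=
  integral_timeDomain_mul_exp hf.contDiff_filterHat hf.tsupport_filterHat
    hf.integrable_filterTime ν

end FilterAssumption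

end Filter

/-! ### Operators on one site -/

section OnSite

variable {Λ : Type} [Fintype Λ] [DecidableEq Λ]

theorem sum_ite_agree_off (i : Λ) (x : Λ → Fin 2) (F : (Λ → Fin 2) → ℂ) :
    ∑ z, (if ∀ n, n ≠ i → x n = z n then F z else 0) = ∑ b, F (Function.update x i b) := by
  rw [← Finset.sum_filter]
  refine Finset.sum_nbij' (fun z => z i) (fun b => Function.update x i b) ?_ ?_ ?_ ?_ ?_
  · simp
  · intro b _
    simp only [Finset.mem_filter, Finset.mem_univ, true_and]
    intro n hn
    rw [Function.update_of_ne hn]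
  · intro z hz
    simp only [Finset.mem_filter, Finset.mem_univ, true_and] at hz
    funext n
    by_cases hn : n = i
    · subst hn; simp
    · rw [Function.update_of_ne hn, hz n hn]
  · simp
  · intro z hz
    simp only [Finset.mem_filter, Finset.mem_univ, true_and] at hz
    congr 1
    funext n
    by_cases hn : n = i
    · subst hn; simp
    · rw [Function.update_of_ne hn, hz n hn]

theorem onSite_mul_apply (i : Λ) (M : Matrix (Fin 2) (Fin 2) ℂ) (A : Op Λ) (x y : Λ → Fin 2) :
    (onSite i M * A) x y = ∑ b, M (x i) b * A (Function.update x i b) y := by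
  rw [Matrix.mul_apply]
  simp only [onSite, Matrix.of_apply, ite_mul, zero_mul]
  rw [sum_ite_agree_off i x fun z => M (x i) (z i) * A z y]
  simp

theorem mul_onSite_apply (i : Λ) (M : Matrix (Fin 2) (Fin 2) ℂ) (A : Op Λ) (x y : Λ → Fin 2) :
    (A * onSite i M) x y = ∑ b, A x (Function.update y i b) * M b (y i) := by
  rw [Matrix.mul_apply]
  simp only [onSite, Matrix.of_apply, mul_ite, mul_zero]
  have h : ∀ z : Λ → Fin 2, (∀ n, n ≠ i → z n = y n) ↔ ∀ n, n ≠ i → y n = z n := fun z =>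
    ⟨fun h n hn => (h n hn).symm, fun h n hn => (h n hn).symm⟩
  simp only [h]
  rw [sum_ite_agree_off i y fun z => A x z * M (z i) (y i)]
  simp

theorem onSite_mul_onSite (i : Λ) (M N : Matrix (Fin 2) (Fin 2) ℂ) :
    onSite i M * onSite i N = onSite i (M * N) := by
  ext x y
  rw [onSite_mul_apply]
  simp only [onSite, Matrix.of_apply, Function.update_self, Matrix.mul_apply]
  have h : ∀ b, (∀ n, n ≠ i → Function.update x i b n = y n) ↔ ∀ n, n ≠ i → x n = y n :=
    fun b => forall₂_congr fun n hn => by rw [Function.update_of_ne hn]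
  simp only [h]
  split_ifs <;> simp

theorem onSite_add (i : Λ) (M N : Matrix (Fin 2) (Fin 2) ℂ) :
    onSite i (M + N) = onSite i M + onSite i N := by
  ext x y
  simp only [onSite, Matrix.of_apply, Matrix.add_apply]
  split_ifs <;> simp

theorem onSite_sub (i : Λ) (M N : Matrix (Fin 2) (Fin 2) ℂ) :
    onSite i (M - N) = onSite i M - onSite i N := by
  ext x y
  simp only [onSite, Matrix.of_apply, Matrix.sub_apply]
  split_ifs <;> simp

theorem onSite_zero (i : Λ) : onSite i (0 : Matrix (Fin 2) (Fin 2) ℂ) = 0 := by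
  ext x y
  simp [onSite]

theorem onSite_one (i : Λ) : onSite i (1 : Matrix (Fin 2) (Fin 2) ℂ) = 1 := by
  ext x y
  simp only [onSite, Matrix.of_apply, Matrix.one_apply]
  have : x = y ↔ (∀ n, n ≠ i → x n = y n) ∧ x i = y i := by
    constructor
    · rintro rfl; simp
    · rintro ⟨h1, h2⟩
      funext n
      by_cases hn : n = i
      · rw [hn, h2]
      · exact h1 n hn
  simp only [this]
  split_ifs <;> simp_all

theorem star_onSite (i : Λ) (M : Matrix (Fin 2) (Fin 2) ℂ) :
    star (onSite i M) = onSite i Mᴴ := by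
  ext x y
  simp only [Matrix.star_eq_conjTranspose, Matrix.conjTranspose_apply, onSite, Matrix.of_apply]
  have h : (∀ n, n ≠ i → y n = x n) ↔ ∀ n, n ≠ i → x n = y n :=
    ⟨fun h n hn => (h n hn).symm, fun h n hn => (h n hn).symm⟩
  simp only [h]
  split_ifs <;> simp

theorem commute_onSite_of_isSupportedOn {S : Set Λ} {A : Op Λ} (hA : IsSupportedOn S A) {i : Λ}
    (hi : i ∉ S) (M : Matrix (Fin 2) (Fin 2) ℂ) : Commute A (onSite i M) := by
  classical
  obtain ⟨B, hB⟩ := hA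
  ext x y
  rw [onSite_mul_apply, mul_onSite_apply]
  simp only [hB]
  have hx : ∀ b, (fun n : S => Function.update x i b n) = fun n : S => x n := fun b => by
    funext n
    exact Function.update_of_ne (fun h : (n : Λ) = i => hi (h ▸ n.2)) _ _
  have hy : ∀ b, (fun n : S => Function.update y i b n) = fun n : S => y n := fun b => by
    funext n
    exact Function.update_of_ne (fun h : (n : Λ) = i => hi (h ▸ n.2)) _ _
  simp only [hx, hy]
  have h1 : ∀ b, (∀ n, n ∉ S → x n = Function.update y i b n) ↔
      (b = x i ∧ ∀ n, n ∉ S → n ≠ i → x n = y n) := by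
    intro b
    constructor
    · intro h
      refine ⟨by simpa using (h i hi).symm, fun n hn hni => ?_⟩
      simpa [Function.update_of_ne hni] using h n hn
    · rintro ⟨rfl, h⟩ n hn
      by_cases hni : n = i
      · subst hni; simp
      · rw [Function.update_of_ne hni]; exact h n hn hni
  have h2 : ∀ b, (∀ n, n ∉ S → Function.update x i b n = y n) ↔
      (b = y i ∧ ∀ n, n ∉ S → n ≠ i → x n = y n) := by
    intro b
    constructor
    · intro h
      refine ⟨by simpa using h i hi, fun n hn hni => ?_⟩
      simpa [Function.update_of_ne hni] using h n hn
    · rintro ⟨rfl, h⟩ n hn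
      by_cases hni : n = i
      · subst hni; simp
      · rw [Function.update_of_ne hni]; exact h n hn hni
  by_cases hc : ∀ n, n ∉ S → n ≠ i → x n = y n
  · have h1' : ∀ b, (∀ n, n ∉ S → x n = Function.update y i b n) ↔ b = x i := fun b =>
      (h1 b).trans (and_iff_left hc)
    have h2' : ∀ b, (∀ n, n ∉ S → Function.update x i b n = y n) ↔ b = y i := fun b =>
      (h2 b).trans (and_iff_left hc)
    simp only [h1', h2', ite_mul, mul_ite, zero_mul, mul_zero, Finset.sum_ite_eq',
      Finset.mem_univ, if_true, mul_comm]
  · have h1' : ∀ b, ¬ ∀ n, n ∉ S → x n = Function.update y i b n := fun b h =>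
      hc ((h1 b).1 h).2
    have h2' : ∀ b, ¬ ∀ n, n ∉ S → Function.update x i b n = y n := fun b h =>
      hc ((h2 b).1 h).2
    simp only [h1', h2', if_false, zero_mul, mul_zero]

theorem commute_onSite_onSite {i j : Λ} (hij : i ≠ j) (M N : Matrix (Fin 2) (Fin 2) ℂ) :
    Commute (onSite i M) (onSite j N) := by
  refine commute_onSite_of_isSupportedOn (S := {i}) ?_ (by simpa using hij.symm) N
  refine ⟨fun x y => M (x ⟨i, rfl⟩) (y ⟨i, rfl⟩), fun x y => ?_⟩
  simp [onSite]

/-- The lowering operator `|0⟩⟨1|` at the site `i`. -/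
def lower (i : Λ) : Op Λ := onSite i !![0, 1; 0, 0]

theorem star_lower (i : Λ) : star (lower i) = onSite i !![0, 0; 1, 0] := by
  rw [lower, star_onSite]
  congr 1
  ext a b
  fin_cases a <;> fin_cases b <;> simp

theorem lower_mul_star (i : Λ) : lower i * star (lower i) = onSite i !![1, 0; 0, 0] := by
  rw [star_lower, lower, onSite_mul_onSite]
  congr 1
  ext a b
  fin_cases a <;> fin_cases b <;> simp

theorem star_mul_lower (i : Λ) : star (lower i) * lower i = onSite i !![0, 0; 0, 1] := by
  rw [star_lower, lower, onSite_mul_onSite]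
  congr 1
  ext a b
  fin_cases a <;> fin_cases b <;> simp

theorem pauliX_eq (i : Λ) : pauliX i = lower i + star (lower i) := by
  rw [star_lower, lower, ← onSite_add, pauliX]
  simp

theorem pauliZ_eq (i : Λ) :
    pauliZ i = lower i * star (lower i) - star (lower i) * lower i := by
  rw [lower_mul_star, star_mul_lower, ← onSite_sub, pauliZ]
  congr 1
  ext a b
  fin_cases a <;> fin_cases b <;> simp

theorem commutesWith_lower {A : Op Λ} {i : Λ} (h : ∀ M, Commute A (onSite i M)) :
    CommutesWith A (lower i) := ⟨h _, by rw [star_lower]; exact h _⟩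

theorem eq_of_update_invariant {β : Type*} (D : (Λ → Fin 2) → β)
    (hD : ∀ x i b, D (Function.update x i b) = D x) (x y : Λ → Fin 2) : D x = D y := by
  have h : ∀ s : Finset Λ, D (s.piecewise x y) = D y := by
    intro s
    induction s using Finset.induction_on with
    | empty => simp
    | insert a s ha ih => rw [Finset.piecewise_insert, hD, ih]
  simpa using h Finset.univ

/-- Commuting with every |1⟩⟨1|_i makes A diagonal; commuting with every spin flip a_i + a_i† makes
the diagonal constant. -/
theorem exists_smul_one_of_commutesWith {A : Op Λ} (hA : ∀ i, CommutesWith A (lower i)) :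
    ∃ c : ℂ, A = c • 1 := by
  have hdiag : ∀ x y, x ≠ y → A x y = 0 := by
    intro x y hxy
    obtain ⟨i, hi⟩ := Function.ne_iff.1 hxy
    have h := ((hA i).2.mul_right (hA i).1).eq
    rw [star_mul_lower] at h
    have h' := congrFun (congrFun h x) y
    rw [onSite_mul_apply, mul_onSite_apply] at h'
    simp only [Fin.sum_univ_two] at h'
    have hx : x i = 0 ∨ x i = 1 := by omega
    have hy : y i = 0 ∨ y i = 1 := by omega
    rcases hx with hx | hx <;> rcases hy with hy | hy
    · exact absurd (hx.trans hy.symm) hi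
    · have e : Function.update y i 1 = y := by rw [← hy, Function.update_eq_self]
      simpa [hx, hy, e] using h'
    · have e : Function.update x i 1 = x := by rw [← hx, Function.update_eq_self]
      simpa [hx, hy, e] using h'.symm
    · exact absurd (hx.trans hy.symm) hi
  have hflip : ∀ x i b, A (Function.update x i b) (Function.update x i b) = A x x := by
    intro x i b
    have h := ((hA i).1.add_right (hA i).2).eq
    rw [← pauliX_eq, pauliX] at h
    have hb : b = 0 ∨ b = 1 := by omega
    have hx : x i = 0 ∨ x i = 1 := by omega
    have h' := congrFun (congrFun h x) (Function.update x i b)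
    rw [onSite_mul_apply, mul_onSite_apply] at h'
    simp only [Fin.sum_univ_two, Function.update_idem, Function.update_self] at h'
    rcases hb with rfl | rfl <;> rcases hx with hx | hx
    · rw [← hx, Function.update_eq_self]
    · have e : Function.update x i 1 = x := by rw [← hx, Function.update_eq_self]
      simpa [hx, e] using h'.symm
    · have e : Function.update x i 0 = x := by rw [← hx, Function.update_eq_self]
      simpa [hx, e] using h'.symm
    · rw [← hx, Function.update_eq_self]
  refine ⟨A 0 0, ?_⟩
  ext x y
  rw [Matrix.smul_apply, Matrix.one_apply]
  split_ifs with hxy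
  · subst hxy
    rw [smul_eq_mul, mul_one]
    exact eq_of_update_invariant (fun x => A x x) hflip x 0
  · rw [hdiag x y hxy, smul_zero]

theorem isSpinSystem_lower : IsSpinSystem (lower : Λ → Op Λ) where
  lowering i := by
    constructor
    · rw [lower, onSite_mul_onSite, ← onSite_zero i]
      congr 1
      ext a b
      fin_cases a <;> fin_cases b <;> simp
    · rw [lower_mul_star, star_mul_lower, ← onSite_add, ← onSite_one i]
      congr 1
      ext a b
      fin_cases a <;> fin_cases b <;> simp
  commutes i j hij := commutesWith_lower fun M => commute_onSite_onSite hij _ M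
  irreducible A hA := exists_smul_one_of_commutesWith hA

end OnSite

/-! ### Geometry of the lattice -/

section Lattice

theorem coordDist_self (periodic : Bool) {L : ℕ} (a : Fin (L + 1)) : coordDist periodic a a = 0 := by
  simp [coordDist]

theorem coordDist_comm (periodic : Bool) {L : ℕ} (a b : Fin (L + 1)) :
    coordDist periodic a b = coordDist periodic b a := by
  have : ((a : ℤ) - (b : ℤ)).natAbs = ((b : ℤ) - (a : ℤ)).natAbs := by omega
  simp only [coordDist, this]

theorem coordDist_triangle (periodic : Bool) {L : ℕ} (a b c : Fin (L + 1)) :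
    coordDist periodic a c ≤ coordDist periodic a b + coordDist periodic b c := by
  have := a.2
  have := b.2
  have := c.2
  unfold coordDist
  split_ifs <;> omega

theorem card_coordDist_eq_le (periodic : Bool) {L : ℕ} (b : Fin (L + 1)) (n : ℕ) :
    (Finset.univ.filter fun a : Fin (L + 1) => coordDist periodic a b = n).card ≤ 4 := by
  -- At distance n from b there are at most the points b ± n and, going around the cycle, b ± (L + 1
  -- - n).
  have hsub : (Finset.univ.filter fun a : Fin (L + 1) => coordDist periodic a b = n).image
      (fun a : Fin (L + 1) => ((a : ℕ) : ℤ)) ⊆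
      {(b : ℤ) + n, (b : ℤ) - n, (b : ℤ) + (L + 1 - n), (b : ℤ) - (L + 1 - n)} := by
    intro z hz
    simp only [Finset.mem_image, Finset.mem_filter, Finset.mem_univ, true_and] at hz
    obtain ⟨a, ha, rfl⟩ := hz
    have h1 := a.2
    have h2 := b.2
    simp only [Finset.mem_insert, Finset.mem_singleton]
    unfold coordDist at ha
    split_ifs at ha <;> omega
  have hinj : Function.Injective fun a : Fin (L + 1) => ((a : ℕ) : ℤ) := fun a b h => by
    simp only [Nat.cast_inj] at h
    exact Fin.ext h
  rw [← Finset.card_image_of_injective _ hinj]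
  exact (Finset.card_le_card hsub).trans Finset.card_le_four

theorem sum_inv_sq_range_le (n : ℕ) :
    ∑ i ∈ Finset.range (n + 1), ((1 + (i : ℝ)) ^ 2)⁻¹ ≤ 2 - 1 / (1 + (n : ℝ)) := by
  induction n with
  | zero => norm_num
  | succ n ih =>
    rw [Finset.sum_range_succ]
    have h : ((1 + ((n + 1 : ℕ) : ℝ)) ^ 2)⁻¹ ≤
        1 / (1 + (n : ℝ)) - 1 / (1 + ((n + 1 : ℕ) : ℝ)) := by
      push_cast
      rw [div_sub_div _ _ (by positivity) (by positivity), inv_eq_one_div,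
        div_le_div_iff₀ (by positivity) (by positivity)]
      nlinarith [Nat.cast_nonneg (α := ℝ) n]
    linarith

theorem sum_coordDist_le (periodic : Bool) {L : ℕ} (b : Fin (L + 1)) :
    ∑ a, ((1 + (coordDist periodic a b : ℝ)) ^ 2)⁻¹ ≤ 8 := by
  have hlt : ∀ a : Fin (L + 1), coordDist periodic a b ∈ Finset.range (L + 1) := by
    intro a
    have := a.2
    have := b.2
    rw [Finset.mem_range]
    unfold coordDist
    split_ifs <;> omega
  rw [← Finset.sum_fiberwise_of_maps_to (fun a _ => hlt a)]
  calc _ ≤ ∑ n ∈ Finset.range (L + 1), 4 * ((1 + (n : ℝ)) ^ 2)⁻¹ := by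
        refine Finset.sum_le_sum fun n _ => ?_
        rw [Finset.sum_congr rfl (g := fun _ => ((1 + (n : ℝ)) ^ 2)⁻¹) fun a ha => by
          rw [(Finset.mem_filter.1 ha).2], Finset.sum_const, nsmul_eq_mul]
        gcongr
        exact_mod_cast card_coordDist_eq_le periodic b n
    _ = 4 * ∑ n ∈ Finset.range (L + 1), ((1 + (n : ℝ)) ^ 2)⁻¹ := by rw [Finset.mul_sum]
    _ ≤ 4 * 2 := by
        gcongr
        refine (sum_inv_sq_range_le L).trans ?_
        have : (0 : ℝ) ≤ 1 / (1 + (L : ℝ)) := by positivity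
        linarith
    _ = 8 := by norm_num

/-- The Manhattan distance dominates each coordinate distance, so (1 + d)^(2D) is at least the
product of the (1 + d_n)². The sum then factorizes into D one-dimensional sums, each at most 4 · 2 =
8. -/
theorem hasPolyGrowth_manhattanDist (periodic : Bool) (D L : ℕ) :
    HasPolyGrowth (manhattanDist periodic : Site D L → Site D L → ℕ) (2 * D) (8 ^ D) where
  self i := by simp [manhattanDist, coordDist_self]
  symm i j := Finset.sum_congr rfl fun n _ => coordDist_comm periodic _ _
  triangle i j m := by
    simp only [manhattanDist, ← Finset.sum_add_distrib]
    exact Finset.sum_le_sum fun n _ => coordDist_triangle periodic _ _ _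
  sum_le j := by
    have h1 : ∀ i : Site D L, ((1 + (manhattanDist periodic i j : ℝ)) ^ (2 * D))⁻¹ ≤
        ∏ n, ((1 + (coordDist periodic (i n) (j n) : ℝ)) ^ 2)⁻¹ := by
      intro i
      rw [Finset.prod_inv_distrib]
      refine inv_anti₀ (Finset.prod_pos fun n _ => by positivity) ?_
      calc _ ≤ ∏ n : Fin D, (1 + (manhattanDist periodic i j : ℝ)) ^ 2 := by
            refine Finset.prod_le_prod (fun n _ => by positivity) fun n _ => ?_
            have : (coordDist periodic (i n) (j n) : ℝ) ≤ manhattanDist periodic i j := by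
              exact_mod_cast Finset.single_le_sum
                (f := fun n => coordDist periodic (i n) (j n)) (fun _ _ => Nat.zero_le _)
                (Finset.mem_univ n)
            gcongr
        _ = _ := by rw [Finset.prod_const, Finset.card_univ, Fintype.card_fin, ← pow_mul]
    calc _ ≤ ∑ i : Site D L, ∏ n, ((1 + (coordDist periodic (i n) (j n) : ℝ)) ^ 2)⁻¹ :=
          Finset.sum_le_sum fun i _ => h1 i
      _ = ∏ n, ∑ a, ((1 + (coordDist periodic a (j n) : ℝ)) ^ 2)⁻¹ :=
          (Fintype.prod_sum fun n a => ((1 + (coordDist periodic a (j n) : ℝ)) ^ 2)⁻¹).symm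
      _ ≤ ∏ _n : Fin D, (8 : ℝ) := Finset.prod_le_prod
          (fun n _ => Finset.sum_nonneg fun _ _ => by positivity)
          fun n _ => sum_coordDist_le periodic _
      _ = 8 ^ D := by simp

end Lattice

/-! ### Euler products for exponentials -/

section Euler

open Filter

variable {𝔹 : Type*} [NormedRing 𝔹] [NormedAlgebra ℂ 𝔹] [CompleteSpace 𝔹] [NormOneClass 𝔹]

theorem norm_exp_le_exp_norm (x : 𝔹) : ‖NormedSpace.exp x‖ ≤ Real.exp ‖x‖ := by
  have h1 := NormedSpace.exp_series_hasSum_exp' (𝕂 := ℂ) x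
  have h2 := NormedSpace.exp_series_hasSum_exp' (𝕂 := ℝ) ‖x‖
  rw [← congrFun Real.exp_eq_exp_ℝ ‖x‖] at h2
  rw [← h1.tsum_eq]
  refine tsum_of_norm_bounded h2 fun n => ?_
  rw [norm_smul, smul_eq_mul]
  have : ‖((n.factorial : ℂ))⁻¹‖ = ((n.factorial : ℝ))⁻¹ := by
    rw [norm_inv, Complex.norm_natCast]
  rw [this]
  gcongr
  exact norm_pow_le x n

theorem norm_pow_sub_pow_le {a b : 𝔹} {m : ℝ} (hm : 1 ≤ m) (ha : ‖a‖ ≤ m) (hb : ‖b‖ ≤ m) (n : ℕ) :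
    ‖a ^ n - b ^ n‖ ≤ n * ‖a - b‖ * m ^ n := by
  induction n with
  | zero => simp
  | succ n ih =>
    have e : a ^ (n + 1) - b ^ (n + 1) = a * (a ^ n - b ^ n) + (a - b) * b ^ n := by
      rw [pow_succ', pow_succ', mul_sub, sub_mul]; abel
    have hbn : ‖b ^ n‖ ≤ m ^ n := (norm_pow_le b n).trans (by gcongr)
    rw [e]
    calc _ ≤ ‖a‖ * ‖a ^ n - b ^ n‖ + ‖a - b‖ * ‖b ^ n‖ :=
          (norm_add_le _ _).trans (add_le_add (norm_mul_le _ _) (norm_mul_le _ _))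
      _ ≤ m * (n * ‖a - b‖ * m ^ n) + ‖a - b‖ * (m * m ^ n) := by
          gcongr
          exact hbn.trans (le_mul_of_one_le_left (by positivity) hm)
      _ = _ := by push_cast; ring

/-- Since e^x is the n-th power of e^{x/n}, the error is at most n e^{‖x‖} times ‖1 + x/n -
e^{x/n}‖, which is o(1/n) because exp has derivative 1 at 0. -/
theorem tendsto_one_add_smul_pow (x : 𝔹) :
    Tendsto (fun n : ℕ => (1 + ((n : ℂ)⁻¹) • x) ^ n) atTop (nhds (NormedSpace.exp x)) := by
  let +nondep : NormedAlgebra ℚ 𝔹 := .restrictScalars ℚ ℂ 𝔹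
  have hy : Tendsto (fun n : ℕ => ((n : ℂ)⁻¹) • x) atTop (nhds 0) := by
    have h : Tendsto (fun n : ℕ => ((n : ℂ)⁻¹)) atTop (nhds 0) :=
      tendsto_inv_atTop_nhds_zero_nat
    simpa using h.smul_const x
  have ho := (hasFDerivAt_exp_zero (𝕂 := ℂ) (𝔸 := 𝔹)).isLittleO.comp_tendsto hy
  rw [tendsto_iff_norm_sub_tendsto_zero]
  rw [Metric.tendsto_atTop]
  intro ε hε
  set δ := ε / (2 * (‖x‖ + 1) * Real.exp ‖x‖) with hδ
  have hδ0 : 0 < δ := by positivity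
  have hev := ho.def hδ0
  obtain ⟨n₀, hn₀⟩ := (hev.and (eventually_ge_atTop 1)).exists_forall_of_atTop
  refine ⟨n₀, fun n hn => ?_⟩
  obtain ⟨h1, h2⟩ := hn₀ n hn
  simp only [Function.comp_apply, sub_zero, NormedSpace.exp_zero,
    one_apply_eq_self] at h1
  have hn0 : (0 : ℝ) < n := by exact_mod_cast h2
  have hnc : (n : ℂ) ≠ 0 := by exact_mod_cast hn0.ne'
  set y := ((n : ℂ)⁻¹) • x with hyd
  have hyn : ‖y‖ = ‖x‖ / n := by
    rw [hyd, norm_smul, norm_inv, Complex.norm_natCast, inv_mul_eq_div]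
  have hexp : NormedSpace.exp x = NormedSpace.exp y ^ n := by
    rw [← NormedSpace.exp_nsmul, hyd, ← Nat.cast_smul_eq_nsmul ℂ, smul_smul,
      mul_inv_cancel₀ hnc, one_smul]
  have hb : ‖1 + y‖ ≤ Real.exp (‖x‖ / n) := by
    refine (norm_add_le _ _).trans ?_
    rw [norm_one, hyn]
    linarith [Real.add_one_le_exp (‖x‖ / n)]
  have ha : ‖NormedSpace.exp y‖ ≤ Real.exp (‖x‖ / n) := hyn ▸ norm_exp_le_exp_norm y
  have h3 := norm_pow_sub_pow_le (Real.one_le_exp (by positivity)) hb ha n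
  rw [← Real.exp_nat_mul, mul_div_cancel₀ _ hn0.ne'] at h3
  have h4 : ‖1 + y - NormedSpace.exp y‖ ≤ δ * (‖x‖ / n) := by
    rw [norm_sub_rev, ← hyn, ← sub_sub]; exact h1
  rw [Real.dist_eq, sub_zero, abs_of_nonneg (norm_nonneg _), hexp]
  calc _ ≤ n * ‖1 + y - NormedSpace.exp y‖ * Real.exp ‖x‖ := h3
    _ ≤ n * (δ * (‖x‖ / n)) * Real.exp ‖x‖ := by gcongr
    _ = δ * ‖x‖ * Real.exp ‖x‖ := by field_simp
    _ < δ * (2 * (‖x‖ + 1)) * Real.exp ‖x‖ := by gcongr; linarith [norm_nonneg x]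
    _ = ε := by rw [hδ]; field_simp

end Euler

section Spin

variable {Λ : Type} [Fintype Λ] [DecidableEq Λ]

/-! ### Trace estimates -/

theorem norm_dotProduct_mulVec_le (A : Op Λ) (v : (Λ → Fin 2) → ℂ) :
    ‖star v ⬝ᵥ (A *ᵥ v)‖ ≤ ‖A‖ * (star v ⬝ᵥ v).re := by
  have h1 := Matrix.l2_opNorm_mulVec A (WithLp.toLp 2 v)
  have e : star v ⬝ᵥ (A *ᵥ v) =
      inner ℂ (WithLp.toLp 2 v : EuclideanSpace ℂ (Λ → Fin 2)) (WithLp.toLp 2 (A *ᵥ v)) := by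
    rw [EuclideanSpace.inner_toLp_toLp, dotProduct_comm]
  have e2 : (star v ⬝ᵥ v).re =
      ‖(WithLp.toLp 2 v : EuclideanSpace ℂ (Λ → Fin 2))‖ * ‖(WithLp.toLp 2 v : EuclideanSpace ℂ (Λ → Fin 2))‖ := by
    rw [← inner_self_eq_norm_mul_norm (𝕜 := ℂ), EuclideanSpace.inner_toLp_toLp, dotProduct_comm]
    rfl
  rw [e, e2]
  calc _ ≤ _ := norm_inner_le_norm _ _
    _ ≤ ‖(WithLp.toLp 2 v : EuclideanSpace ℂ (Λ → Fin 2))‖ *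
        (‖A‖ * ‖(WithLp.toLp 2 v : EuclideanSpace ℂ (Λ → Fin 2))‖) := by
        gcongr
        exact h1
    _ = _ := by ring

/-- With ρ = B†B the trace is a sum of quadratic forms of A in the rows of B, whose squared norms
add up to tr ρ = 1. -/
theorem norm_trace_mul_state_le {ρ : Op Λ} (hρ : IsState ρ) (A : Op Λ) :
    ‖(A * ρ).trace‖ ≤ ‖A‖ := by
  obtain ⟨B, hB⟩ := CStarAlgebra.nonneg_iff_eq_star_mul_self.1 hρ.1.nonneg
  have hv : ∀ (C : Op Λ) x, (B * C * Bᴴ) x x = star (fun y => star (B x y)) ⬝ᵥ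
      (C *ᵥ fun y => star (B x y)) := by
    intro C x
    rw [Matrix.mul_assoc, Matrix.mul_apply]
    simp only [dotProduct, Pi.star_apply, star_star, Matrix.mulVec, Matrix.mul_apply,
      Matrix.conjTranspose_apply]
  have htr : ∀ C : Op Λ, (C * ρ).trace = (B * C * Bᴴ).trace := fun C => by
    rw [hB, Matrix.star_eq_conjTranspose, ← Matrix.mul_assoc, Matrix.trace_mul_comm,
      Matrix.mul_assoc]
  have h1 : ∑ x, (star (fun y => star (B x y)) ⬝ᵥ fun y => star (B x y)).re = 1 := by
    have := htr 1
    rw [one_mul, hρ.2] at this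
    rw [← Complex.re_sum]
    have h2 := congrArg Complex.re this
    rw [Complex.one_re] at h2
    rw [h2, Matrix.trace]
    congr 1
    refine Finset.sum_congr rfl fun x _ => ?_
    rw [Matrix.diag_apply, hv, Matrix.one_mulVec]
  rw [htr, Matrix.trace]
  calc _ ≤ ∑ x, ‖(B * A * Bᴴ) x x‖ := norm_sum_le _ _
    _ ≤ ∑ x, ‖A‖ * (star (fun y => star (B x y)) ⬝ᵥ fun y => star (B x y)).re :=
        Finset.sum_le_sum fun x _ => by rw [hv]; exact norm_dotProduct_mulVec_le A _
    _ = ‖A‖ := by rw [← Finset.mul_sum, h1, mul_one]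

theorem exists_traceNorm_eq {Δ : Op Λ} (hΔ : Δ.IsHermitian) :
    ∃ O : Op Λ, ‖O‖ ≤ 1 ∧ traceNorm Δ = (O * Δ).trace.re := by
  -- The optimal observable is the sign of Δ; its value at 0 is immaterial, and 1 is chosen.
  set g : ℝ → ℝ := fun x => if 0 ≤ x then 1 else -1 with hg
  have hsa : IsSelfAdjoint Δ := hΔ
  have hc : ∀ φ : ℝ → ℝ, ContinuousOn φ (spectrum ℝ Δ) := fun φ =>
    (Matrix.finite_real_spectrum (A := Δ)).continuousOn φ
  refine ⟨cfc g Δ, norm_cfc_le zero_le_one fun x _ => ?_, ?_⟩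
  · simp only [hg]
    split_ifs <;> simp
  · have h1 : CFC.sqrt (Δᴴ * Δ) = CFC.abs Δ := rfl
    have h2 : cfc (fun x : ℝ => ‖x‖) Δ = cfc g Δ * Δ := by
      conv_rhs => rw [← cfc_id ℝ Δ hsa]
      rw [cfc_id ℝ Δ hsa]
      nth_rewrite 3 [← cfc_id ℝ Δ hsa]
      rw [← cfc_mul g id Δ (hc _) (hc _)]
      congr 1
      funext x
      simp only [hg, id, Real.norm_eq_abs]
      split_ifs with h
      · rw [abs_of_nonneg h, one_mul]
      · rw [abs_of_neg (not_le.1 h), neg_one_mul]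
    rw [traceNorm, h1, CFC.abs_eq_cfc_norm Δ hsa, h2]

theorem isState_pureState {ψ : (Λ → Fin 2) → ℂ} (h : star ψ ⬝ᵥ ψ = 1) : IsState (pureState ψ) :=
  ⟨Matrix.posSemidef_vecMulVec_self_star ψ, by
    rw [pureState, Matrix.trace_vecMulVec, dotProduct_comm, h]⟩

/-! ### Duality -/

theorem dissipator_apply (K ρ : Op Λ) : dissipator K ρ =
    K * ρ * Kᴴ - (1 / 2 : ℂ) • (Kᴴ * K * ρ + ρ * (Kᴴ * K)) := by
  simp [dissipator, mul_assoc]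

theorem trace_mul_dissipator (O K ρ : Op Λ) :
    (O * dissipator K ρ).trace = (heisenberg K K O * ρ).trace := by
  have h1 : (O * (K * ρ * Kᴴ)).trace = (Kᴴ * O * K * ρ).trace := by
    rw [← Matrix.mul_assoc, Matrix.trace_mul_comm]
    simp only [Matrix.mul_assoc]
  have h2 : (O * (ρ * (Kᴴ * K))).trace = (Kᴴ * K * O * ρ).trace := by
    rw [← Matrix.mul_assoc, Matrix.trace_mul_comm]
    simp only [Matrix.mul_assoc]
  have h3 : O * (Kᴴ * K * ρ) = O * (Kᴴ * K) * ρ := by simp only [Matrix.mul_assoc]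
  rw [dissipator_apply, heisenberg, Matrix.star_eq_conjTranspose]
  simp only [mul_sub, sub_mul, mul_smul_comm, smul_mul_assoc, mul_add, add_mul,
    Matrix.trace_sub, Matrix.trace_smul, Matrix.trace_add, h1, h2, h3]
  congr 2
  rw [add_comm]

theorem lindbladian_apply (f : ℝ → ℂ) (H ρ : Op Λ) :
    lindbladian f H ρ = ∑ i, dissipator (jumpOp f H (pauliX i)) ρ := by
  simp [lindbladian]

/-- The Heisenberg picture of an Euler step of the Lindblad dynamics. -/
def heisStep (K : Λ → Op Λ) (h : ℝ) (O : Op Λ) : Op Λ :=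
  O + (h : ℂ) • ∑ j, heisenberg (K j) (K j) O

theorem trace_mul_one_add_lindbladian_pow (f : ℝ → ℂ) (H : Op Λ) (h : ℝ) (n : ℕ) (σ : Op Λ) :
    ∀ O : Op Λ, (O * ((1 + (h : ℂ) • lindbladian f H) ^ n) σ).trace =
      ((heisStep (fun j => jumpOp f H (pauliX j)) h)^[n] O * σ).trace := by
  induction n with
  | zero => intro O; simp
  | succ n ih =>
    intro O
    rw [Function.iterate_succ_apply, ← ih, pow_succ', mul_apply_eq_comp]
    set τ := ((1 + (h : ℂ) • lindbladian f H) ^ n) σ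
    rw [add_apply, one_apply_eq_self,
      smul_apply, lindbladian_apply, heisStep, mul_add, add_mul,
      Matrix.trace_add, Matrix.trace_add, mul_smul_comm, smul_mul_assoc, Matrix.trace_smul,
      Matrix.trace_smul, Finset.mul_sum, Finset.sum_mul, Matrix.trace_sum, Matrix.trace_sum]
    simp only [trace_mul_dissipator]

theorem isHermitian_dissipator (K : Op Λ) {ρ : Op Λ} (hρ : ρ.IsHermitian) :
    (dissipator K ρ).IsHermitian := by
  rw [dissipator_apply, Matrix.IsHermitian]
  simp only [Matrix.conjTranspose_sub, Matrix.conjTranspose_smul, Matrix.conjTranspose_add,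
    Matrix.conjTranspose_mul, Matrix.conjTranspose_conjTranspose, hρ.eq, Matrix.mul_assoc]
  rw [add_comm]
  simp

theorem isHermitian_one_add_lindbladian_pow (f : ℝ → ℂ) (H : Op Λ) (h : ℝ) (n : ℕ) {ρ : Op Λ}
    (hρ : ρ.IsHermitian) : (((1 + (h : ℂ) • lindbladian f H) ^ n) ρ).IsHermitian := by
  induction n with
  | zero => simpa using hρ
  | succ n ih =>
    rw [pow_succ', mul_apply_eq_comp, add_apply,
      one_apply_eq_self, smul_apply, lindbladian_apply]
    refine ih.add (IsSelfAdjoint.smul (by simp [IsSelfAdjoint]) ?_)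
    exact isSelfAdjoint_sum _ fun i _ => isHermitian_dissipator _ ih

/-- A vector annihilated by all jump operators is dark: every term of the dissipator contains Kψ or
its adjoint. -/
theorem one_add_lindbladian_pow_pureState {f : ℝ → ℂ} {H : Op Λ} {ψ : (Λ → Fin 2) → ℂ}
    (hψ : ∀ j, jumpOp f H (pauliX j) *ᵥ ψ = 0) (h : ℝ) (n : ℕ) :
    ((1 + (h : ℂ) • lindbladian f H) ^ n) (pureState ψ) = pureState ψ := by
  have hz : lindbladian f H (pureState ψ) = 0 := by
    rw [lindbladian_apply]
    refine Finset.sum_eq_zero fun j _ => ?_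
    set K := jumpOp f H (pauliX j) with hK
    have h1 : K * pureState ψ = 0 := by
      rw [pureState, Matrix.mul_vecMulVec, hψ j]; ext; simp [Matrix.vecMulVec_apply]
    have h2 : pureState ψ * Kᴴ = 0 := by
      have := congrArg Matrix.conjTranspose h1
      have hh : (pureState ψ)ᴴ = pureState ψ :=
        (Matrix.posSemidef_vecMulVec_self_star ψ).isHermitian.eq
      rw [Matrix.conjTranspose_mul, Matrix.conjTranspose_zero, hh] at this
      exact this
    rw [dissipator_apply, h1, ← Matrix.mul_assoc, h2, Matrix.mul_assoc, h1]
    simp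
  induction n with
  | zero => simp
  | succ n ih =>
    rw [pow_succ', mul_apply_eq_comp, ih, add_apply,
      one_apply_eq_self, smul_apply, hz, smul_zero, add_zero]

theorem tendsto_one_add_lindbladian_pow (f : ℝ → ℂ) (H : Op Λ) (t : ℝ) (ρ : Op Λ) :
    Filter.Tendsto (fun n : ℕ => ((1 + ((t / n : ℝ) : ℂ) • lindbladian f H) ^ n) ρ)
      Filter.atTop (nhds (evolve f H t ρ)) := by
  have h := tendsto_one_add_smul_pow ((t : ℂ) • lindbladian f H)
  have h2 := (ContinuousLinearMap.apply ℂ (Op Λ) ρ).continuous.continuousAt.tendsto.comp h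
  refine h2.congr fun n => ?_
  simp only [Function.comp_apply, ContinuousLinearMap.apply_apply, smul_smul]
  push_cast
  rw [div_eq_inv_mul]

/-! ### Convergence to the ground state -/

/-- The trace norm is tested against one observable O, which is moved through n Euler steps by
duality. The oscillation sum of O starts at most at 2N; one factor 2 more comes from testing against
two states. -/
theorem traceNorm_evolve_sub_le {f : ℝ → ℂ} {H : Op Λ} {ψ : (Λ → Fin 2) → ℂ}
    (hψ1 : star ψ ⬝ᵥ ψ = 1) (hψ : ∀ j, jumpOp f H (pauliX j) *ᵥ ψ = 0) {C : ℝ}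
    (hC : ∀ h : ℝ, 0 ≤ h → h ≤ 1 / 2 → ∀ O : Op Λ,
      ∑ i, ‖osc (lower i) (heisStep (fun j => jumpOp f H (pauliX j)) h O)‖ ≤
        (1 - h / 4 + C * h ^ 2) * ∑ i, ‖osc (lower i) O‖) (hC0 : 0 ≤ C)
    {t : ℝ} (ht : 0 ≤ t) {ρ : Op Λ} (hρ : IsState ρ) :
    traceNorm (evolve f H t ρ - pureState ψ) ≤ 4 * Fintype.card Λ * Real.exp (-t / 4) := by
  have hk := isSpinSystem_lower (Λ := Λ)
  have hlim := tendsto_one_add_lindbladian_pow f H t ρ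
  have hherm : (evolve f H t ρ - pureState ψ).IsHermitian := by
    refine Matrix.IsHermitian.sub ?_ (Matrix.posSemidef_vecMulVec_self_star ψ).isHermitian
    have h1 := (continuous_star.tendsto (evolve f H t ρ)).comp hlim
    refine tendsto_nhds_unique h1 (hlim.congr fun n => ?_)
    exact (isHermitian_one_add_lindbladian_pow f H (t / n) n hρ.1.isHermitian).eq.symm
  obtain ⟨O, hO, hOt⟩ := exists_traceNorm_eq hherm
  rw [hOt]
  set σ := ρ - pureState ψ with hσ
  have hlim2 : Filter.Tendsto (fun n : ℕ =>
      (O * ((1 + ((t / n : ℝ) : ℂ) • lindbladian f H) ^ n) σ).trace.re) Filter.atTop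
      (nhds (O * (evolve f H t ρ - pureState ψ)).trace.re) := by
    have h1 : Filter.Tendsto (fun n : ℕ => ((1 + ((t / n : ℝ) : ℂ) • lindbladian f H) ^ n) σ)
        Filter.atTop (nhds (evolve f H t ρ - pureState ψ)) := by
      refine (hlim.sub_const (pureState ψ)).congr fun n => ?_
      rw [hσ, map_sub, one_add_lindbladian_pow_pureState hψ]
    set Φ : Op Λ →ₗ[ℂ] ℂ := Matrix.traceLinearMap _ ℂ ℂ ∘ₗ LinearMap.mulLeft ℂ O with hΦ
    have hΦc : Continuous Φ := Φ.continuous_of_finiteDimensional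
    exact Complex.continuous_re.continuousAt.tendsto.comp (hΦc.continuousAt.tendsto.comp h1)
  have hosc0 : ∑ i, ‖osc (lower i) O‖ ≤ 2 * Fintype.card Λ := by
    calc _ ≤ ∑ _i : Λ, (2 : ℝ) := Finset.sum_le_sum fun i _ => by
          linarith [(hk.lowering i).norm_osc_le O]
      _ = _ := by simp [mul_comm]
  have hosc0' : 0 ≤ ∑ i, ‖osc (lower i) O‖ := Finset.sum_nonneg fun _ _ => norm_nonneg _
  have hbound : ∀ᶠ n : ℕ in Filter.atTop,
      (O * ((1 + ((t / n : ℝ) : ℂ) • lindbladian f H) ^ n) σ).trace.re ≤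
      4 * Fintype.card Λ * Real.exp (-t / 4 + C * t ^ 2 / n) := by
    filter_upwards [Filter.eventually_ge_atTop 1, Filter.eventually_ge_atTop ⌈2 * t⌉₊]
      with n hn1 hn2
    have hn0 : (0 : ℝ) < n := by exact_mod_cast hn1
    set h : ℝ := t / n with hh
    have h0 : 0 ≤ h := by positivity
    have h1 : h ≤ 1 / 2 := by
      have := Nat.ceil_le.1 hn2
      rw [hh, div_le_iff₀ hn0]
      linarith
    set S := heisStep (fun j => jumpOp f H (pauliX j)) h with hS
    have hfac : 0 ≤ 1 - h / 4 + C * h ^ 2 := by nlinarith [mul_nonneg hC0 (sq_nonneg h)]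
    have hiter : ∀ m : ℕ, ∑ i, ‖osc (lower i) (S^[m] O)‖ ≤
        (1 - h / 4 + C * h ^ 2) ^ m * ∑ i, ‖osc (lower i) O‖ := by
      intro m
      induction m with
      | zero => simp
      | succ m ih =>
        rw [Function.iterate_succ_apply', pow_succ']
        calc _ ≤ _ := hC h h0 h1 _
          _ ≤ _ := mul_le_mul_of_nonneg_left ih hfac
          _ = _ := by ring
    rw [trace_mul_one_add_lindbladian_pow]
    -- An operator commuting with all spins is a scalar, and scalars cancel between two states of
    -- trace 1.
    obtain ⟨O', hO'c, hO'⟩ := hk.exists_commutesWith_approx Finset.univ (S^[n] O)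
    obtain ⟨c, rfl⟩ := hk.irreducible O' fun i => hO'c i (Finset.mem_univ i)
    have hpure := isState_pureState hψ1
    have htr : (S^[n] O * σ).trace = ((S^[n] O - c • 1) * ρ).trace
        - ((S^[n] O - c • 1) * pureState ψ).trace := by
      simp only [hσ, mul_sub, sub_mul, Matrix.trace_sub, smul_mul_assoc, one_mul,
        Matrix.trace_smul, hρ.2, hpure.2]
      ring
    calc _ ≤ ‖(S^[n] O * σ).trace‖ := Complex.re_le_norm _
      _ ≤ ‖S^[n] O - c • 1‖ + ‖S^[n] O - c • 1‖ := by
          rw [htr]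
          exact (norm_sub_le _ _).trans
            (add_le_add (norm_trace_mul_state_le hρ _) (norm_trace_mul_state_le hpure _))
      _ ≤ 2 * ((1 - h / 4 + C * h ^ 2) ^ n * (2 * Fintype.card Λ)) := by
          have h2 := hO'.trans ((hiter n).trans (mul_le_mul_of_nonneg_left hosc0
            (pow_nonneg hfac n)))
          linarith
      -- After n steps of length t/n the second-order errors amount to C t²/n in the exponent and
      -- vanish in the limit, however large C is.
      _ ≤ 2 * (Real.exp (-h / 4 + C * h ^ 2) ^ n * (2 * Fintype.card Λ)) := by
          gcongr
          linarith [Real.add_one_le_exp (-h / 4 + C * h ^ 2)]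
      _ = _ := by
          rw [← Real.exp_nat_mul]
          have : (n : ℝ) * (-h / 4 + C * h ^ 2) = -t / 4 + C * t ^ 2 / n := by
            rw [hh]; field_simp
          rw [this]; ring
  have hlim3 : Filter.Tendsto (fun n : ℕ => 4 * Fintype.card Λ *
      Real.exp (-t / 4 + C * t ^ 2 / n)) Filter.atTop
      (nhds (4 * Fintype.card Λ * Real.exp (-t / 4))) := by
    have h1 : Filter.Tendsto (fun n : ℕ => -t / 4 + C * t ^ 2 / (n : ℝ)) Filter.atTop
        (nhds (-t / 4 + 0)) :=
      tendsto_const_nhds.add (tendsto_const_div_atTop_nhds_zero_nat _)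
    rw [add_zero] at h1
    exact (Real.continuous_exp.continuousAt.tendsto.comp h1).const_mul _
  exact le_of_tendsto_of_tendsto hlim2 hlim3 hbound

end Spin

/-! ### The ground state is annihilated by the jump operators -/

section GroundState

variable {n : Type*} [Fintype n] [DecidableEq n]

theorem exp_mulVec_of_eigenvector {M : Matrix n n ℂ} {φ : n → ℂ} {μ : ℂ} (h : M *ᵥ φ = μ • φ) :
    NormedSpace.exp M *ᵥ φ = Complex.exp μ • φ := by
  have hpow : ∀ m : ℕ, M ^ m *ᵥ φ = μ ^ m • φ := by
    intro m
    induction m with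
    | zero => simp
    | succ m ih => rw [pow_succ, ← Matrix.mulVec_mulVec, h, Matrix.mulVec_smul, ih, smul_smul,
        pow_succ']
  let T : Matrix n n ℂ →ₗ[ℂ] (n → ℂ) :=
    { toFun := fun A => A *ᵥ φ
      map_add' := fun A B => Matrix.add_mulVec A B φ
      map_smul' := fun c A => Matrix.smul_mulVec c A φ }
  have h1 := (NormedSpace.exp_series_hasSum_exp' (𝕂 := ℂ) M).mapL T.toContinuousLinearMap
  have h2 := (NormedSpace.exp_series_hasSum_exp' (𝕂 := ℂ) μ).smul_const φ
  have h3 : (fun m : ℕ => T.toContinuousLinearMap (((m.factorial : ℂ)⁻¹) • M ^ m)) =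
      fun m : ℕ => (((m.factorial : ℂ)⁻¹) • μ ^ m) • φ := by
    ext1 m
    change (((m.factorial : ℂ)⁻¹) • M ^ m) *ᵥ φ = _
    rw [Matrix.smul_mulVec, hpow, smul_eq_mul, smul_smul]
  rw [h3] at h1
  rw [Complex.exp_eq_exp_ℂ]
  exact h1.unique h2

theorem exp_smul_mulVec_of_eigenvector {M : Matrix n n ℂ} {φ : n → ℂ} {μ : ℂ}
    (h : M *ᵥ φ = μ • φ) (z : ℂ) :
    NormedSpace.exp (z • M) *ᵥ φ = Complex.exp (z * μ) • φ :=
  exp_mulVec_of_eigenvector (by rw [Matrix.smul_mulVec, h, smul_smul])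

theorem star_dotProduct_exp_smul_mulVec {M : Matrix n n ℂ} (hM : M.IsHermitian) {φ : n → ℂ}
    {μ : ℝ} (h : M *ᵥ φ = (μ : ℂ) • φ) (z : ℂ) (w : n → ℂ) :
    star φ ⬝ᵥ (NormedSpace.exp (z • M) *ᵥ w) = Complex.exp (z * μ) * (star φ ⬝ᵥ w) := by
  have h1 := exp_smul_mulVec_of_eigenvector h (star z)
  have h2 : (NormedSpace.exp (z • M))ᴴ = NormedSpace.exp (star z • M) := by
    rw [← Matrix.exp_conjTranspose, Matrix.conjTranspose_smul, hM.eq]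
  have h3 := congrArg star h1
  rw [← h2, Matrix.star_mulVec, Matrix.conjTranspose_conjTranspose] at h3
  rw [Matrix.dotProduct_mulVec, h3, star_smul, smul_dotProduct, smul_eq_mul]
  congr 1
  rw [Complex.star_def, ← Complex.exp_conj]
  simp

theorem eq_zero_of_forall_eigenvector {H : Matrix n n ℂ} (hH : H.IsHermitian) {w : n → ℂ}
    (h : ∀ (μ : ℝ) (φ : n → ℂ), φ ≠ 0 → H *ᵥ φ = (μ : ℂ) • φ → star φ ⬝ᵥ w = 0) : w = 0 := by
  have hz : WithLp.toLp 2 w = 0 := by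
    refine InnerProductSpace.ext_inner_left_basis (𝕜 := ℂ) hH.eigenvectorBasis.toBasis fun i => ?_
    rw [inner_zero_right, OrthonormalBasis.coe_toBasis, EuclideanSpace.inner_eq_star_dotProduct,
      dotProduct_comm]
    refine h (hH.eigenvalues i) _ ?_ ?_
    · intro h0
      exact hH.eigenvectorBasis.orthonormal.ne_zero i ((WithLp.ofLp_eq_zero 2).1 h0)
    · simpa using hH.mulVec_eigenvectorBasis i
  simpa using hz

end GroundState

section Spin

open MeasureTheory

variable {Λ : Type} [Fintype Λ] [DecidableEq Λ]

/-- In the energy eigenbasis ⟨φ|K|ψ⟩ = f̂(μ - E)⟨φ|A|ψ⟩, and μ ≥ E for every eigenvalue. Neither a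
gap nor uniqueness of ψ enters. -/
theorem FilterAssumption.jumpOp_mulVec_groundState {α A₁u A₂u A₁v A₂v : ℝ} {u : ℝ → ℝ}
    {v : ℝ → ℂ} (hf : FilterAssumption α A₁u A₂u A₁v A₂v u v) {H : Op Λ} (hH : H.IsHermitian)
    {ψ : (Λ → Fin 2) → ℂ} (hψ : IsGroundState H ψ) (A : Op Λ) :
    jumpOp (filterTime u v) H A *ᵥ ψ = 0 := by
  obtain ⟨-, E, hE, hmin⟩ := hψ
  refine eq_zero_of_forall_eigenvector hH fun μ φ hφ0 hφ => ?_
  let T : Op Λ →ₗ[ℂ] ℂ :=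
    { toFun := fun B => star φ ⬝ᵥ (B *ᵥ ψ)
      map_add' := fun B B' => by rw [Matrix.add_mulVec, dotProduct_add]
      map_smul' := fun c B => by rw [Matrix.smul_mulVec, dotProduct_smul]; rfl }
  have hintegr : Integrable fun s => filterTime u v s • heisEvo H s A :=
    integrable_smul_of_norm_le hf.continuous_filterTime (hf.filterTime_moment 0).1
      (continuous_heisEvo H A) (c := ‖A‖) fun s => by
        rw [norm_heisEvo hH, pow_zero, mul_one]
  have hcomm := T.toContinuousLinearMap.integral_comp_comm hintegr
  change ∫ s, star φ ⬝ᵥ ((filterTime u v s • heisEvo H s A) *ᵥ ψ) =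
    star φ ⬝ᵥ (jumpOp (filterTime u v) H A *ᵥ ψ) at hcomm
  rw [← hcomm]
  have hpt : ∀ s : ℝ, star φ ⬝ᵥ ((filterTime u v s • heisEvo H s A) *ᵥ ψ) =
      filterTime u v s * Complex.exp (Complex.I * ((μ - E : ℝ) : ℂ) * s) *
        (star φ ⬝ᵥ (A *ᵥ ψ)) := by
    intro s
    rw [Matrix.smul_mulVec, dotProduct_smul, heisEvo, ← Matrix.mulVec_mulVec,
      ← Matrix.mulVec_mulVec, exp_smul_mulVec_of_eigenvector hE,
      star_dotProduct_exp_smul_mulVec hH hφ, Matrix.mulVec_smul, dotProduct_smul, smul_eq_mul,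
      smul_eq_mul, ← mul_assoc (Complex.exp _), ← Complex.exp_add, ← mul_assoc]
    congr 3
    push_cast
    ring
  simp only [hpt]
  rw [integral_mul_const, hf.integral_filterTime_mul_exp,
    hf.filterHat_of_nonneg (sub_nonneg.2 (hmin μ φ hφ0 hφ)), zero_mul]

end Spin

/-! ### The lattice Hamiltonian is weakly coupled -/

section Lattice

variable {D L : ℕ}

theorem IsGeometricallyLocal.isWeaklyCoupled {periodic : Bool} {r l : ℕ}
    {h : Site D L → Op (Site D L)} (hh : IsGeometricallyLocal periodic r l h)
    (hn : ∀ j, ‖h j‖ ≤ 1) (ε : ℝ) :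
    IsWeaklyCoupled lower (manhattanDist periodic) (hamiltonian ε h) (fun j => (ε : ℂ) • h j)
      |ε| l r where
  eq := by simp only [hamiltonian, pauliZ_eq, Finset.smul_sum]
  selfAdjoint j := IsSelfAdjoint.smul (by simp [IsSelfAdjoint]) (hh.hermitian j)
  localized j i hi := commutesWith_lower fun M =>
    (commute_onSite_of_isSupportedOn (hh.supported j)
      (fun h' => hi (mem_ballOf.2 h')) M).smul_left _
  norm_le j := by
    rw [norm_smul, Complex.norm_real, Real.norm_eq_abs]
    exact mul_le_of_le_one_right (abs_nonneg _) (hn j)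
  overlap m := by
    classical
    refine ⟨Finset.univ.filter fun j => ActsOn m (h j), ?_, fun j hj => ?_⟩
    · rw [← Set.ncard_coe_finset]
      simpa using hh.overlap m
    · have hs : IsSupportedOn {m}ᶜ (h j) := by
        by_contra hs
        exact hj (Finset.mem_filter.2 ⟨Finset.mem_univ j, hs⟩)
      exact commutesWith_lower fun M =>
        (commute_onSite_of_isSupportedOn hs (by simp) M).smul_left _

theorem IsGeometricallyLocal.isHermitian_hamiltonian {periodic : Bool} {r l : ℕ}
    {h : Site D L → Op (Site D L)} (hh : IsGeometricallyLocal periodic r l h)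
    (hn : ∀ j, ‖h j‖ ≤ 1) (ε : ℝ) : (hamiltonian ε h).IsHermitian :=
  (hh.isWeaklyCoupled hn ε).isSelfAdjoint

end Lattice

/-! ### Rapid mixing -/

section Mixing

open MeasureTheory

variable {α A₁u A₂u A₁v A₂v : ℝ} {u : ℝ → ℝ} {v : ℝ → ℂ}

theorem FilterAssumption.traceNorm_evolve_sub_groundState_le
    (hf : FilterAssumption α A₁u A₂u A₁v A₂v u v) {D L r l : ℕ} {periodic : Bool}
    {h : Site D L → Op (Site D L)} (hh : IsGeometricallyLocal periodic r l h)
    (hn : ∀ j, ‖h j‖ ≤ 1) (hr : 1 ≤ r) {ε M x : ℝ}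
    (hM : filterMomentBound α A₁u A₂u A₁v A₂v (3 * (2 * D) + 1) ≤ M)
    (hw1 : 4 * Real.exp 1 * |ε| * l * (8 ^ D * (1 + (r : ℝ)) ^ (2 * D)) ≤ 1)
    (hx : M * (12 * |ε| * l + 8 ^ D * (2 * Real.exp 1 * (3 * (2 * D)).factorial *
      (4 * Real.exp 1 * |ε| * l * (8 ^ D * (1 + (r : ℝ)) ^ (2 * D))) *
        (2 * r) ^ (3 * (2 * D)))) ≤ x)
    (hsmall : 4 * (8 ^ D : ℝ) ^ 2 * (2 * x + x ^ 2) ≤ 1 / 4)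
    {ψ : (Site D L → Fin 2) → ℂ} (hψ : IsGroundState (hamiltonian ε h) ψ) {t : ℝ} (ht : 0 ≤ t)
    {ρ : Op (Site D L)} (hρ : IsState ρ) :
    traceNorm (evolve (filterTime u v) (hamiltonian ε h) t ρ - pureState ψ) ≤
      4 * ((L : ℝ) + 1) ^ D * Real.exp (-t / 4) := by
  have hd := hasPolyGrowth_manhattanDist periodic D L
  have hk := isSpinSystem_lower (Λ := Site D L)
  have hmom := hf.filterTime_moment (3 * (2 * D) + 1)
  have hf1 : ∫ s, filterTime u v s * Complex.exp (-2 * Complex.I * s) = 1 := by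
    have h1 := hf.integral_filterTime_mul_exp (-2)
    rw [hf.filterHat_neg_two] at h1
    rw [← h1]
    congr 1 with s
    push_cast
    ring_nf
  have hf2 : ∫ s, filterTime u v s * Complex.exp (2 * Complex.I * s) = 0 := by
    have h1 := hf.integral_filterTime_mul_exp 2
    rw [hf.filterHat_of_nonneg (by norm_num)] at h1
    rw [← h1]
    congr 1 with s
    push_cast
    ring_nf
  have hjump := fun j => ((hh.isWeaklyCoupled hn ε).jump_bound hk hd hr (abs_nonneg ε) hw1
    hf.continuous_filterTime hmom.1 (hmom.2.trans hM) hf1 hf2 j).trans hx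
  have hK : ∀ j : Site D L, (∫ s, filterTime u v s •
      heisEvo (hamiltonian ε h) s (lower j + star (lower j))) =
      jumpOp (filterTime u v) (hamiltonian ε h) (pauliX j) := fun j => by
    rw [pauliX_eq]; rfl
  simp only [hK] at hjump
  obtain ⟨C, hC0, hC⟩ := hk.exists_sum_norm_osc_le hd
    (fun j => jumpOp (filterTime u v) (hamiltonian ε h) (pauliX j)) hjump hsmall
  have hfin := traceNorm_evolve_sub_le hψ.1
    (fun j => hf.jumpOp_mulVec_groundState (hh.isHermitian_hamiltonian hn ε) hψ (pauliX j))
    hC hC0 ht hρ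
  simpa using hfin

/-- The time 12 log(N/η) yields three factors η/N: one supplies the target accuracy, and the other
two absorb the 4 because N/η ≥ 2. -/
theorem four_mul_mul_exp_le {N η t : ℝ} (hN : 2 ≤ N) (hη : 0 < η) (hη1 : η ≤ 1)
    (ht : 12 * Real.log (N / η) ≤ t) : 0 ≤ t ∧ 4 * N * Real.exp (-t / 4) ≤ η := by
  have hy : 2 ≤ N / η := by rw [le_div_iff₀ hη]; nlinarith
  have hy0 : 0 < N / η := by linarith
  have hl : 0 ≤ Real.log (N / η) := Real.log_nonneg (by linarith)
  refine ⟨by linarith, ?_⟩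
  have h1 : Real.exp (-t / 4) ≤ ((N / η) ^ 3)⁻¹ := by
    calc _ ≤ Real.exp (-(3 * Real.log (N / η))) := Real.exp_le_exp.2 (by linarith)
      _ = _ := by
        rw [Real.exp_neg, show (3 : ℝ) = ((3 : ℕ) : ℝ) by norm_num, Real.exp_nat_mul,
          Real.exp_log hy0]
  have h2 : 4 * (N / η) ≤ (N / η) ^ 3 := by nlinarith [mul_le_mul hy hy (by norm_num) hy0.le]
  calc _ ≤ 4 * N * ((N / η) ^ 3)⁻¹ := by gcongr
    _ = η * (4 * (N / η) * ((N / η) ^ 3)⁻¹) := by field_simp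
    _ ≤ η * 1 := by
      gcongr
      rw [← div_eq_mul_inv, div_le_one (by positivity)]
      exact h2
    _ = η := mul_one η

/-- All smallness conditions on the coupling follow from one on `e (r l)^(8 D)`. -/
theorem exists_coupling_threshold {M : ℝ} (hM : 0 < M) {D : ℕ} (hD : 1 ≤ D) :
    ∃ c : ℝ, 0 < c ∧ ∀ (r l : ℕ), 1 ≤ r → 1 ≤ l → ∀ e : ℝ, 0 ≤ e →
      e < c * ((r : ℝ) * (l : ℝ)) ^ (-(8 * (D : ℝ))) →
      4 * Real.exp 1 * e * l * (8 ^ D * (1 + (r : ℝ)) ^ (2 * D)) ≤ 1 ∧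
      ∃ x : ℝ, M * (12 * e * l + 8 ^ D * (2 * Real.exp 1 * (3 * (2 * D)).factorial *
        (4 * Real.exp 1 * e * l * (8 ^ D * (1 + (r : ℝ)) ^ (2 * D))) *
          (2 * r) ^ (3 * (2 * D)))) ≤ x ∧ 4 * (8 ^ D : ℝ) ^ 2 * (2 * x + x ^ 2) ≤ 1 / 4 := by
  set G : ℝ := 8 ^ D with hG
  have hG1 : 1 ≤ G := one_le_pow₀ (by norm_num)
  set F : ℝ := ((3 * (2 * D)).factorial : ℝ) with hF
  have hF0 : 0 < F := by positivity
  set c₁ : ℝ := M * (12 + 8 * Real.exp 1 ^ 2 * G ^ 2 * F * 2 ^ (8 * D)) with hc₁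
  have hc₁0 : 0 < c₁ := by positivity
  set c₂ : ℝ := 4 * Real.exp 1 * G * 2 ^ (2 * D) with hc₂
  have hc₂0 : 0 < c₂ := by positivity
  -- The power 8D of r is 2D from the volume of the balls plus 6D from the factor (2r)^(6D) in the
  -- Lieb–Robinson bound. A single power of l is needed, and l ≤ l^(8D).
  refine ⟨min (1 / (48 * G ^ 2 * c₁)) (1 / c₂), by positivity, ?_⟩
  intro r l hr hl e he hlt
  have hr' : (1 : ℝ) ≤ r := by exact_mod_cast hr
  have hl' : (1 : ℝ) ≤ l := by exact_mod_cast hl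
  set y : ℝ := e * ((r : ℝ) ^ (8 * D) * l) with hy
  have hy0 : 0 ≤ y := by positivity
  have hyc : y ≤ min (1 / (48 * G ^ 2 * c₁)) (1 / c₂) := by
    have hrl : (0 : ℝ) < r * l := by positivity
    have hp : ((r : ℝ) * l) ^ (-(8 * (D : ℝ))) = (((r : ℝ) * l) ^ (8 * D))⁻¹ := by
      rw [Real.rpow_neg hrl.le, ← Real.rpow_natCast]
      push_cast
      rfl
    rw [hp, ← div_eq_mul_inv, lt_div_iff₀ (by positivity), mul_pow] at hlt
    refine le_trans ?_ hlt.le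
    rw [hy]
    gcongr
    exact le_self_pow₀ hl' (by omega)
  have hy1 := hyc.trans (min_le_left _ _)
  have hy2 := hyc.trans (min_le_right _ _)
  have hr1 : 1 + (r : ℝ) ≤ 2 * r := by linarith
  have hb : (1 + (r : ℝ)) ^ (2 * D) ≤ 2 ^ (2 * D) * (r : ℝ) ^ (2 * D) := by
    rw [← mul_pow]; gcongr
  have he8 : e * l ≤ y := by
    rw [hy]
    gcongr
    exact le_mul_of_one_le_left (by positivity) (one_le_pow₀ hr')
  refine ⟨?_, c₁ * y, ?_, ?_⟩
  · calc _ ≤ 4 * Real.exp 1 * e * l * (G * (2 ^ (2 * D) * (r : ℝ) ^ (8 * D))) := by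
          gcongr
          refine hb.trans ?_
          gcongr
          norm_num
      _ = c₂ * y := by rw [hc₂, hy]; ring
      _ ≤ c₂ * (1 / c₂) := by gcongr
      _ = 1 := by field_simp
  · calc _ ≤ M * (12 * y + G * (2 * Real.exp 1 * F *
          (4 * Real.exp 1 * e * l * (G * (2 ^ (2 * D) * (r : ℝ) ^ (2 * D)))) *
            (2 * r) ^ (3 * (2 * D)))) := by
          rw [mul_assoc 12 e]
          gcongr
      _ = c₁ * y := by
          have h1 : (2 * (r : ℝ)) ^ (3 * (2 * D)) =
            2 ^ (3 * (2 * D)) * (r : ℝ) ^ (3 * (2 * D)) := mul_pow _ _ _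
          have h2 : (2 : ℝ) ^ (8 * D) = 2 ^ (2 * D) * 2 ^ (3 * (2 * D)) := by
            rw [← pow_add]; congr 1; omega
          have h3 : (r : ℝ) ^ (8 * D) = (r : ℝ) ^ (2 * D) * (r : ℝ) ^ (3 * (2 * D)) := by
            rw [← pow_add]; congr 1; omega
          rw [h1, hc₁, h2, hy, h3]
          ring
  -- With x = c₁ y ≤ 1/(48 G²) ≤ 1 one has 2x + x² ≤ 3x, and 4 G² · 3/(48 G²) = 1/4.
  · have hz0 : 0 ≤ c₁ * y := by positivity
    have hz : c₁ * y ≤ 1 / (48 * G ^ 2) := by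
      calc _ ≤ c₁ * (1 / (48 * G ^ 2 * c₁)) := by gcongr
        _ = _ := by field_simp
    have hz1 : c₁ * y ≤ 1 := hz.trans (by
      rw [div_le_one (by positivity)]
      nlinarith)
    calc _ ≤ 4 * G ^ 2 * (3 * (c₁ * y)) := by gcongr; nlinarith
      _ ≤ 4 * G ^ 2 * (3 * (1 / (48 * G ^ 2))) := by gcongr
      _ = 1 / 4 := by field_simp; norm_num

end Mixing

end GroundStatePrep

end

/-! ### The main theorem. -/

theorem mainTheorem1 :
    ∃ a C : ℝ, 0 < a ∧ 0 < C ∧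
      ∀ α A₁u A₂u A₁v A₂v : ℝ, 1 < α → 0 < A₁u → 0 < A₂u → 0 < A₁v → 0 < A₂v →
      ∀ D : ℕ, 1 ≤ D → ∃ c : ℝ, 0 < c ∧
      ∀ r₀ l : ℕ, 1 ≤ r₀ → 1 ≤ l → ∃ εstar : ℝ,
        εstar = c * ((r₀ : ℝ) * (l : ℝ)) ^ (-(a * (D : ℝ))) ∧
        ∀ (u : ℝ → ℝ) (v : ℝ → ℂ),
          GroundStatePrep.FilterAssumption α A₁u A₂u A₁v A₂v u v →
        ∀ L : ℕ, 1 ≤ L → ∀ (periodic : Bool)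
          (h : GroundStatePrep.Site D L → GroundStatePrep.Op (GroundStatePrep.Site D L)),
          GroundStatePrep.IsGeometricallyLocal periodic r₀ l h → (∀ j, ‖h j‖ ≤ 1) →
        ∀ ε : ℝ, |ε| < εstar →
        ∀ ψ₀, GroundStatePrep.IsGroundState (GroundStatePrep.hamiltonian ε h) ψ₀ →
        ∀ η : ℝ, 0 < η → η ≤ 1 →
        ∀ t : ℝ, C * Real.log (((L : ℝ) + 1) ^ D / η) ≤ t →
        ∀ ρ, GroundStatePrep.IsState ρ →
          GroundStatePrep.traceNorm
            (GroundStatePrep.evolve (GroundStatePrep.filterTime u v)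
                (GroundStatePrep.hamiltonian ε h) t ρ
              - GroundStatePrep.pureState ψ₀) ≤ η := by
  refine ⟨8, 12, by norm_num, by norm_num, ?_⟩
  intro α A₁u A₂u A₁v A₂v _ _ _ _ _ D hD
  -- M depends only on the Gevrey constants and D, hence so does the threshold c. The maximum with 1
  -- makes M positive.
  set M := max 1 (GroundStatePrep.filterMomentBound α A₁u A₂u A₁v A₂v (3 * (2 * D) + 1)) with hM
  obtain ⟨c, hc, hthr⟩ :=
    GroundStatePrep.exists_coupling_threshold (M := M) (lt_max_of_lt_left one_pos) hD
  refine ⟨c, hc, fun r₀ l hr hl => ⟨_, rfl, ?_⟩⟩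
  intro u v hf L hL periodic h hh hn ε hε ψ₀ hψ η hη hη1 t ht ρ hρ
  obtain ⟨hw1, x, hx, hsmall⟩ := hthr r₀ l hr hl |ε| (abs_nonneg ε) hε
  have hN : (2 : ℝ) ≤ ((L : ℝ) + 1) ^ D := by
    have h1 : (1 : ℝ) ≤ L := by exact_mod_cast hL
    calc (2 : ℝ) ≤ (L : ℝ) + 1 := by linarith
      _ ≤ _ := le_self_pow₀ (by linarith) (by omega)
  obtain ⟨ht0, hfin⟩ := GroundStatePrep.four_mul_mul_exp_le hN hη hη1 ht
  exact (hf.traceNorm_evolve_sub_groundState_le hh hn hr (le_max_right _ _) hw1 hx hsmall hψ ht0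
    hρ).trans hfin
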